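/- **Setting.** Let $\Omega\subset\mathbb R^d$, $d\ge 1$, be a bounded domain, $V\subset H^1(\Omega)$ a closed subspace and $a:V\times V\to\mathbb R$ a symmetric bilinear form with $|a(u,v)|\le C_{\rm cont}\|u\|_{H^1(\Omega)}\|v\|_{H^1(\Omega)}$ and $a(u,u)\ge c_{\rm coer}\|u\|_{H^1(\Omega)}^2$, $c_{\rm coer}>0$. Fix $m\ge1$, $\nu\in[0,\tfrac12]$ and constants $h_0$, $C_{\rm eq}>0$, $C_{\rm inv}$, $C_{\rm qu}$; $\|\cdot\|$ is the norm of $L^2(\Omega)$. Let $\mathcal T$ be a conforming simplicial mesh of $\Omega$ with a nonempty coarse part $\mathcal T_c\subset\mathcal T$ and fine part $\mathcal T_f=\mathcal T\setminus\mathcal T_c$; let $h_\tau=\operatorname{diam}\tau$, $h=\max_{\tau\in\mathcal T}h_\tau=\max_{\tau\in\mathcal T_c}h_\tau=:h_c$, and let $\Omega_c,\Omega_f$ be the open interiors of $\bigcup_{\tau\in\mathcal T_c}\tau$, $\bigcup_{\tau\in\mathcal T_f}\tau$. Let $S_{\mathcal T}^m$ be the space of continuous, piecewise polynomial functions of total degree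 $\le m$, with nodal (Lagrange) basis $b_z$, and $S=S_{\mathcal T}^m\cap V$; the $b_z\in V$ are assumed to form a basis of $S$, and $\Sigma$ is the set of their nodal points $z$. Put $\Sigma_f=\Sigma\cap\overline{\Omega_f}$, $\Sigma_c=\Sigma\setminus\Sigma_f$, and let $\Pi_f,\Pi_c$ be the projections belonging to $S=\operatorname{span}\{b_z:z\in\Sigma_c\}\oplus\operatorname{span}\{b_z:z\in\Sigma_f\}$. With weights $d_z>0$ let $(u,v)_{\mathcal T}=\sum_{z\in\Sigma}d_zu(z)v(z)$, $\|u\|_{\mathcal T}=(u,u)_{\mathcal T}^{1/2}$, and define $A^S:S\to S$ by $(A^Su,v)_{\mathcal T}=a(u,v)$ for all $u,v\in S$. For $f:[0,T]\to L^2(\Omega)$ define $f_S:[0,T]\to S$ by $(f_S(t),v)_{\mathcal T}=(f(t),v)_{L^2(\Omega)}$ for all $v\in S$. For $U_0,V_0\in S$ (the discrete initial data) let $u_S:[0,T]\to S$ solve $$(\ddot u_S,v)_{\mathcal T}+a(u_S,v)=(f_S,v)_{\mathcal T}\quad\forall v\in S,\ 0<t\le T,\qquad u_S(0)=U_0,\quad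 \dot u_S(0)=V_0 .$$ **Scheme.** Let $p\ge 2$, $N\ge1$, $\Delta t=T/N$, $t_n=n\Delta t$. With the Chebyshev polynomials $T_k,U_k$ of the first and second kind put $\delta=1+\nu/p^2$, $\omega=2T_p'(\delta)/T_p(\delta)$, $\beta^{(k,\ell)}=T_{k+\ell}(\delta)/T_{k+1}(\delta)$, $\gamma^{(k)}=(p-k)\beta^{(k,p-k)}/U_{p-1-k}(\delta)$. The LF-LTS($\nu$) solution is $u_S^{(0)}=U_0$, $u_S^{(1)}=U_0+\Delta t\,V_0+\tfrac{\Delta t^2}{2}\left(f_S(0)-A^SU_0\right)$ and, for $n\ge1$, $u_S^{(n+1)}=-u_S^{(n-1)}+2z_p$, where, with $f_k=f_S(t_n+\tfrac kp\Delta t)$ and $w=\Pi_cf_0-A^S\Pi_cu_S^{(n)}$, $$z_0=u_S^{(n)},\qquad z_1=z_0+\tfrac12\left(\tfrac{\Delta t}{p}\right)^2\left(\tfrac{2p^2}{\omega}\beta^{(0,0)}\left(w-A^S\Pi_fz_0\right)+\gamma^{(0)}\Pi_ff_0\right),$$ $$z_{k+1}=(1+\beta^{(k,-1)})z_k-\beta^{(k,-1)}z_{k-1}+\left(\tfrac{\Delta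 t}{p}\right)^2\left(\tfrac{2p^2}{\omega}\beta^{(k,0)}\left(w-A^S\Pi_fz_k\right)+\gamma^{(k)}\tfrac12\Pi_f(f_k+f_{-k})\right),\quad 1\le k\le p-1 .$$ The split-LFC variant is obtained by taking $w=f_0-A^S\Pi_cu_S^{(n)}$ and $\gamma^{(k)}=0$ for all $k$. **Theorem.** There is a constant $C$, depending only on $\Omega,V,a,C_{\rm cont},c_{\rm coer},m,\nu,h_0,C_{\rm eq},C_{\rm inv},C_{\rm qu}$ (hence independent of $n,\Delta t,T,h,p,u_S,f_S$), such that the following holds for all data as above with $T>0$. Assume * $h\le h_0$; * $C_{\rm eq}^{-1}\|u\|_{\mathcal T}\le\|u\|\le C_{\rm eq}\|u\|_{\mathcal T}$ for all $u\in S$; * $h_c\le C_{\rm qu}h_\tau$ for all $\tau\in\mathcal T_c$, and $h_c/h_\tau\le C_{\rm qu}\,p$ for all $\tau\in\mathcal T$; * the CFL condition $\left(3+\tfrac{C_{\rm cont}}{c_{\rm coer}}\right)C_{\rm cont}C_{\rm inv}^2\left(\tfrac{\Delta t}{h_c}\right)^2\le\tfrac{\nu}{\nu+1}$, where $C_{\rm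 inv}$ is a constant in the inverse inequalities $\|u\|_{H^1(\Omega_c)}\le C_{\rm inv}h_c^{-1}\|u\|_{\mathcal T}$ and $\|u\|_{H^1(\Omega)}\le C_{\rm inv}\tfrac{p}{h_c}\|u\|_{\mathcal T}$ for all $u\in S$; * $u_S\in W^{5,\infty}(0,T;L^2(\Omega))$, and $f_S\in W^{3,\infty}(0,T;L^2(\Omega))$ (its continuous representative). Then, for all $n\ge 0$ with $n+1\le N$, $$\left\|u_S(t_{n+1})-u_S^{(n+1)}\right\|\le C\,\Delta t^2\,(1+T)\,\mathcal M(u_S,f_S),$$ $$\mathcal M(u_S,f_S)=\max\left\{\max_{2\le\ell\le5}\|\partial_t^\ell u_S\|_{L^\infty(0,T;L^2(\Omega))},\ \max_{0\le\ell\le3}\|\partial_t^\ell f_S\|_{L^\infty(0,T;L^2(\Omega))}\right\},$$ and the same estimate, with the same $C$, holds for the split-LFC variant. -/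

import Mathlib

open MeasureTheory Set
open scoped ContDiff

noncomputable section

namespace LFLTS

/-! ### Function spaces on a domain -/

/-- Euclidean space `ℝᵈ`. -/
abbrev E (d : ℕ) := EuclideanSpace ℝ (Fin d)

/-- The space `L²(Ω)`. -/
abbrev L2 {d : ℕ} (Ω : Set (E d)) := Lp ℝ 2 (volume.restrict Ω)

/-- `g` is the weak partial derivative `∂ᵢ u` on `Ω`. -/
def IsWeakPartial {d : ℕ} (Ω : Set (E d)) (i : Fin d) (u g : L2 Ω) : Prop :=
  ∀ φ : E d → ℝ, ContDiff ℝ ∞ φ → HasCompactSupport φ → tsupport φ ⊆ Ω →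
    ∫ x in Ω, u x * fderiv ℝ φ x (EuclideanSpace.single i 1) = -∫ x in Ω, g x * φ x

theorem integrable_mul_of_test {d : ℕ} {Ω : Set (E d)} (u : L2 Ω) {ψ : E d → ℝ}
    (hc : Continuous ψ) (hs : HasCompactSupport ψ) :
    Integrable (fun x => u x * ψ x) (volume.restrict Ω) := by
  have h1 : MemLp ψ 2 (volume.restrict Ω) := (hc.memLp_of_hasCompactSupport hs)
  exact (Lp.memLp u).integrable_mul h1

theorem continuous_test_deriv {d : ℕ} {φ : E d → ℝ} (h : ContDiff ℝ ∞ φ) (e : E d) :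
    Continuous (fun x => fderiv ℝ φ x e) :=
  (h.continuous_fderiv (by simp)).clm_apply continuous_const

theorem hasCompactSupport_test_deriv {d : ℕ} {φ : E d → ℝ} (h : HasCompactSupport φ) (e : E d) :
    HasCompactSupport (fun x => fderiv ℝ φ x e) :=
  h.fderiv_apply (𝕜 := ℝ) e

theorem IsWeakPartial.add {d : ℕ} {Ω : Set (E d)} {i : Fin d} {u g u' g' : L2 Ω}
    (h : IsWeakPartial Ω i u g) (h' : IsWeakPartial Ω i u' g') :
    IsWeakPartial Ω i (u + u') (g + g') := by
  intro φ h1 h2 h3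
  have e1 : ∫ x in Ω, (u + u') x * fderiv ℝ φ x (EuclideanSpace.single i 1) =
      ∫ x in Ω, (u x * fderiv ℝ φ x (EuclideanSpace.single i 1) +
        u' x * fderiv ℝ φ x (EuclideanSpace.single i 1)) := by
    refine integral_congr_ae ?_
    filter_upwards [Lp.coeFn_add u u'] with x hx
    rw [hx, Pi.add_apply, add_mul]
  have e2 : ∫ x in Ω, (g + g') x * φ x = ∫ x in Ω, (g x * φ x + g' x * φ x) := by
    refine integral_congr_ae ?_
    filter_upwards [Lp.coeFn_add g g'] with x hx
    rw [hx, Pi.add_apply, add_mul]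
  rw [e1, e2, integral_add, integral_add, h φ h1 h2 h3, h' φ h1 h2 h3]
  · ring
  · exact integrable_mul_of_test g h1.continuous h2
  · exact integrable_mul_of_test g' h1.continuous h2
  · exact integrable_mul_of_test u (continuous_test_deriv h1 _) (hasCompactSupport_test_deriv h2 _)
  · exact integrable_mul_of_test u' (continuous_test_deriv h1 _) (hasCompactSupport_test_deriv h2 _)

theorem IsWeakPartial.smul {d : ℕ} {Ω : Set (E d)} {i : Fin d} {u g : L2 Ω}
    (h : IsWeakPartial Ω i u g) (c : ℝ) : IsWeakPartial Ω i (c • u) (c • g) := by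
  intro φ h1 h2 h3
  have e1 : ∫ x in Ω, (c • u) x * fderiv ℝ φ x (EuclideanSpace.single i 1) =
      ∫ x in Ω, c * (u x * fderiv ℝ φ x (EuclideanSpace.single i 1)) := by
    refine integral_congr_ae ?_
    filter_upwards [Lp.coeFn_smul c u] with x hx
    rw [hx, Pi.smul_apply, smul_eq_mul, mul_assoc]
  have e2 : ∫ x in Ω, (c • g) x * φ x = ∫ x in Ω, c * (g x * φ x) := by
    refine integral_congr_ae ?_
    filter_upwards [Lp.coeFn_smul c g] with x hx
    rw [hx, Pi.smul_apply, smul_eq_mul, mul_assoc]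
  rw [e1, e2, integral_const_mul, integral_const_mul, h φ h1 h2 h3]
  ring

theorem IsWeakPartial.zero {d : ℕ} {Ω : Set (E d)} {i : Fin d} :
    IsWeakPartial Ω i (0 : L2 Ω) (0 : L2 Ω) := by
  intro φ h1 h2 h3
  have e1 : ∫ x in Ω, (0 : L2 Ω) x * fderiv ℝ φ x (EuclideanSpace.single i 1) = 0 := by
    refine integral_eq_zero_of_ae ?_
    filter_upwards [Lp.coeFn_zero ℝ 2 (volume.restrict Ω)] with x hx
    rw [hx, Pi.zero_apply]
    exact zero_mul _
  have e2 : ∫ x in Ω, (0 : L2 Ω) x * φ x = 0 := by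
    refine integral_eq_zero_of_ae ?_
    filter_upwards [Lp.coeFn_zero ℝ 2 (volume.restrict Ω)] with x hx
    rw [hx, Pi.zero_apply]
    exact zero_mul _
  rw [e1, e2, neg_zero]

theorem IsWeakPartial.unique {d : ℕ} {Ω : Set (E d)} (hΩ : IsOpen Ω) {i : Fin d}
    {u g g' : L2 Ω} (h : IsWeakPartial Ω i u g) (h' : IsWeakPartial Ω i u g') : g = g' := by
  have hloc : LocallyIntegrableOn (fun x => g x - g' x) Ω := by
    rw [locallyIntegrableOn_iff hΩ.isLocallyClosed]
    intro K hK hKc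
    have hf : IsFiniteMeasure ((volume.restrict Ω).restrict K) :=
      ⟨by
        rw [Measure.restrict_apply_univ]
        exact (Measure.restrict_apply_le _ _).trans_lt hKc.measure_lt_top⟩
    have h1 : MemLp (fun x => g x - g' x) 2 ((volume.restrict Ω).restrict K) :=
      ((Lp.memLp g).sub (Lp.memLp g')).restrict K
    have h2 := h1.integrable (by norm_num)
    rw [Measure.restrict_restrict_of_subset hK] at h2
    exact h2
  have key := hΩ.ae_eq_zero_of_integral_contDiff_smul_eq_zero hloc fun φ h1 h2 h3 => by
    have e1 := h φ h1 h2 h3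
    rw [h' φ h1 h2 h3, neg_inj] at e1
    have hi := integrable_mul_of_test g h1.continuous h2
    have hi' := integrable_mul_of_test g' h1.continuous h2
    have e2 : ∫ x, φ x • (g x - g' x) = ∫ x in Ω, (g x * φ x - g' x * φ x) := by
      rw [← setIntegral_eq_integral_of_forall_compl_eq_zero (s := Ω)]
      · exact integral_congr_ae (.of_forall fun x => by simp only [smul_eq_mul]; ring)
      · intro x hx
        rw [image_eq_zero_of_notMem_tsupport (fun hh => hx (h3 hh)), zero_smul]
    rw [e2, integral_sub hi hi', e1, sub_self]
  refine Lp.ext ?_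
  rw [Filter.EventuallyEq, ae_restrict_iff' hΩ.measurableSet]
  filter_upwards [key] with x hx hxΩ
  exact sub_eq_zero.mp (hx hxΩ)

/-- The Sobolev space `H¹(Ω)`: the pairs `(w, ∇w)` in `L²(Ω) × L²(Ω)ᵈ`, with the norm
`‖w‖² = ‖w‖²_{L²} + ∑ᵢ ‖∂ᵢ w‖²_{L²}`. -/
def H1 {d : ℕ} (Ω : Set (E d)) :
    Submodule ℝ (WithLp 2 (L2 Ω × PiLp 2 (fun _ : Fin d => L2 Ω))) where
  carrier := {w | ∀ i, IsWeakPartial Ω i w.fst (w.snd i)}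
  add_mem' h h' := fun i => (h i).add (h' i)
  zero_mem' := fun _ => IsWeakPartial.zero
  smul_mem' c _ h := fun i => (h i).smul c

/-- The `L²(Ω)` class of an `H¹(Ω)` function. -/
def H1.toL2 {d : ℕ} {Ω : Set (E d)} (w : H1 Ω) : L2 Ω := w.1.fst

/-- The weak partial derivatives of an `H¹(Ω)` function. -/
def H1.grad {d : ℕ} {Ω : Set (E d)} (w : H1 Ω) (i : Fin d) : L2 Ω := w.1.snd i

theorem H1.ext_toL2 {d : ℕ} {Ω : Set (E d)} (hΩ : IsOpen Ω) {w w' : H1 Ω}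
    (h : H1.toL2 w = H1.toL2 w') : w = w' := by
  obtain ⟨⟨x, y⟩, hw⟩ := w
  obtain ⟨⟨x', y'⟩, hw'⟩ := w'
  obtain rfl : x = x' := h
  have hy : y = y' := PiLp.ext fun i => IsWeakPartial.unique hΩ (hw i) (hw' i)
  subst hy
  rfl

/-- The norm `‖w‖_{H¹(D)}` of the restriction of `w ∈ H¹(Ω)` to `D` (for `D ⊆ Ω` open). -/
def H1.normOn {d : ℕ} {Ω : Set (E d)} (D : Set (E d)) (w : H1 Ω) : ℝ :=
  Real.sqrt ((∫ x in D, (H1.toL2 w x) ^ 2 ∂(volume.restrict Ω)) +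
    ∑ i, ∫ x in D, (H1.grad w i x) ^ 2 ∂(volume.restrict Ω))

/-! ### Time regularity -/

/-- `g` is the weak derivative of order `l` of `u` on `(0, T)`. -/
def IsWeakTimeDeriv {X : Type*} [NormedAddCommGroup X] [NormedSpace ℝ X] (T : ℝ) (l : ℕ)
    (u g : ℝ → X) : Prop :=
  ∀ φ : ℝ → ℝ, ContDiff ℝ ∞ φ → HasCompactSupport φ → tsupport φ ⊆ Ioo 0 T →
    ∫ t in Ioo 0 T, iteratedDeriv l φ t • u t = (-1 : ℝ) ^ l • ∫ t in Ioo 0 T, φ t • g t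

/-- `u ∈ W^{k,∞}(0,T; X)`: `u` and its weak time derivatives of all orders `≤ k` are in
`L^∞(0,T; X)`. -/
def MemWInfty {X : Type*} [NormedAddCommGroup X] [NormedSpace ℝ X] (T : ℝ) (k : ℕ)
    (u : ℝ → X) : Prop :=
  MemLp u ⊤ (volume.restrict (Ioo 0 T)) ∧
    ∀ l ≤ k, ∃ g : ℝ → X, MemLp g ⊤ (volume.restrict (Ioo 0 T)) ∧ IsWeakTimeDeriv T l u g

open Classical in
/-- The weak derivative `∂ₜˡ u ∈ L^∞(0,T; X)` (unique almost everywhere; `0` if there is none). -/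
def timeDeriv {X : Type*} [NormedAddCommGroup X] [NormedSpace ℝ X] (T : ℝ) (l : ℕ)
    (u : ℝ → X) : ℝ → X :=
  if h : ∃ g : ℝ → X, MemLp g ⊤ (volume.restrict (Ioo 0 T)) ∧ IsWeakTimeDeriv T l u g
  then h.choose else 0

/-- `‖∂ₜˡ u‖_{L^∞(0,T; X)}`. -/
def timeDerivNorm {X : Type*} [NormedAddCommGroup X] [NormedSpace ℝ X] (T : ℝ) (l : ℕ)
    (u : ℝ → X) : ℝ :=
  (eLpNorm (timeDeriv T l u) ⊤ (volume.restrict (Ioo 0 T))).toReal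

/-- The regularity functional `𝓜(u, f)`: the maximum of `‖∂ₜˡ u‖_{L^∞(0,T; X)}`, `2 ≤ l ≤ 5`, and
`‖∂ₜˡ f‖_{L^∞(0,T; X)}`, `0 ≤ l ≤ 3`. -/
def regM {X : Type*} [NormedAddCommGroup X] [NormedSpace ℝ X] (T : ℝ) (u f : ℝ → X) : ℝ :=
  max ((Finset.Icc 2 5).sup' ⟨2, by simp⟩ (fun l => timeDerivNorm T l u))
    ((Finset.Icc 0 3).sup' ⟨0, by simp⟩ (fun l => timeDerivNorm T l f))

/-! ### Simplicial meshes and finite element spaces -/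

/-- A conforming simplicial mesh of `Ω`. A cell is given by its `d + 1` vertices; the closed simplex
is their convex hull. Two cells meet in the (possibly empty) face spanned by common vertices. -/
structure Mesh {d : ℕ} (Ω : Set (E d)) where
  cells : Finset (Finset (E d))
  card_cell : ∀ s ∈ cells, s.card = d + 1
  indep : ∀ s ∈ cells, AffineIndependent ℝ (fun v : s => (v : E d))
  conforming : ∀ s ∈ cells, ∀ t ∈ cells,
    convexHull ℝ (s : Set (E d)) ∩ convexHull ℝ (t : Set (E d)) ⊆
      convexHull ℝ ((s : Set (E d)) ∩ (t : Set (E d)))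
  covers : ⋃ s ∈ cells, convexHull ℝ (s : Set (E d)) = closure Ω

/-- The closed simplex `τ` with vertex set `s`. -/
def simplex {d : ℕ} (s : Finset (E d)) : Set (E d) := convexHull ℝ (s : Set (E d))

/-- The open interior of the union of a family of cells. -/
def region {d : ℕ} (C : Finset (Finset (E d))) : Set (E d) := interior (⋃ s ∈ C, simplex s)

/-- The mesh width `max {diam τ}` of a (nonempty) family of cells. -/
def width {d : ℕ} (C : Finset (Finset (E d))) : ℝ :=
  sSup ((fun s => Metric.diam (simplex s)) '' (C : Set (Finset (E d))))

/-- `w` is the family of barycentric coordinates of `x` in the simplex with vertex set `s`,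
extended by zero to all other points. -/
structure IsBary {d : ℕ} (s : Finset (E d)) (x : E d) (w : E d → ℝ) : Prop where
  nonneg : ∀ v ∈ s, 0 ≤ w v
  zero : ∀ v ∉ s, w v = 0
  sum_eq : ∑ v ∈ s, w v = 1
  comb : ∑ v ∈ s, w v • v = x

namespace Mesh

variable {d : ℕ} {Ω : Set (E d)}

open Classical in
/-- The barycentric coordinates of a point `x` of the mesh, as a function of the vertex. Conformity
makes them independent of the cell; `x ↦ T.bary x v` is the piecewise linear hat function of `v`. -/
def bary (T : Mesh Ω) (x : E d) : E d → ℝ :=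
  if h : ∃ w, ∃ s ∈ T.cells, IsBary s x w then h.choose else 0

open Classical in
/-- All vertices of the mesh. -/
def vertices (T : Mesh Ω) : Finset (E d) := T.cells.biUnion id

open Classical in
/-- The nodal points of order `m`: the points `∑ᵥ (αᵥ / m) v` of the cells, `αᵥ ∈ ℕ`,
`∑ᵥ αᵥ = m`. -/
def nodes (T : Mesh Ω) (m : ℕ) : Finset (E d) :=
  T.cells.biUnion fun s =>
    (Finset.piAntidiag s m).image fun α => ∑ v ∈ s, ((α v : ℝ) / (m : ℝ)) • v

open Classical in
/-- The Lagrange nodal basis function `b_{m,z}`, by its formula in barycentric coordinates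
`λᵥ`: the product over the vertices `v` of the binomials "`m λᵥ(x)` choose `m λᵥ(z)`". It is
extended by zero outside the mesh. -/
def nodalBasis (T : Mesh Ω) (m : ℕ) (z x : E d) : ℝ :=
  if x ∈ closure Ω then
    ∏ v ∈ T.vertices, ∏ k ∈ Finset.range ⌊(m : ℝ) * T.bary z v⌋₊,
      ((m : ℝ) * T.bary x v - k) / ((k : ℝ) + 1)
  else 0

/-- The space of continuous functions on the closed mesh that are polynomials of total degree `≤ m`
on each cell; the functions are extended by zero to `ℝᵈ`. -/
def polySpace (T : Mesh Ω) (m : ℕ) : Submodule ℝ (E d → ℝ) where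
  carrier := {u | ContinuousOn u (closure Ω) ∧ (∀ x ∉ closure Ω, u x = 0) ∧
    ∀ s ∈ T.cells, ∃ P : MvPolynomial (Fin d) ℝ, P.totalDegree ≤ m ∧
      ∀ x ∈ simplex s, u x = MvPolynomial.eval (fun i => x i) P}
  add_mem' := by
    rintro u u' ⟨h1, h2, h3⟩ ⟨h1', h2', h3'⟩
    refine ⟨h1.add h1', fun x hx => by simp [h2 x hx, h2' x hx], fun s hs => ?_⟩
    obtain ⟨P, hP, e⟩ := h3 s hs
    obtain ⟨P', hP', e'⟩ := h3' s hs
    exact ⟨P + P', (MvPolynomial.totalDegree_add _ _).trans (max_le hP hP'),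
      fun x hx => by simp [e x hx, e' x hx]⟩
  zero_mem' := ⟨continuousOn_const, fun _ _ => rfl, fun s hs => ⟨0, by simp, by simp⟩⟩
  smul_mem' := by
    rintro c u ⟨h1, h2, h3⟩
    refine ⟨h1.const_smul c, fun x hx => by simp [h2 x hx], fun s hs => ?_⟩
    obtain ⟨P, hP, e⟩ := h3 s hs
    exact ⟨c • P, (MvPolynomial.totalDegree_smul_le _ _).trans hP, fun x hx => by
      simp [e x hx, MvPolynomial.smul_eval]⟩

theorem bary_eq (T : Mesh Ω) {s : Finset (E d)} (hs : s ∈ T.cells) {x : E d} {w : E d → ℝ}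
    (hw : IsBary s x w) : T.bary x = w := by
  classical
  have uniq : ∀ s ∈ T.cells, ∀ (w w' : E d → ℝ), IsBary s x w → (∀ v ∉ s, w' v = 0) →
      ∑ v ∈ s, w' v = 1 → ∑ v ∈ s, w' v • v = x → w = w' := by
    intro s hs w w' h h0 h1 h2
    have hi := affineIndependent_iff.mp (T.indep s hs) Finset.univ (fun v => w v - w' v)
      (by
        have := Finset.sum_coe_sort s (fun v => w v - w' v)
        simpa [this, Finset.sum_sub_distrib, h.sum_eq, h1] using this)
      (by
        have := Finset.sum_coe_sort s (fun v => (w v - w' v) • v)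
        rw [this]
        simp [sub_smul, Finset.sum_sub_distrib, h.comb, h2])
    funext v
    by_cases hv : v ∈ s
    · exact sub_eq_zero.mp (hi ⟨v, hv⟩ (Finset.mem_univ _))
    · rw [h.zero v hv, h0 v hv]
  have hull : ∀ s (w : E d → ℝ), IsBary s x w → x ∈ convexHull ℝ (s : Set (E d)) := by
    intro s w h
    rw [Finset.mem_convexHull']
    exact ⟨w, h.nonneg, h.sum_eq, h.comb⟩
  have hex : ∃ w, ∃ s ∈ T.cells, IsBary s x w := ⟨w, s, hs, hw⟩
  have hb : T.bary x = hex.choose := by rw [bary, dif_pos hex]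
  obtain ⟨t, ht, hw'⟩ := hex.choose_spec
  rw [hb]
  set w' := hex.choose
  have hx := T.conforming s hs t ht ⟨hull s w hw, hull t w' hw'⟩
  rw [← Finset.coe_inter, Finset.mem_convexHull'] at hx
  obtain ⟨c, -, hc1, hc2⟩ := hx
  let c' : E d → ℝ := fun v => if v ∈ s ∩ t then c v else 0
  have key : ∀ r : Finset (E d), s ∩ t ⊆ r → (∀ v ∉ r, c' v = 0) ∧ ∑ v ∈ r, c' v = 1 ∧
      ∑ v ∈ r, c' v • v = x := by
    intro r hr
    refine ⟨fun v hv => if_neg fun h => hv (hr h), ?_, ?_⟩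
    · rw [← hc1, ← Finset.sum_subset hr (fun v _ hv => if_neg hv)]
      exact Finset.sum_congr rfl fun v hv => if_pos hv
    · rw [← hc2, ← Finset.sum_subset hr (fun v _ hv => by simp only [c', if_neg hv, zero_smul])]
      exact Finset.sum_congr rfl fun v hv => by simp only [c', if_pos hv]
  obtain ⟨a1, a2, a3⟩ := key s Finset.inter_subset_left
  obtain ⟨b1, b2, b3⟩ := key t Finset.inter_subset_right
  rw [uniq s hs w c' hw a1 a2 a3, uniq t ht w' c' hw' b1 b2 b3]

theorem exists_of_mem_nodes (T : Mesh Ω) {m : ℕ} (hm : 1 ≤ m) {z : E d} (hz : z ∈ T.nodes m) :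
    ∃ s ∈ T.cells, ∃ α : E d → ℕ, (∑ v ∈ T.vertices, α v = m) ∧
      (∀ v, T.bary z v = (α v : ℝ) / m) ∧ z = ∑ v ∈ s, ((α v : ℝ) / m) • v ∧ z ∈ closure Ω ∧
      ∀ v ∉ s, α v = 0 := by
  classical
  simp only [nodes, Finset.mem_biUnion, Finset.mem_image, Finset.mem_piAntidiag] at hz
  obtain ⟨s, hs, α, ⟨h1, h2⟩, rfl⟩ := hz
  have h0 : ∀ v ∉ s, α v = 0 := fun v hv => by
    by_contra h
    exact hv (h2 v h)
  have hm' : (m : ℝ) ≠ 0 := by positivity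
  have hw : IsBary s (∑ v ∈ s, ((α v : ℝ) / m) • v) (fun v => (α v : ℝ) / m) :=
    { nonneg := fun v _ => by positivity
      zero := fun v hv => by simp [h0 v hv]
      sum_eq := by
        rw [← Finset.sum_div, ← Nat.cast_sum, h1, div_self hm']
      comb := rfl }
  refine ⟨s, hs, α, ?_, fun v => by rw [T.bary_eq hs hw], rfl, ?_, h0⟩
  · rw [← h1]
    refine (Finset.sum_subset ?_ fun v _ hv => h0 v hv).symm
    exact fun v hv => Finset.mem_biUnion.mpr ⟨s, hs, hv⟩
  · rw [← T.covers]
    refine mem_biUnion hs ?_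
    rw [Finset.mem_convexHull']
    exact ⟨_, hw.nonneg, hw.sum_eq, rfl⟩

/-- The defining property of the nodal basis: `b_{m,z}(z') = δ_{z,z'}` at the nodal points. -/
theorem nodalBasis_node (T : Mesh Ω) {m : ℕ} (hm : 1 ≤ m) {z z' : E d} (hz : z ∈ T.nodes m)
    (hz' : z' ∈ T.nodes m) [Decidable (z = z')] :
    T.nodalBasis m z z' = if z = z' then 1 else 0 := by
  classical
  obtain ⟨s, hs, α, h1, h2, h3, -, h5⟩ := T.exists_of_mem_nodes hm hz
  obtain ⟨s', hs', α', h1', h2', h3', h4', h5'⟩ := T.exists_of_mem_nodes hm hz'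
  have hm' : (m : ℝ) ≠ 0 := by positivity
  have e : T.nodalBasis m z z' = ∏ v ∈ T.vertices, ((α' v).choose (α v) : ℝ) := by
    rw [nodalBasis, if_pos h4']
    refine Finset.prod_congr rfl fun v _ => ?_
    rw [h2, h2', mul_div_cancel₀ _ hm', mul_div_cancel₀ _ hm', Nat.floor_natCast]
    generalize α' v = a
    generalize α v = b
    induction b with
    | zero => simp
    | succ b ih =>
      rw [Finset.prod_range_succ, ih, ← mul_div_assoc, div_eq_iff (by positivity)]
      have h := Nat.choose_succ_right_eq a b
      rcases le_or_gt b a with hab | hab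
      · have h' : ((a.choose (b + 1) : ℕ) : ℝ) * ((b : ℝ) + 1) = a.choose b * ((a : ℝ) - b) := by
          rw [← Nat.cast_sub hab]
          exact_mod_cast h
        exact h'.symm
      · simp [Nat.choose_eq_zero_of_lt hab, Nat.choose_eq_zero_of_lt (Nat.lt_succ_of_lt hab)]
  rw [e]
  split_ifs with h
  · subst h
    refine Finset.prod_eq_one fun v _ => ?_
    have : α v = α' v := by
      have := (h2 v).symm.trans (h2' v)
      field_simp at this
      exact_mod_cast this
    simp [this]
  · have : ∃ v ∈ T.vertices, α' v < α v := by
      by_contra! hle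
      have heq : ∀ v ∈ T.vertices, α v = α' v :=
        (Finset.sum_eq_sum_iff_of_le hle).mp (h1.trans h1'.symm)
      apply h
      have ext : ∀ r ∈ T.cells, ∀ β : E d → ℕ, (∀ v ∉ r, β v = 0) →
          ∑ v ∈ r, ((β v : ℝ) / m) • v = ∑ v ∈ T.vertices, ((β v : ℝ) / m) • v :=
        fun r hr β hβ => Finset.sum_subset
          (fun v hv => Finset.mem_biUnion.mpr ⟨r, hr, hv⟩) fun v _ hv => by simp [hβ v hv]
      rw [h3, h3', ext s hs α h5, ext s' hs' α' h5']
      exact Finset.sum_congr rfl fun v hv => by rw [heq v hv]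
    obtain ⟨v, hv, hlt⟩ := this
    exact Finset.prod_eq_zero hv (by simp [Nat.choose_eq_zero_of_lt hlt])

open Classical in
/-- The nodal points `Σ` of the Galerkin space: those whose basis function belongs to `V`. -/
def dofs (T : Mesh Ω) (V : Submodule ℝ (H1 Ω)) (m : ℕ) : Finset (E d) :=
  (T.nodes m).filter fun z =>
    ∃ v ∈ V, (H1.toL2 v : E d → ℝ) =ᵐ[volume.restrict Ω] T.nodalBasis m z

/-- The Galerkin space `S = S_𝒯^m ∩ V`. An element is a pair: a continuous piecewise polynomial
function together with the element of `V ⊆ H¹(Ω)` that it represents. -/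
def galerkin (T : Mesh Ω) (V : Submodule ℝ (H1 Ω)) (m : ℕ) : Submodule ℝ ((E d → ℝ) × V) where
  carrier := {u | u.1 ∈ T.polySpace m ∧
    (H1.toL2 (u.2 : H1 Ω) : E d → ℝ) =ᵐ[volume.restrict Ω] u.1}
  add_mem' := by
    rintro u u' ⟨h1, h2⟩ ⟨h1', h2'⟩
    exact ⟨add_mem h1 h1', (Lp.coeFn_add _ _).trans (h2.add h2')⟩
  zero_mem' := ⟨zero_mem _, Lp.coeFn_zero _ _ _⟩
  smul_mem' := by
    rintro c u ⟨h1, h2⟩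
    exact ⟨(T.polySpace m).smul_mem c h1, (Lp.coeFn_smul _ _).trans (h2.const_smul c)⟩

theorem galerkin_ext (T : Mesh Ω) {V : Submodule ℝ (H1 Ω)} {m : ℕ} (hΩ : IsOpen Ω)
    {x y : (E d → ℝ) × V} (hx : x ∈ T.galerkin V m) (hy : y ∈ T.galerkin V m) (h : x.1 = y.1) :
    x = y := by
  have h1 := hx.2
  have h2 := hy.2
  rw [h] at h1
  have h3 : H1.toL2 (x.2 : H1 Ω) = H1.toL2 (y.2 : H1 Ω) := Lp.ext (h1.trans h2.symm)
  exact Prod.ext h (Subtype.ext (H1.ext_toL2 hΩ h3))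

end Mesh

/-- A locally refined Galerkin finite element discretization of degree `m` of the space `V`, with
mass lumping: a conforming mesh, its coarse part `𝒯_c` (with mesh width `h_c = h`), and positive
mass-lumping weights. The nodal basis functions in `V` span `S = S_𝒯^m ∩ V`. -/
structure FEM {d : ℕ} {Ω : Set (E d)} (V : Submodule ℝ (H1 Ω)) (m : ℕ) where
  mesh : Mesh Ω
  coarse : Finset (Finset (E d))
  coarse_subset : coarse ⊆ mesh.cells
  coarse_nonempty : coarse.Nonempty
  width_coarse : width coarse = width mesh.cells
  weight : E d → ℝ
  weight_pos : ∀ z ∈ mesh.dofs V m, 0 < weight z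
  span_basis : (mesh.galerkin V m).map (LinearMap.fst ℝ (E d → ℝ) V) =
    Submodule.span ℝ (mesh.nodalBasis m '' (mesh.dofs V m : Set (E d)))

namespace FEM

variable {d : ℕ} {Ω : Set (E d)} {V : Submodule ℝ (H1 Ω)} {m : ℕ}

/-- The finite element space `S`. -/
def S (D : FEM V m) : Type := D.mesh.galerkin V m

instance (D : FEM V m) : AddCommGroup D.S := inferInstanceAs (AddCommGroup (D.mesh.galerkin V m))

instance (D : FEM V m) : Module ℝ D.S := inferInstanceAs (Module ℝ (D.mesh.galerkin V m))

/-- The function `ℝᵈ → ℝ` underlying a finite element function. -/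
def val (D : FEM V m) : D.S →ₗ[ℝ] (E d → ℝ) :=
  (LinearMap.fst ℝ (E d → ℝ) V).comp (D.mesh.galerkin V m).subtype

/-- A finite element function as an element of `V ⊆ H¹(Ω)`. -/
def toV (D : FEM V m) : D.S →ₗ[ℝ] V :=
  (LinearMap.snd ℝ (E d → ℝ) V).comp (D.mesh.galerkin V m).subtype

/-- A finite element function as an element of `L²(Ω)`. -/
def toL2 (D : FEM V m) (u : D.S) : L2 Ω := H1.toL2 (D.toV u : H1 Ω)

/-- The mesh width `h = h_c`. -/
def h (D : FEM V m) : ℝ := width D.mesh.cells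

open Classical in
/-- The refined part `𝒯_f` of the mesh. -/
def fine (D : FEM V m) : Finset (Finset (E d)) := D.mesh.cells \ D.coarse

/-- The degrees of freedom `Σ`. -/
abbrev dofs (D : FEM V m) : Finset (E d) := D.mesh.dofs V m

open Classical in
/-- `Σ_f`, the degrees of freedom in the closure of the refined region `Ω_f`. -/
def fineDofs (D : FEM V m) : Finset (E d) := D.dofs.filter fun z => z ∈ closure (region D.fine)

open Classical in
/-- `Σ_c = Σ \ Σ_f`. -/
def coarseDofs (D : FEM V m) : Finset (E d) := D.dofs \ D.fineDofs

/-- The span of the nodal basis functions `b_z`, `z ∈ Z`, as a subspace of `S`. -/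
def spanNodal (D : FEM V m) (Z : Finset (E d)) : Submodule ℝ D.S :=
  Submodule.span ℝ {e | ∃ z ∈ Z, D.val e = D.mesh.nodalBasis m z}

open Classical in
/-- The projection `Π_f : S → S_f`: the component `u_f` in `u = u_c + u_f`. -/
def projF (D : FEM V m) (u : D.S) : D.S :=
  if h : ∃ w ∈ D.spanNodal D.fineDofs, u - w ∈ D.spanNodal D.coarseDofs then h.choose else 0

/-- The projection `Π_c : S → S_c`: the component `u_c` in `u = u_c + u_f`. -/
def projC (D : FEM V m) (u : D.S) : D.S := u - D.projF u

/-- The mass-lumped scalar product `(u, v)_𝒯`. -/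
def lumped (D : FEM V m) (u v : D.S) : ℝ := ∑ z ∈ D.dofs, D.weight z * D.val u z * D.val v z

/-- The norm `‖u‖_𝒯`. -/
def lumpedNorm (D : FEM V m) (u : D.S) : ℝ := Real.sqrt (D.lumped u u)

open Classical in
/-- The element `u ∈ S` with `(u, v)_𝒯 = l v` for all `v ∈ S`. -/
def repr (D : FEM V m) (l : D.S → ℝ) : D.S :=
  if h : ∃ u : D.S, ∀ v, D.lumped u v = l v then h.choose else 0

/-- The operator `A^S : S → S`, `(A^S u, v)_𝒯 = a(u, v)`. -/
def opA (D : FEM V m) (a : V →ₗ[ℝ] V →ₗ[ℝ] ℝ) (u : D.S) : D.S :=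
  D.repr fun v => a (D.toV u) (D.toV v)

/-- The discrete source `f_S : [0,T] → S`, `(f_S(t), v)_𝒯 = (f(t), v)`. -/
def source (D : FEM V m) (f : ℝ → L2 Ω) (t : ℝ) : D.S :=
  D.repr fun v => inner ℝ (f t) (D.toL2 v)

/-! The projections and the lumped representatives exist and are unique. -/

theorem ext_val (D : FEM V m) (hΩ : IsOpen Ω) {u u' : D.S} (h : D.val u = D.val u') : u = u' :=
  Subtype.ext (p := fun x => x ∈ D.mesh.galerkin V m)
    (D.mesh.galerkin_ext hΩ (Subtype.property (p := fun x => x ∈ D.mesh.galerkin V m) u)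
      (Subtype.property (p := fun x => x ∈ D.mesh.galerkin V m) u') h)

theorem exists_basis (D : FEM V m) {z : E d} (hz : z ∈ D.dofs) :
    ∃ e : D.S, D.val e = D.mesh.nodalBasis m z := by
  have : D.mesh.nodalBasis m z ∈ (D.mesh.galerkin V m).map (LinearMap.fst ℝ (E d → ℝ) V) := by
    rw [D.span_basis]
    exact Submodule.subset_span ⟨z, hz, rfl⟩
  obtain ⟨e, he, h⟩ := this
  exact ⟨⟨e, he⟩, h⟩

theorem val_eq_sum (D : FEM V m) (hm : 1 ≤ m) (u : D.S) :
    D.val u = ∑ z ∈ D.dofs, D.val u z • D.mesh.nodalBasis m z := by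
  classical
  have hn : ∀ z ∈ D.dofs, z ∈ D.mesh.nodes m := fun z hz => (Finset.mem_filter.mp hz).1
  have hu : D.val u ∈ Submodule.span ℝ (D.mesh.nodalBasis m '' (D.dofs : Set (E d))) := by
    rw [← D.span_basis]
    exact ⟨_, Subtype.property (p := fun x => x ∈ D.mesh.galerkin V m) u, rfl⟩
  generalize D.val u = g at hu
  induction hu using Submodule.span_induction with
  | mem g hg =>
    obtain ⟨y, hy, rfl⟩ := hg
    rw [Finset.sum_congr rfl fun z hz => by
      rw [D.mesh.nodalBasis_node hm (hn y hy) (hn z hz)]]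
    have hy' : y ∈ D.dofs := hy
    simp [hy']
  | zero => simp
  | add a b _ _ ha hb =>
    conv_lhs => rw [ha, hb]
    simp [add_smul, Finset.sum_add_distrib]
  | smul c a _ ha =>
    conv_lhs => rw [ha]
    simp [mul_smul, Finset.smul_sum]

theorem existsUnique_repr (D : FEM V m) (hΩ : IsOpen Ω) (hm : 1 ≤ m) (l : D.S →ₗ[ℝ] ℝ) :
    ∃! u : D.S, ∀ v, D.lumped u v = l v := by
  classical
  choose! e he using fun (z : E d) (hz : z ∈ D.dofs) => D.exists_basis hz
  have hn : ∀ z ∈ D.dofs, z ∈ D.mesh.nodes m := fun z hz => (Finset.mem_filter.mp hz).1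
  have hev : ∀ z ∈ D.dofs, ∀ y ∈ D.dofs, D.val (e z) y = if z = y then 1 else 0 := by
    intro z hz y hy
    rw [he z hz, D.mesh.nodalBasis_node hm (hn z hz) (hn y hy)]
  have hsum : ∀ (c : E d → ℝ), ∀ x, D.val (∑ z ∈ D.dofs, c z • e z : D.S) x =
      ∑ z ∈ D.dofs, c z * D.val (e z) x := by
    intro c x
    simp [map_sum, Finset.sum_apply]
  have hrep : ∀ u : D.S, u = ∑ z ∈ D.dofs, D.val u z • e z := by
    intro u
    refine D.ext_val hΩ (funext fun x => ?_)
    rw [hsum]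
    have := congrFun (D.val_eq_sum hm u) x
    rw [this, Finset.sum_apply]
    exact Finset.sum_congr rfl fun z hz => by rw [he z hz]; rfl
  refine ⟨∑ z ∈ D.dofs, ((D.weight z)⁻¹ * l (e z)) • e z, fun v => ?_, fun u hu => ?_⟩
  · have h1 : ∀ y ∈ D.dofs, D.val (∑ z ∈ D.dofs, ((D.weight z)⁻¹ * l (e z)) • e z : D.S) y =
        (D.weight y)⁻¹ * l (e y) := by
      intro y hy
      rw [hsum, Finset.sum_congr rfl fun z hz => by rw [hev z hz y hy]]
      simp [hy]
    conv_rhs => rw [hrep v, map_sum]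
    refine Finset.sum_congr rfl fun z hz => ?_
    rw [h1 z hz, map_smul, smul_eq_mul]
    have := (D.weight_pos z hz).ne'
    field_simp
  · rw [hrep u]
    refine Finset.sum_congr rfl fun z hz => ?_
    congr 1
    rw [← hu, lumped, Finset.sum_eq_single z]
    · rw [hev z hz z hz, if_pos rfl]
      have := (D.weight_pos z hz).ne'
      field_simp
    · intro y hy hne
      rw [hev z hz y hy, if_neg (Ne.symm hne), mul_zero]
    · exact fun h => absurd hz h

theorem existsUnique_decomp (D : FEM V m) (hΩ : IsOpen Ω) (hm : 1 ≤ m) (u : D.S) :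
    ∃! w : D.S, w ∈ D.spanNodal D.fineDofs ∧ u - w ∈ D.spanNodal D.coarseDofs := by
  classical
  choose! e he using fun (z : E d) (hz : z ∈ D.dofs) => D.exists_basis hz
  have hn : ∀ z ∈ D.dofs, z ∈ D.mesh.nodes m := fun z hz => (Finset.mem_filter.mp hz).1
  have hf : D.fineDofs ⊆ D.dofs := Finset.filter_subset _ _
  have hc : D.coarseDofs ⊆ D.dofs := Finset.sdiff_subset
  have hsum : ∀ (Z : Finset (E d)) (c : E d → ℝ), ∀ x, D.val (∑ z ∈ Z, c z • e z : D.S) x =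
      ∑ z ∈ Z, c z * D.val (e z) x := by
    intro Z c x
    simp [map_sum, Finset.sum_apply]
  have hrep : ∀ u : D.S, u = ∑ z ∈ D.dofs, D.val u z • e z := by
    intro u
    refine D.ext_val hΩ (funext fun x => ?_)
    rw [hsum]
    have := congrFun (D.val_eq_sum hm u) x
    rw [this, Finset.sum_apply]
    exact Finset.sum_congr rfl fun z hz => by rw [he z hz]; rfl
  have hmem : ∀ Z ⊆ D.dofs, ∀ w ∈ D.spanNodal Z, ∀ y ∈ D.dofs, y ∉ Z → D.val w y = 0 := by
    intro Z hZ w hw y hy hyZ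
    induction hw using Submodule.span_induction with
    | mem w hw =>
      obtain ⟨z, hz, h⟩ := hw
      rw [h, D.mesh.nodalBasis_node hm (hn z (hZ hz)) (hn y hy),
        if_neg (fun hzy : z = y => hyZ (hzy ▸ hz))]
    | zero => rfl
    | add a b _ _ ha hb =>
      have : D.val (a + b) y = D.val a y + D.val b y := rfl
      rw [this, ha, hb, add_zero]
    | smul c a _ ha =>
      have : D.val (c • a) y = c * D.val a y := rfl
      rw [this, ha, mul_zero]
  have hin : ∀ Z ⊆ D.dofs, ∀ c : E d → ℝ, ∑ z ∈ Z, c z • e z ∈ D.spanNodal Z :=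
    fun Z hZ c => Submodule.sum_mem _ fun z hz =>
      Submodule.smul_mem _ _ (Submodule.subset_span ⟨z, hz, he z (hZ hz)⟩)
  refine ⟨∑ z ∈ D.fineDofs, D.val u z • e z, ⟨hin _ hf _, ?_⟩, fun w hw => ?_⟩
  · have : u - ∑ z ∈ D.fineDofs, D.val u z • e z = ∑ z ∈ D.coarseDofs, D.val u z • e z := by
      rw [sub_eq_iff_eq_add]
      conv_lhs => rw [hrep u]
      exact (Finset.sum_sdiff hf).symm
    rw [this]
    exact hin _ hc _
  · rw [hrep w, ← Finset.sum_subset hf fun z hz hzf => by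
      rw [hmem _ hf w hw.1 z hz hzf, zero_smul]]
    refine Finset.sum_congr rfl fun z hz => ?_
    have h0 : D.val (u - w) z = 0 :=
      hmem _ hc _ hw.2 z (hf hz) fun h => (Finset.mem_sdiff.mp h).2 hz
    have : D.val (u - w) z = D.val u z - D.val w z := rfl
    rw [this, sub_eq_zero] at h0
    rw [h0]

end FEM

/-! ### The semi-discrete wave equation -/

/-- `u_S` solves the semi-discrete wave equation `(ü_S, w)_𝒯 + a(u_S, w) = (f_S, w)_𝒯` for all
`w ∈ S` on `(0, T]`, with velocity `v_S = u̇_S` and initial data `u_S(0) = U₀`, `u̇_S(0) = V₀`.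
Derivatives at the end points are one-sided. -/
structure IsSemidiscrete {d : ℕ} {Ω : Set (E d)} {V : Submodule ℝ (H1 Ω)} {m : ℕ} (D : FEM V m)
    (a : V →ₗ[ℝ] V →ₗ[ℝ] ℝ) (f : ℝ → L2 Ω) (T : ℝ) (U₀ V₀ : D.S) (uS vS : ℝ → D.S) : Prop where
  init : uS 0 = U₀
  init_vel : vS 0 = V₀
  vel_cont : ∀ w : D.S, ContinuousOn (fun t => D.lumped (vS t) w) (Icc 0 T)
  vel : ∀ w : D.S, ∀ t ∈ Icc 0 T,
    HasDerivWithinAt (fun s => D.lumped (uS s) w) (D.lumped (vS t) w) (Icc 0 T) t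
  wave : ∀ w : D.S, ∀ t ∈ Ioc 0 T,
    HasDerivWithinAt (fun s => D.lumped (vS s) w)
      (D.lumped (D.source f t) w - a (D.toV (uS t)) (D.toV w)) (Icc 0 T) t

/-! ### The stabilized local time-stepping scheme -/

/-- `δ_{p,ν} = 1 + ν / p²`. -/
def dlt (p : ℕ) (ν : ℝ) : ℝ := 1 + ν / (p : ℝ) ^ 2

/-- `ω_{p,ν} = 2 T_p'(δ) / T_p(δ)`. -/
def omg (p : ℕ) (ν : ℝ) : ℝ :=
  2 * ((Polynomial.derivative (Polynomial.Chebyshev.T ℝ p)).eval (dlt p ν) /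
    (Polynomial.Chebyshev.T ℝ p).eval (dlt p ν))

/-- `β_{p,ν}^{(k,l)} = T_{k+l}(δ) / T_{k+1}(δ)` (used only for `k + l ≥ 0`). -/
def bet (p : ℕ) (ν : ℝ) (k l : ℤ) : ℝ :=
  (Polynomial.Chebyshev.T ℝ (k + l)).eval (dlt p ν) /
    (Polynomial.Chebyshev.T ℝ (k + 1)).eval (dlt p ν)

/-- `γ_{p,ν}^{(k)} = (p - k) β_{p,ν}^{(k,p-k)} / U_{p-1-k}(δ)`, `0 ≤ k ≤ p - 1`. -/
def gam (p : ℕ) (ν : ℝ) (k : ℕ) : ℝ :=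
  ((p : ℝ) - k) * bet p ν k ((p : ℤ) - k) /
    (Polynomial.Chebyshev.U ℝ ((p : ℤ) - 1 - k)).eval (dlt p ν)

namespace FEM

variable {d : ℕ} {Ω : Set (E d)} {V : Submodule ℝ (H1 Ω)} {m : ℕ}

/-- The local steps `z_{S,k}^{(n)}`, `0 ≤ k ≤ p`, inside one global time-step of length `dt`, from
the current value `u = u_S^{(n)}`, the coarse contribution `w = w_S^{(n)}`, coefficients `γ k` of
the local source terms and source samples `F k = f_{S,k}^{(n)}`. -/
def localStep (D : FEM V m) (a : V →ₗ[ℝ] V →ₗ[ℝ] ℝ) (p : ℕ) (ν dt : ℝ) (γ : ℕ → ℝ)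
    (F : ℤ → D.S) (w u : D.S) : ℕ → D.S
  | 0 => u
  | 1 => u + ((1 / 2) * (dt / p) ^ 2) •
      ((2 * (p : ℝ) ^ 2 / omg p ν * bet p ν 0 0) • (w - D.opA a (D.projF u)) +
        γ 0 • D.projF (F 0))
  | k + 2 =>
      (1 + bet p ν (k + 1) (-1)) • localStep D a p ν dt γ F w u (k + 1) -
        bet p ν (k + 1) (-1) • localStep D a p ν dt γ F w u k +
        ((dt / p) ^ 2) •
          ((2 * (p : ℝ) ^ 2 / omg p ν * bet p ν (k + 1) 0) •
              (w - D.opA a (D.projF (localStep D a p ν dt γ F w u (k + 1)))) +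
            (γ (k + 1) * (1 / 2)) • D.projF (F (k + 1) + F (-(k + 1))))

/-- The fully discrete solution `u_S^{(n)}` with global step `dt`, `p` local steps and initial data
`U₀`, `V₀`. The map `Π` is applied to the source in `w_S^{(n)} = Π f_S(t_n) - A^S Π_c u_S^{(n)}`, and
`γ` are the coefficients of the local source terms. -/
def scheme (D : FEM V m) (a : V →ₗ[ℝ] V →ₗ[ℝ] ℝ) (f : ℝ → L2 Ω) (p : ℕ) (ν dt : ℝ)
    (Pi : D.S → D.S) (γ : ℕ → ℝ) (U₀ V₀ : D.S) : ℕ → D.S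
  | 0 => U₀
  | 1 => U₀ + dt • V₀ + (dt ^ 2 / 2) • (D.source f 0 - D.opA a U₀)
  | n + 2 =>
      -scheme D a f p ν dt Pi γ U₀ V₀ n +
        (2 : ℝ) • D.localStep a p ν dt γ
          (fun k => D.source f (((n : ℝ) + 1) * dt + (k : ℝ) / p * dt))
          (Pi (D.source f (((n : ℝ) + 1) * dt)) -
            D.opA a (D.projC (scheme D a f p ν dt Pi γ U₀ V₀ (n + 1))))
          (scheme D a f p ν dt Pi γ U₀ V₀ (n + 1)) p

/-- The `LF-LTS(ν)` solution. -/
def ltsSolution (D : FEM V m) (a : V →ₗ[ℝ] V →ₗ[ℝ] ℝ) (f : ℝ → L2 Ω) (p : ℕ) (ν dt : ℝ)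
    (U₀ V₀ : D.S) : ℕ → D.S :=
  D.scheme a f p ν dt D.projC (gam p ν) U₀ V₀

/-- The split-LFC solution: the source is evaluated only at the global time-steps, in
`w_S^{(n)} = f_S(t_n) - A^S Π_c u_S^{(n)}`, and all local source terms are dropped. -/
def splitLFCSolution (D : FEM V m) (a : V →ₗ[ℝ] V →ₗ[ℝ] ℝ) (f : ℝ → L2 Ω) (p : ℕ) (ν dt : ℝ)
    (U₀ V₀ : D.S) : ℕ → D.S :=
  D.scheme a f p ν dt id (fun _ => 0) U₀ V₀

end FEM

end LFLTS

end

/-!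
Both schemes are analysed in the finite dimensional space `S` with the mass-lumped scalar product,
where `A = A^S` is symmetric and positive definite and `P = Π_f` is an orthogonal projection
(diagonal in the nodal basis).

**One global step in closed form.** After multiplication by `T_k(δ)` the local steps satisfy the
three-term recursion of the Chebyshev polynomials. Hence (`IsLocal.closed_form`) both schemes are
leapfrog methods `u^{n+1} - 2 u^n + u^{n-1} = Δt² (… - A_ψ u^n)` with the stiffness operator
`A_ψ = ψ(A P) A`, where `x ψ(x) Δt² = 2 (1 - T_p(δ - τ x) / T_p(δ))`, `τ = Δt² / ω`. The source
enters through `ψ(A P)` and, for `LF-LTS(ν)`, through an average of normalized symbols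
`U_j(δ - τ x) / U_j(δ)` on the fine part. As `A P` is not symmetric, a function of it is defined by
`q(A P) = q(0) + A P χ(P A P) P` with `χ(x) = (q(x) - q(0)) / x`.

**Stability.** On `[-δ, δ]` the polynomials `T_n`, `U_n` and their derivatives are bounded by their
values at `δ`. The stabilization `T_p(δ) ≥ 1 + ν` gives bounds uniform in `p`: `0 < ψ ≤ 1`,
`Δt² x ψ ≤ 4 - 2 g` with `g = ν / (1 + ν)` (`Cheb.symbol_le`), and every symbol bounded by both `2`
and `2 p² τ x` is at most `(Δt² / g) x ψ` (`Cheb.mul_abs_le_symbol`, `Stepping.abs_le_mul_psi`).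
They make `A_ψ` symmetric, uniformly positive (`LocalOp.norm_sq_le_inner_ApL`) and, together with
the inverse inequality on the coarse part and the CFL condition, `Δt² A_ψ ≤ 4 - 7/4 g`
(`LocalOp.inner_ApL_le_norm_sq`), so that the leapfrog energy is coercive (`norm_leapfrog_le`). The
coarse inverse inequality applies to `Π_c u` because this function vanishes on the refined cells
(`FEM.normOn_projC`).

**Consistency.** The defect contains terms `φ(A P) v`, `φ = 1 - ψ` for instance, that are not small
for rough `v`. But `φ(0) = 0`, so such a term is `A_ψ ρ` with `ρ = P (φ / (x ψ))(P A P) P v`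
(`LocalOp.ApL_F`), and `‖ρ‖ ≤ (Δt² / g) ‖v‖` by the bound above. Subtracting `ρ` from the error
leaves a defect of order `Δt⁴`, consisting of second differences in time, and the stability estimate
gives an error of order `Δt²` (`CFL.norm_error_le`, `CFL.norm_error_split_le`,
`CFL.norm_error_lts_le`).

**Regularity in time.** The pointwise bounds for differences of `u_S`, `ü_S` and `f_S` follow from
bounds of weak derivatives by mollification (`norm_sub_le_of_isWeakTimeDeriv_one`,
`norm_second_diff_le`, `IsMotion.norm_central_diff_le`).
-/

noncomputable section

namespace LFLTS

/-! ### Chebyshev polynomials to the right of `1` -/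

namespace Cheb

open Polynomial Polynomial.Chebyshev

theorem abs_eval_T_le {δ x : ℝ} (hδ : 1 ≤ δ) (hx : |x| ≤ δ) (n : ℤ) :
    |(T ℝ n).eval x| ≤ (T ℝ n).eval δ := by
  rcases le_or_gt |x| 1 with h | h
  · exact (abs_eval_T_real_le_one n h).trans (one_le_eval_T_real n hδ)
  · have h1 : |(T ℝ n).eval x| = (T ℝ n).eval |x| := by
      have h2 : |(T ℝ n).eval x| = |(T ℝ n).eval (|x|)| := by
        rcases abs_cases x with ⟨e, -⟩ | ⟨e, -⟩
        · rw [e]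
        · rw [e, T_eval_neg, abs_mul, abs_unit_intCast, one_mul]
      rw [h2]
      exact abs_of_nonneg (zero_le_one.trans (one_le_eval_T_real n h.le))
    rw [h1, ← Real.cosh_arcosh h.le, ← Real.cosh_arcosh hδ, T_real_cosh, T_real_cosh,
      Real.cosh_le_cosh, abs_mul, abs_mul]
    refine mul_le_mul_of_nonneg_left ?_ (abs_nonneg _)
    rw [abs_of_nonneg (Real.arcosh_nonneg h.le), abs_of_nonneg (Real.arcosh_nonneg hδ)]
    exact (Real.arcosh_le_arcosh (by linarith) (by linarith)).mpr hx

/-- The cone of combinations of `T₀, …, Tₙ` with natural coefficients. It contains `Uₙ` and is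
stable under differentiation, and on it the modulus on `[-δ, δ]`, `δ ≥ 1`, is controlled by the
value at `δ`. -/
abbrev cone (n : ℕ) : Submodule ℕ ℝ[X] :=
  Submodule.span ℕ ((fun m : ℕ => T ℝ m) '' Icc 0 n)

theorem abs_eval_le_of_mem_cone {n : ℕ} {q : ℝ[X]} (hq : q ∈ cone n) {δ x : ℝ} (hδ : 1 ≤ δ)
    (hx : |x| ≤ δ) : |q.eval x| ≤ q.eval δ := by
  induction hq using Submodule.span_induction with
  | mem q hq =>
    obtain ⟨m, -, rfl⟩ := hq
    exact abs_eval_T_le hδ hx m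
  | zero => simp
  | add a b _ _ ha hb =>
    rw [eval_add, eval_add]
    exact (abs_add_le _ _).trans (add_le_add ha hb)
  | smul c a _ ha =>
    rw [eval_smul, eval_smul, nsmul_eq_mul, nsmul_eq_mul, abs_mul, Nat.abs_cast]
    exact mul_le_mul_of_nonneg_left ha (Nat.cast_nonneg _)

theorem eval_nonneg_of_mem_cone {n : ℕ} {q : ℝ[X]} (hq : q ∈ cone n) {δ : ℝ} (hδ : 1 ≤ δ) :
    0 ≤ q.eval δ :=
  (abs_nonneg _).trans (abs_eval_le_of_mem_cone hq hδ (x := δ) (abs_of_nonneg (by linarith)).le)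

theorem derivative_mem_cone {n : ℕ} {q : ℝ[X]} (hq : q ∈ cone n) : derivative q ∈ cone n := by
  induction hq using Submodule.span_induction with
  | mem q hq =>
    obtain ⟨m, hm, rfl⟩ := hq
    refine Submodule.span_mono (image_mono ?_) (T_derivative_mem_span_T m)
    exact fun k hk => ⟨hk.1, hk.2.le.trans hm.2⟩
  | zero => simp
  | add a b _ _ ha hb =>
    rw [derivative_add]
    exact add_mem ha hb
  | smul c a _ ha =>
    rw [derivative_smul]
    exact Submodule.smul_mem _ c ha

theorem T_mem_cone (n : ℕ) : T ℝ n ∈ cone n :=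
  Submodule.subset_span ⟨n, by simp, rfl⟩

theorem eval_U_nonneg (n : ℕ) {δ : ℝ} (hδ : 1 ≤ δ) : 0 ≤ (U ℝ n).eval δ :=
  eval_nonneg_of_mem_cone (U_mem_span_T ℝ n) hδ

theorem one_le_eval_U (n : ℕ) {δ : ℝ} (hδ : 1 ≤ δ) : 1 ≤ (U ℝ n).eval δ := by
  have h := abs_eval_le_of_mem_cone (U_mem_span_T ℝ n) hδ (x := 1) (by simpa using hδ)
  rw [U_eval_one] at h
  have h2 := le_abs_self (((n : ℤ) : ℝ) + 1)
  have h3 : (0 : ℝ) ≤ n := Nat.cast_nonneg n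
  push_cast at h h2
  linarith

theorem eval_U_le (n : ℕ) {δ : ℝ} (hδ : 1 ≤ δ) :
    (U ℝ n).eval δ ≤ (n + 1) * (T ℝ (n + 1)).eval δ := by
  induction n with
  | zero => simpa using hδ
  | succ n ih =>
    have h1 := congrArg (eval δ) (U_eq_X_mul_U_add_T ℝ n)
    have h2 := congrArg (eval δ) (T_eq_X_mul_T_sub_pol_U ℝ n)
    simp only [eval_add, eval_mul, eval_X, eval_sub, eval_one, eval_pow] at h1 h2
    have h3 := eval_U_nonneg n hδ
    have h4 := one_le_eval_T_real (n + 1) hδ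
    have e : ((n + 1 : ℕ) : ℤ) + 1 = n + 2 := by push_cast; ring
    rw [e, h2]
    push_cast
    rw [h1]
    have h5 : 0 ≤ (δ ^ 2 - 1) * (U ℝ n).eval δ := mul_nonneg (by nlinarith) h3
    have h6 : δ * (U ℝ n).eval δ ≤ δ * ((n + 1) * (T ℝ (n + 1)).eval δ) :=
      mul_le_mul_of_nonneg_left ih (by linarith)
    have h7 : (T ℝ (n + 1)).eval δ ≤ δ * (T ℝ (n + 1)).eval δ := by nlinarith
    have h8 : (0 : ℝ) ≤ n := Nat.cast_nonneg n
    nlinarith [mul_nonneg h8 h5]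

theorem eval_derivative_T_le (n : ℕ) {δ : ℝ} (hδ : 1 ≤ δ) :
    (derivative (T ℝ n)).eval δ ≤ (n : ℝ) ^ 2 * (T ℝ n).eval δ := by
  rcases n with _ | n
  · simp
  · have h := eval_U_le n hδ
    rw [T_derivative_eq_U]
    have e : ((n + 1 : ℕ) : ℤ) - 1 = n := by push_cast; ring
    rw [e]
    simp only [eval_mul, Int.cast_natCast, eval_natCast]
    push_cast
    nlinarith [mul_le_mul_of_nonneg_left h (by positivity : (0 : ℝ) ≤ n + 1)]

theorem sq_le_eval_derivative_T (n : ℕ) {δ : ℝ} (hδ : 1 ≤ δ) :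
    (n : ℝ) ^ 2 ≤ (derivative (T ℝ n)).eval δ := by
  have h := abs_eval_le_of_mem_cone (derivative_mem_cone (T_mem_cone n)) hδ (x := 1)
    (by simpa using hδ)
  rw [derivative_T_eval_one] at h
  exact (le_abs_self _).trans (by simpa using h)

/-- A Markov type inequality on the cone, at a point to the right of `1`. -/
theorem eval_derivative_le_of_mem_cone {n : ℕ} {q : ℝ[X]} (hq : q ∈ cone n) {δ : ℝ}
    (hδ : 1 ≤ δ) : (derivative q).eval δ ≤ (n : ℝ) ^ 2 * q.eval δ := by
  induction hq using Submodule.span_induction with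
  | mem q hq =>
    obtain ⟨m, hm, rfl⟩ := hq
    refine (eval_derivative_T_le m hδ).trans ?_
    have h1 := zero_le_one.trans (one_le_eval_T_real (m : ℤ) hδ)
    have h2 : (m : ℝ) ≤ n := by exact_mod_cast hm.2
    exact mul_le_mul_of_nonneg_right (pow_le_pow_left₀ (Nat.cast_nonneg m) h2 2) h1
  | zero => simp
  | add a b _ _ ha hb =>
    rw [derivative_add, eval_add, eval_add]
    linarith
  | smul c a _ ha =>
    rw [derivative_smul, eval_smul, eval_smul, nsmul_eq_mul, nsmul_eq_mul]
    have := mul_le_mul_of_nonneg_left ha (Nat.cast_nonneg (α := ℝ) c)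
    linarith

theorem exists_eval_sub_eval (q : ℝ[X]) (δ : ℝ) {t : ℝ} (ht : 0 < t) :
    ∃ ξ, δ - t < ξ ∧ ξ < δ ∧ q.eval δ - q.eval (δ - t) = t * (derivative q).eval ξ := by
  obtain ⟨ξ, ⟨h1, h2⟩, h3⟩ := exists_deriv_eq_slope (fun x => q.eval x)
    (show δ - t < δ by linarith) q.continuous.continuousOn q.differentiable.differentiableOn
  refine ⟨ξ, h1, h2, ?_⟩
  rw [Polynomial.deriv] at h3
  rw [h3]
  have : δ - (δ - t) = t := by ring
  rw [this]
  field_simp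

theorem abs_eval_sub_eval_le {n : ℕ} {q : ℝ[X]} (hq : q ∈ cone n) {δ t : ℝ} (hδ : 1 ≤ δ)
    (ht : 0 ≤ t) (ht' : t ≤ 2) : |q.eval δ - q.eval (δ - t)| ≤ t * (derivative q).eval δ := by
  rcases ht.eq_or_lt with rfl | ht
  · simp
  · obtain ⟨ξ, h1, h2, h3⟩ := exists_eval_sub_eval q δ ht
    rw [h3, abs_mul, abs_of_pos ht]
    refine mul_le_mul_of_nonneg_left ?_ ht.le
    exact abs_eval_le_of_mem_cone (derivative_mem_cone hq) hδ
      (abs_le.mpr ⟨by linarith, by linarith⟩)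

/-- The first order Taylor remainder at `δ`, with the second derivative bounded by the Markov type
inequality for `q'`. -/
theorem abs_taylor_le {n : ℕ} {q : ℝ[X]} (hq : q ∈ cone n) {δ t : ℝ} (hδ : 1 ≤ δ)
    (ht : 0 < t) (ht' : t ≤ 2) :
    |t * (derivative q).eval δ - (q.eval δ - q.eval (δ - t))| ≤
      t ^ 2 * ((n : ℝ) ^ 2 * (derivative q).eval δ) := by
  obtain ⟨ξ, h1, h2, h3⟩ := exists_eval_sub_eval q δ ht
  have hq' := derivative_mem_cone hq
  have h4 := abs_eval_sub_eval_le hq' hδ (t := δ - ξ) (by linarith) (by linarith)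
  have e : δ - (δ - ξ) = ξ := by ring
  rw [e] at h4
  have h5 := eval_derivative_le_of_mem_cone hq' hδ
  have h6 := eval_nonneg_of_mem_cone (derivative_mem_cone hq') hδ
  rw [h3, ← mul_sub, abs_mul, abs_of_pos ht, pow_two, mul_assoc]
  refine mul_le_mul_of_nonneg_left ?_ ht.le
  exact h4.trans ((mul_le_mul_of_nonneg_right (by linarith) h6).trans
    (mul_le_mul_of_nonneg_left h5 ht.le))

section Stabilized

variable {p : ℕ} {ν δ : ℝ} (hp : 1 ≤ p) (hν : 0 ≤ ν) (hν' : ν ≤ 1 / 2)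
  (hδ : δ = 1 + ν / (p : ℝ) ^ 2)

include hν hδ in
theorem one_le_delta : 1 ≤ δ := by
  rw [hδ]
  have : 0 ≤ ν / (p : ℝ) ^ 2 := by positivity
  linarith

include hp hν hδ in
/-- Stabilization: `T_p(δ)` exceeds the values of `T_p` on `[-1, 1]` by `ν`. -/
theorem one_add_le_eval_T : 1 + ν ≤ (T ℝ p).eval δ := by
  have h1 := one_le_delta hν hδ
  have hp' : (0 : ℝ) < p := by exact_mod_cast hp
  rcases hν.eq_or_lt with rfl | hν0
  · simpa using one_le_eval_T_real (p : ℤ) h1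
  · obtain ⟨ξ, h2, h3, h4⟩ := exists_eval_sub_eval (T ℝ p) δ (t := ν / (p : ℝ) ^ 2) (by positivity)
    have e : δ - ν / (p : ℝ) ^ 2 = 1 := by rw [hδ]; ring
    rw [e] at h2 h4
    rw [T_eval_one] at h4
    have h5 := sq_le_eval_derivative_T p h2.le
    have h6 : ν = ν / (p : ℝ) ^ 2 * (p : ℝ) ^ 2 := by field_simp
    have h7 := mul_le_mul_of_nonneg_left h5 (by positivity : 0 ≤ ν / (p : ℝ) ^ 2)
    linarith

include hν hδ in
theorem eval_T_le_one_add : (T ℝ p).eval δ ≤ 1 + ν / (p : ℝ) ^ 2 * (derivative (T ℝ p)).eval δ := by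
  have h1 := one_le_delta hν hδ
  have h2 : 0 ≤ ν / (p : ℝ) ^ 2 := by positivity
  rcases h2.eq_or_lt with h | h
  · rw [hδ, ← h]
    simp
  · have e : δ - ν / (p : ℝ) ^ 2 = 1 := by rw [hδ]; ring
    obtain ⟨ξ, h3, h4, h5⟩ := exists_eval_sub_eval (T ℝ p) δ h
    rw [e] at h3 h5
    rw [T_eval_one] at h5
    have h6 := abs_eval_le_of_mem_cone (derivative_mem_cone (T_mem_cone p)) h1 (x := ξ)
      (by rw [abs_of_pos (by linarith)]; exact h4.le)
    have h7 := mul_le_mul_of_nonneg_left ((le_abs_self _).trans h6) h2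
    linarith

include hp hν hν' hδ in
theorem eval_T_le_two : (T ℝ p).eval δ ≤ 2 := by
  have hp' : (0 : ℝ) < p := by exact_mod_cast hp
  have h1 := eval_T_le_one_add (p := p) hν hδ
  have h2 := eval_derivative_T_le p (one_le_delta hν hδ)
  have h3 := mul_le_mul_of_nonneg_left h2 (by positivity : 0 ≤ ν / (p : ℝ) ^ 2)
  have h4 : ν / (p : ℝ) ^ 2 * ((p : ℝ) ^ 2 * (T ℝ p).eval δ) = ν * (T ℝ p).eval δ := by
    field_simp
  have h5 := one_le_eval_T_real (p : ℤ) (one_le_delta hν hδ)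
  nlinarith

include hp hν hδ in
theorem sq_mul_eval_T_le :
    (p : ℝ) ^ 2 * (T ℝ p).eval δ ≤ (1 + ν) * (derivative (T ℝ p)).eval δ := by
  have hp' : (0 : ℝ) < p := by exact_mod_cast hp
  have h1 := eval_T_le_one_add (p := p) hν hδ
  have h2 := sq_le_eval_derivative_T p (one_le_delta hν hδ)
  have h3 := mul_le_mul_of_nonneg_left h1 (by positivity : 0 ≤ (p : ℝ) ^ 2)
  have h4 : (p : ℝ) ^ 2 * (1 + ν / (p : ℝ) ^ 2 * (derivative (T ℝ p)).eval δ) =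
      (p : ℝ) ^ 2 + ν * (derivative (T ℝ p)).eval δ := by field_simp
  linarith

include hp hν hν' hδ in
/-- The stabilized symbol `1 - T_p(δ - t) / T_p(δ)` dominates `min {1, p² t}`, uniformly in `p`. -/
theorem mul_abs_le_symbol {t q : ℝ} (ht : 0 ≤ t) (ht' : t ≤ 2) (hq : |q| ≤ 2)
    (hq' : |q| ≤ 2 * (t * (p : ℝ) ^ 2)) :
    ν / (1 + ν) * |q| ≤ 2 * (1 - (T ℝ p).eval (δ - t) / (T ℝ p).eval δ) := by
  have hp' : (0 : ℝ) < p := by exact_mod_cast hp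
  have h1 := one_le_delta hν hδ
  have h2 := one_add_le_eval_T hp hν hδ
  have h0 : 0 < (T ℝ p).eval δ := by linarith
  have hs : 0 ≤ ν / (1 + ν) := by positivity
  have hs' : ν / (1 + ν) ≤ 1 / 2 := by
    rw [div_le_iff₀ (by linarith)]
    linarith
  rcases le_or_gt (ν / (p : ℝ) ^ 2) t with h | h
  -- `t ≥ δ - 1`: the argument `δ - t` is in `[-1, 1]`, where `T_p ≤ 1 < T_p(δ)`.
  · have h3 : (T ℝ p).eval (δ - t) ≤ 1 :=
      (le_abs_self _).trans (abs_eval_T_real_le_one _ (abs_le.mpr ⟨by linarith, by linarith⟩))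
    have h4 : (T ℝ p).eval (δ - t) / (T ℝ p).eval δ ≤ 1 / (1 + ν) := by
      rw [div_le_div_iff₀ h0 (by linarith)]
      nlinarith
    have h5 : ν / (1 + ν) = 1 - 1 / (1 + ν) := by field_simp; ring
    nlinarith
  -- `t < δ - 1`: between `δ - t > 1` and `δ` the slope of `T_p` is at least `p²`.
  · rcases ht.eq_or_lt with rfl | ht
    · have : |q| = 0 := le_antisymm (by simpa using hq') (abs_nonneg _)
      simp [this, h0.ne']
    · obtain ⟨ξ, h3, h4, h5⟩ := exists_eval_sub_eval (T ℝ p) δ ht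
      have h6 := sq_le_eval_derivative_T p (δ := ξ) (by linarith)
      have h7 : t * (p : ℝ) ^ 2 ≤ (T ℝ p).eval δ - (T ℝ p).eval (δ - t) := by
        rw [h5]
        exact mul_le_mul_of_nonneg_left h6 ht.le
      have h8 := eval_T_le_two hp hν hν' hδ
      have h9 : t * (p : ℝ) ^ 2 / 2 ≤ 1 - (T ℝ p).eval (δ - t) / (T ℝ p).eval δ := by
        have : 1 - (T ℝ p).eval (δ - t) / (T ℝ p).eval δ =
            ((T ℝ p).eval δ - (T ℝ p).eval (δ - t)) / (T ℝ p).eval δ := by field_simp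
        rw [this]
        exact div_le_div₀ (by nlinarith [mul_pos ht (pow_pos hp' 2)]) h7 h0 h8
      nlinarith [abs_nonneg q]

include hp hν hδ in
/-- The stabilized symbol stays below `4` by a margin independent of `p`. -/
theorem symbol_le {t : ℝ} (ht' : t ≤ 2) :
    2 * (1 - (T ℝ p).eval (δ - t) / (T ℝ p).eval δ) ≤ 4 - 2 * (ν / (1 + ν)) := by
  have h1 := one_le_delta hν hδ
  have h2 := one_add_le_eval_T hp hν hδ
  have h0 : 0 < (T ℝ p).eval δ := by linarith
  have h5 : ν / (1 + ν) = 1 - 1 / (1 + ν) := by field_simp; ring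
  have h3 : -1 / (1 + ν) ≤ (T ℝ p).eval (δ - t) / (T ℝ p).eval δ := by
    rcases le_or_gt (δ - t) 1 with h | h
    · have h4 := neg_le_of_abs_le
        (abs_eval_T_real_le_one (p : ℤ) (x := δ - t) (abs_le.mpr ⟨by linarith, h⟩))
      rw [div_le_div_iff₀ (by linarith) h0]
      nlinarith
    · have h4 := one_le_eval_T_real (p : ℤ) h.le
      have : (0 : ℝ) ≤ (T ℝ p).eval (δ - t) / (T ℝ p).eval δ := by positivity
      have h6 : -1 / (1 + ν) ≤ 0 := div_nonpos_of_nonpos_of_nonneg (by norm_num) (by linarith)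
      linarith
  have : -1 / (1 + ν) = - (1 / (1 + ν)) := by ring
  linarith

end Stabilized

end Cheb

/-! ### Functions of a symmetric operator -/

section FunctionalCalculus

variable {S : Type*} [NormedAddCommGroup S] [InnerProductSpace ℝ S] [FiniteDimensional ℝ S]
  {H : S →ₗ[ℝ] S} (hH : H.IsSymmetric)

/-- The operator `φ(H)` for a symmetric operator `H` on a finite dimensional space and an arbitrary
function `φ`, which acts on the eigenvectors of `H` with eigenvalue `μ` as multiplication by
`φ μ`. -/
def fc (φ : ℝ → ℝ) : S →ₗ[ℝ] S where
  toFun v := ∑ i, (φ (hH.eigenvalues rfl i) * inner ℝ (hH.eigenvectorBasis rfl i) v) •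
    hH.eigenvectorBasis rfl i
  map_add' v w := by
    simp only [inner_add_right, mul_add, add_smul, Finset.sum_add_distrib]
  map_smul' c v := by
    simp only [inner_smul_right, Finset.smul_sum, smul_smul, RingHom.id_apply]
    exact Finset.sum_congr rfl fun i _ => by congr 1; ring

/-- The eigenvalues of `H` in whose eigenspaces `v` has a component. Only the values of `φ` at
these points matter for `φ(H) v`. -/
def specAt (v : S) : Set ℝ :=
  {x | ∃ i, hH.eigenvalues rfl i = x ∧ inner ℝ (hH.eigenvectorBasis rfl i) v ≠ 0}

theorem inner_fc (φ : ℝ → ℝ) (v : S) (i) :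
    inner ℝ (hH.eigenvectorBasis rfl i) (fc hH φ v) =
      φ (hH.eigenvalues rfl i) * inner ℝ (hH.eigenvectorBasis rfl i) v := by
  classical
  simp only [fc, LinearMap.coe_mk, AddHom.coe_mk]
  rw [inner_sum, Finset.sum_eq_single i]
  · rw [inner_smul_right, (hH.eigenvectorBasis rfl).inner_eq_one, mul_one]
  · intro j _ hj
    rw [inner_smul_right, (hH.eigenvectorBasis rfl).inner_eq_zero (Ne.symm hj), mul_zero]
  · simp

theorem ext_inner_eigenvectorBasis {v w : S}
    (h : ∀ i, inner ℝ (hH.eigenvectorBasis rfl i) v = inner ℝ (hH.eigenvectorBasis rfl i) w) :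
    v = w := by
  rw [← (hH.eigenvectorBasis rfl).sum_repr' v, ← (hH.eigenvectorBasis rfl).sum_repr' w]
  exact Finset.sum_congr rfl fun i _ => by rw [h i]

theorem fc_congr {φ χ : ℝ → ℝ} {v : S} (h : ∀ x ∈ specAt hH v, φ x = χ x) :
    fc hH φ v = fc hH χ v := by
  refine ext_inner_eigenvectorBasis hH fun i => ?_
  rw [inner_fc, inner_fc]
  by_cases h0 : inner ℝ (hH.eigenvectorBasis rfl i) v = 0
  · rw [h0, mul_zero, mul_zero]
  · rw [h _ ⟨i, rfl, h0⟩]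

theorem fc_fc (φ χ : ℝ → ℝ) (v : S) : fc hH φ (fc hH χ v) = fc hH (fun x => φ x * χ x) v := by
  refine ext_inner_eigenvectorBasis hH fun i => ?_
  rw [inner_fc, inner_fc, inner_fc, mul_assoc]

theorem fc_const (c : ℝ) (v : S) : fc hH (fun _ => c) v = c • v := by
  refine ext_inner_eigenvectorBasis hH fun i => ?_
  rw [inner_fc, inner_smul_right]

theorem fc_id (v : S) : fc hH (fun x => x) v = H v := by
  refine ext_inner_eigenvectorBasis hH fun i => ?_
  rw [inner_fc, ← hH, hH.apply_eigenvectorBasis, inner_smul_left]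
  simp

theorem fc_add (φ χ : ℝ → ℝ) (v : S) :
    fc hH (fun x => φ x + χ x) v = fc hH φ v + fc hH χ v := by
  refine ext_inner_eigenvectorBasis hH fun i => ?_
  rw [inner_fc, inner_add_right, inner_fc, inner_fc, add_mul]

theorem fc_smul (c : ℝ) (φ : ℝ → ℝ) (v : S) : fc hH (fun x => c * φ x) v = c • fc hH φ v := by
  refine ext_inner_eigenvectorBasis hH fun i => ?_
  rw [inner_fc, inner_smul_right, inner_fc, mul_assoc]

theorem fc_symm (φ : ℝ → ℝ) (v w : S) : inner ℝ (fc hH φ v) w = inner ℝ v (fc hH φ w) := by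
  rw [← (hH.eigenvectorBasis rfl).sum_inner_mul_inner (fc hH φ v) w,
    ← (hH.eigenvectorBasis rfl).sum_inner_mul_inner v (fc hH φ w)]
  refine Finset.sum_congr rfl fun i _ => ?_
  rw [inner_fc, real_inner_comm, inner_fc, real_inner_comm v]
  ring

theorem inner_fc_mono {φ χ : ℝ → ℝ} {v : S} (h : ∀ x ∈ specAt hH v, φ x ≤ χ x) :
    inner ℝ (fc hH φ v) v ≤ inner ℝ (fc hH χ v) v := by
  rw [← (hH.eigenvectorBasis rfl).sum_inner_mul_inner (fc hH φ v) v,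
    ← (hH.eigenvectorBasis rfl).sum_inner_mul_inner (fc hH χ v) v]
  refine Finset.sum_le_sum fun i _ => ?_
  rw [real_inner_comm, inner_fc, real_inner_comm _ (fc hH χ v), inner_fc]
  by_cases h0 : inner ℝ (hH.eigenvectorBasis rfl i) v = 0
  · rw [h0, mul_zero, mul_zero]
  · rw [mul_assoc, mul_assoc]
    exact mul_le_mul_of_nonneg_right (h _ ⟨i, rfl, h0⟩) (mul_self_nonneg _)

theorem norm_fc_le {φ : ℝ → ℝ} {K : ℝ} {v : S} (hK : 0 ≤ K) (h : ∀ x ∈ specAt hH v, |φ x| ≤ K) :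
    ‖fc hH φ v‖ ≤ K * ‖v‖ := by
  refine abs_le_of_sq_le_sq' ?_ (by positivity) |>.2
  rw [← real_inner_self_eq_norm_sq, ← fc_symm, fc_fc, mul_pow, ← real_inner_self_eq_norm_sq,
    ← real_inner_smul_left, ← fc_const hH]
  refine inner_fc_mono hH fun x hx => ?_
  rw [← pow_two]
  exact sq_le_sq' (abs_le.mp (h x hx)).1 (abs_le.mp (h x hx)).2

end FunctionalCalculus

/-! ### The operators of local time-stepping -/

/-- A symmetric positive definite operator `A` (the stiffness operator) and an orthogonal projection
`P` (the restriction to the fine degrees of freedom) on a space with scalar product. -/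
structure LocalOp (S : Type*) [NormedAddCommGroup S] [InnerProductSpace ℝ S] where
  A : S →ₗ[ℝ] S
  P : S →ₗ[ℝ] S
  symm : A.IsSymmetric
  proj_symm : P.IsSymmetric
  proj_proj : ∀ v, P (P v) = P v
  pos : ∀ v, v ≠ 0 → 0 < inner ℝ (A v) v

namespace LocalOp

variable {S : Type*} [NormedAddCommGroup S] [InnerProductSpace ℝ S] [FiniteDimensional ℝ S]
  (L : LocalOp S)

/-- The local operator `P A P`. -/
def H : S →ₗ[ℝ] S := L.P ∘ₗ L.A ∘ₗ L.P

omit [FiniteDimensional ℝ S] in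
theorem H_apply (v : S) : L.H v = L.P (L.A (L.P v)) := rfl

omit [FiniteDimensional ℝ S] in
theorem H_symm : L.H.IsSymmetric := fun v w => by
  rw [H_apply, H_apply, L.proj_symm, L.symm, L.proj_symm]

omit [FiniteDimensional ℝ S] in
theorem norm_P_le (v : S) : ‖L.P v‖ ≤ ‖v‖ := by
  have h : ‖L.P v‖ ^ 2 = inner ℝ (L.P v) v := by
    rw [← real_inner_self_eq_norm_sq, L.proj_symm, L.proj_proj, ← L.proj_symm]
  have h2 := real_inner_le_norm (L.P v) v
  rcases (norm_nonneg (L.P v)).eq_or_lt with h0 | h0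
  · rw [← h0]
    exact norm_nonneg v
  · nlinarith

/-- The local eigenvalues that are felt by vectors in the range of `P` are positive. -/
theorem pos_of_mem_specAt {v : S} {x : ℝ} (hx : x ∈ specAt L.H_symm (L.P v)) : 0 < x := by
  obtain ⟨i, rfl, h⟩ := hx
  set b := L.H_symm.eigenvectorBasis rfl i
  have h1 : L.H b = L.H_symm.eigenvalues rfl i • b := L.H_symm.apply_eigenvectorBasis rfl i
  have h2 : inner ℝ (L.A (L.P b)) (L.P b) = L.H_symm.eigenvalues rfl i := by
    rw [← L.proj_symm, ← H_apply, h1, inner_smul_left, real_inner_self_eq_norm_sq,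
      (L.H_symm.eigenvectorBasis rfl).norm_eq_one]
    simp
  rw [← h2]
  refine L.pos _ fun h0 => h ?_
  rw [← L.proj_symm, h0, inner_zero_left]

theorem le_of_mem_specAt {v : S} {x Λ : ℝ} (hΛ : ∀ u, inner ℝ (L.A u) u ≤ Λ * ‖u‖ ^ 2)
    (h0 : 0 ≤ Λ) (hx : x ∈ specAt L.H_symm v) : x ≤ Λ := by
  obtain ⟨i, rfl, h⟩ := hx
  set b := L.H_symm.eigenvectorBasis rfl i
  have h1 : L.H b = L.H_symm.eigenvalues rfl i • b := L.H_symm.apply_eigenvectorBasis rfl i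
  have hb : ‖b‖ = 1 := (L.H_symm.eigenvectorBasis rfl).norm_eq_one i
  have h2 : inner ℝ (L.A (L.P b)) (L.P b) = L.H_symm.eigenvalues rfl i := by
    rw [← L.proj_symm, ← H_apply, h1, inner_smul_left, real_inner_self_eq_norm_sq, hb]
    simp
  rw [← h2]
  refine (hΛ _).trans ?_
  have := L.norm_P_le b
  rw [hb] at this
  have h3 : ‖L.P b‖ ^ 2 ≤ 1 := pow_le_one₀ (norm_nonneg _) this
  nlinarith

/-- The operator `q(A P)`, for an arbitrary function `q`. As `A P` need not be symmetric, it is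
expressed by a function of the symmetric operator `P A P`:
`q(A P) = q(0) + A P ((q - q(0)) / x)(P A P) P`. The junk value of the quotient at `x = 0` is
irrelevant, because on the range of `P` only positive eigenvalues occur. -/
def R (q : ℝ → ℝ) (r : S) : S :=
  q 0 • r + L.A (L.P (fc L.H_symm (fun x => (q x - q 0) / x) (L.P r)))

theorem R_const (c : ℝ) (r : S) : L.R (fun _ => c) r = c • r := by
  have : (fun x : ℝ => (c - c) / x) = fun _ => 0 := by funext x; simp
  rw [R, this, fc_const]
  simp

theorem R_add (q q' : ℝ → ℝ) (r : S) : L.R (fun x => q x + q' x) r = L.R q r + L.R q' r := by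
  have : (fun x : ℝ => (q x + q' x - (q 0 + q' 0)) / x) =
      fun x => (q x - q 0) / x + (q' x - q' 0) / x := by funext x; ring
  simp only [R]
  rw [this, fc_add, map_add, map_add, add_smul]
  abel

theorem R_smul (c : ℝ) (q : ℝ → ℝ) (r : S) : L.R (fun x => c * q x) r = c • L.R q r := by
  have : (fun x : ℝ => (c * q x - c * q 0) / x) = fun x => c * ((q x - q 0) / x) := by
    funext x; ring
  simp only [R]
  rw [this, fc_smul, map_smul, map_smul, smul_add, smul_smul]

theorem R_vec_add (q : ℝ → ℝ) (r r' : S) : L.R q (r + r') = L.R q r + L.R q r' := by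
  simp only [R, map_add, smul_add]
  abel

theorem R_vec_smul (q : ℝ → ℝ) (c : ℝ) (r : S) : L.R q (c • r) = c • L.R q r := by
  simp only [R, map_smul, smul_add, smul_comm c]

theorem R_sub (q q' : ℝ → ℝ) (r : S) : L.R (fun x => q x - q' x) r = L.R q r - L.R q' r := by
  have h := L.R_add q (fun x => (-1) * q' x) r
  rw [R_smul] at h
  rw [sub_eq_add_neg, ← neg_one_smul ℝ, ← h]
  congr 1
  funext x
  ring

theorem R_vec_sub (q : ℝ → ℝ) (r r' : S) : L.R q (r - r') = L.R q r - L.R q r' := by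
  simp only [R, map_sub, smul_sub]
  abel

theorem R_congr {q q' : ℝ → ℝ} (h : ∀ x, q x = q' x) (r : S) : L.R q r = L.R q' r := by
  rw [funext h]

/-- Multiplicativity: `(A P) q(A P) = (x q)(A P)`. -/
theorem A_P_R (q : ℝ → ℝ) (r : S) : L.A (L.P (L.R q r)) = L.R (fun x => x * q x) r := by
  have h1 : L.P (L.R q r) =
      L.P (fc L.H_symm (fun x => (x * q x - 0 * q 0) / x) (L.P r)) := by
    have h2 : fc L.H_symm (fun x => (x * q x - 0 * q 0) / x) (L.P r) =
        q 0 • L.P r + L.H (fc L.H_symm (fun x => (q x - q 0) / x) (L.P r)) := by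
      rw [← fc_id L.H_symm (fc _ _ _), fc_fc, ← fc_const L.H_symm (q 0), ← fc_add]
      refine fc_congr _ fun x hx => ?_
      have := (L.pos_of_mem_specAt hx).ne'
      field_simp
      ring
    rw [h2, R, map_add, map_smul, map_add, map_smul, L.proj_proj, H_apply, L.proj_proj]
  rw [h1]
  simp [R]

/-- The stiffness operator `A_ψ = ψ(A P) A` of the method with symbol `ψ`. -/
def Ap (ψ : ℝ → ℝ) (u : S) : S := L.R ψ (L.A u)

/-- `A_ψ⁻¹ φ(A P) P` for functions with `φ 0 = 0`, namely `P (φ / (x ψ))(P A P) P`. -/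
def F (ψ φ : ℝ → ℝ) (g : S) : S := L.P (fc L.H_symm (fun x => φ x / (x * ψ x)) (L.P g))

theorem Ap_add (ψ : ℝ → ℝ) (u v : S) : L.Ap ψ (u + v) = L.Ap ψ u + L.Ap ψ v := by
  rw [Ap, map_add, R_vec_add]; rfl

theorem Ap_smul (ψ : ℝ → ℝ) (c : ℝ) (u : S) : L.Ap ψ (c • u) = c • L.Ap ψ u := by
  rw [Ap, map_smul, R_vec_smul]; rfl

/-- `A_ψ` as a linear map. -/
def ApL (ψ : ℝ → ℝ) : S →ₗ[ℝ] S where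
  toFun := L.Ap ψ
  map_add' := L.Ap_add ψ
  map_smul' := L.Ap_smul ψ

theorem ApL_apply (ψ : ℝ → ℝ) (u : S) : L.ApL ψ u = L.R ψ (L.A u) := rfl

theorem F_add (ψ φ : ℝ → ℝ) (g g' : S) : L.F ψ φ (g + g') = L.F ψ φ g + L.F ψ φ g' := by
  simp only [F, map_add]

theorem F_smul (ψ φ : ℝ → ℝ) (c : ℝ) (g : S) : L.F ψ φ (c • g) = c • L.F ψ φ g := by
  simp only [F, map_smul]

theorem F_sub (ψ φ : ℝ → ℝ) (g g' : S) : L.F ψ φ (g - g') = L.F ψ φ g - L.F ψ φ g' := by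
  simp only [F, map_sub]

theorem ApL_symm {ψ : ℝ → ℝ} : (L.ApL ψ).IsSymmetric := fun u v => by
  have h1 : ∀ y z, inner ℝ y (L.A (L.P z)) = inner ℝ (L.P (L.A y)) z := fun y z => by
    rw [← L.symm, ← L.proj_symm]
  rw [ApL_apply, ApL_apply, R, R, inner_add_left, inner_add_right, inner_smul_left,
    inner_smul_right, h1, L.symm u v, L.symm (L.P _), L.proj_symm, fc_symm]
  rfl

/-- A defect in the range of `A_ψ`: this turns a defect that is not small into a small change of
the error. -/
theorem ApL_F {ψ φ : ℝ → ℝ} (hψ0 : ψ 0 = 1) (hφ : φ 0 = 0) (g : S)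
    (hψ : ∀ x ∈ specAt L.H_symm (L.P g), ψ x ≠ 0) :
    L.ApL ψ (L.F ψ φ g) = L.R φ g := by
  have h1 : L.F ψ φ g = L.P (fc L.H_symm (fun x => φ x / (x * ψ x)) (L.P g)) := rfl
  rw [ApL_apply, R, R, hψ0, hφ, one_smul, zero_smul, zero_add, h1, ← L.H_apply,
    ← fc_id L.H_symm, ← map_add, ← map_add, fc_fc, fc_fc, ← fc_add]
  congr 2
  refine fc_congr _ fun x hx => ?_
  have h2 := hψ x hx
  have h3 := (L.pos_of_mem_specAt hx).ne'
  field_simp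
  ring

theorem R_P {φ : ℝ → ℝ} (hφ : φ 0 = 0) (g : S) : L.R φ (L.P g) = L.R φ g := by
  rw [R, R, hφ, zero_smul, zero_smul, L.proj_proj]

theorem norm_F_le {ψ φ : ℝ → ℝ} {K : ℝ} (hK : 0 ≤ K) (g : S)
    (h : ∀ x ∈ specAt L.H_symm (L.P g), 0 < x * ψ x ∧ |φ x| ≤ K * (x * ψ x)) :
    ‖L.F ψ φ g‖ ≤ K * ‖g‖ := by
  refine (L.norm_P_le _).trans ((norm_fc_le L.H_symm hK fun x hx => ?_).trans
    (mul_le_mul_of_nonneg_left (L.norm_P_le g) hK))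
  obtain ⟨h1, h2⟩ := h x hx
  rw [abs_div, abs_of_pos h1, div_le_iff₀ h1]
  exact h2

section Form

variable {ψ : ℝ → ℝ} {K cA : ℝ} (hψ0 : ψ 0 = 1) (hK : 0 ≤ K)
  (hψ1 : ∀ v, ∀ x ∈ specAt L.H_symm (L.P v), ψ x ≤ 1)
  (hψK : ∀ v, ∀ x ∈ specAt L.H_symm (L.P v), 1 - ψ x ≤ K * (x * ψ x))
  (hcA : 0 < cA) (hcoer : ∀ v, cA * ‖v‖ ^ 2 ≤ inner ℝ (L.A v) v)

include hψ0 in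
theorem inner_ApL (u : S) : inner ℝ (L.ApL ψ u) u = inner ℝ (L.A u) u +
    inner ℝ (fc L.H_symm (fun x => (ψ x - 1) / x) (L.P (L.A u))) (L.P (L.A u)) := by
  rw [ApL_apply, R, hψ0, one_smul, inner_add_left, L.symm (L.P _), L.proj_symm]

include hψ0 hψ1 in
theorem inner_ApL_le (u : S) : inner ℝ (L.ApL ψ u) u ≤ inner ℝ (L.A u) u := by
  rw [L.inner_ApL hψ0]
  have : inner ℝ (fc L.H_symm (fun x => (ψ x - 1) / x) (L.P (L.A u))) (L.P (L.A u)) ≤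
      inner ℝ (fc L.H_symm (fun _ => 0) (L.P (L.A u))) (L.P (L.A u)) := by
    refine inner_fc_mono _ fun x hx => ?_
    exact div_nonpos_of_nonpos_of_nonneg (by linarith [hψ1 _ x hx]) (L.pos_of_mem_specAt hx).le
  rw [fc_const, zero_smul, inner_zero_left] at this
  linarith

include hψ0 hψ1 hψK hcA hcoer hK in
/-- `A_ψ` is bounded below uniformly, although `ψ` itself is not: a perturbation
`v = u + P χ(P A P) P A u` of `u`, `χ = (ψ - 1) / x`, satisfies
`⟨A v, v⟩ ≤ ⟨A_ψ u, u⟩` and `‖u - v‖² ≤ K (⟨A_ψ u, u⟩ - ⟨A v, v⟩)`. -/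
theorem norm_sq_le_inner_ApL (u : S) :
    ‖u‖ ^ 2 ≤ 2 * (1 / cA + K) * inner ℝ (L.ApL ψ u) u := by
  set χ : ℝ → ℝ := fun x => (ψ x - 1) / x
  set g := L.P (L.A u) with hg
  set y := L.P (fc L.H_symm χ g) with hy
  have e1 : inner ℝ (L.A (u + y)) (u + y) = inner ℝ (L.A u) u + 2 * inner ℝ (fc L.H_symm χ g) g +
      inner ℝ (fc L.H_symm (fun x => χ x * (x * χ x)) g) g := by
    have h1 : inner ℝ (L.A u) y = inner ℝ (fc L.H_symm χ g) g := by
      rw [hy, ← L.proj_symm, ← hg, ← fc_symm]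
    have h2 : inner ℝ (L.A y) u = inner ℝ (L.A u) y := by
      rw [L.symm, real_inner_comm]
    have h3 : inner ℝ (L.A y) y = inner ℝ (fc L.H_symm (fun x => χ x * (x * χ x)) g) g := by
      rw [← fc_fc, fc_symm, ← fc_fc L.H_symm (fun x => x), fc_id, H_apply, hy, L.proj_symm]
    rw [map_add, inner_add_left, inner_add_right, inner_add_right, h2, h1, h3]
    ring
  have e2 : inner ℝ (L.ApL ψ u) u = inner ℝ (L.A u) u + inner ℝ (fc L.H_symm χ g) g :=
    L.inner_ApL hψ0 u
  have e3 : inner ℝ (L.ApL ψ u) u - inner ℝ (L.A (u + y)) (u + y) =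
      inner ℝ (fc L.H_symm (fun x => -1 * (χ x + χ x * (x * χ x))) g) g := by
    rw [e1, e2, fc_smul, fc_add, inner_smul_left, inner_add_left]
    simp
    ring
  have hχ : ∀ x ∈ specAt L.H_symm g, -1 * (χ x + χ x * (x * χ x)) = (1 - ψ x) * ψ x / x ∧
      0 < x ∧ 0 < ψ x ∧ χ x * χ x = (1 - ψ x) * (1 - ψ x) / (x * x) := by
    intro x hx
    have h0 := L.pos_of_mem_specAt hx
    refine ⟨?_, h0, ?_, ?_⟩
    · simp only [χ]
      field_simp
      ring
    · by_contra! hn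
      have h1 := hψK _ x hx
      have h2 : K * (x * ψ x) ≤ 0 :=
        mul_nonpos_of_nonneg_of_nonpos hK (mul_nonpos_of_nonneg_of_nonpos h0.le hn)
      linarith
    · simp only [χ]
      field_simp
      ring
  have e4 : ‖y‖ ^ 2 ≤ K * (inner ℝ (L.ApL ψ u) u - inner ℝ (L.A (u + y)) (u + y)) := by
    have h1 : ‖y‖ ^ 2 ≤ ‖fc L.H_symm χ g‖ ^ 2 :=
      pow_le_pow_left₀ (norm_nonneg _) (L.norm_P_le _) 2
    refine h1.trans ?_
    rw [e3, ← real_inner_self_eq_norm_sq, ← fc_symm, fc_fc, ← real_inner_smul_left, ← fc_smul]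
    refine inner_fc_mono _ fun x hx => ?_
    obtain ⟨k1, k2, k3, k4⟩ := hχ x hx
    rw [k1, k4]
    have k5 := hψK _ x hx
    have k6 := hψ1 _ x hx
    rw [div_le_iff₀ (by positivity)]
    have k7 : K * ((1 - ψ x) * ψ x / x) * (x * x) = (1 - ψ x) * (K * (x * ψ x)) := by
      field_simp
    rw [k7]
    exact mul_le_mul_of_nonneg_left k5 (by linarith)
  have e5 : 0 ≤ inner ℝ (L.ApL ψ u) u - inner ℝ (L.A (u + y)) (u + y) := by
    rw [e3]
    have : inner ℝ (fc L.H_symm (fun _ => (0 : ℝ)) g) g ≤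
      inner ℝ (fc L.H_symm (fun x => -1 * (χ x + χ x * (x * χ x))) g) g := by
      refine inner_fc_mono _ fun x hx => ?_
      obtain ⟨k1, k2, k3, k4⟩ := hχ x hx
      have k6 := hψ1 _ x hx
      rw [k1]
      exact div_nonneg (mul_nonneg (by linarith) k3.le) k2.le
    rwa [fc_const, zero_smul, inner_zero_left] at this
  have e6 := hcoer (u + y)
  have e7 : ‖u‖ ≤ ‖u + y‖ + ‖y‖ := by
    have := norm_sub_le (u + y) y
    rwa [add_sub_cancel_right] at this
  have e8 : ‖u‖ ^ 2 ≤ 2 * (‖u + y‖ ^ 2 + ‖y‖ ^ 2) := by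
    nlinarith [sq_nonneg (‖u + y‖ - ‖y‖), norm_nonneg u, norm_nonneg (u + y), norm_nonneg y]
  have e9 : ‖u + y‖ ^ 2 ≤ 1 / cA * inner ℝ (L.A (u + y)) (u + y) := by
    rw [one_div, inv_mul_eq_div, le_div_iff₀ hcA]
    linarith
  have e10 : (0 : ℝ) ≤ inner ℝ (L.A (u + y)) (u + y) :=
    le_trans (by positivity) e6
  have e11 : 0 ≤ 1 / cA := by positivity
  nlinarith [mul_nonneg hK e10, mul_nonneg e11 e5]

include hψ0 hψ1 hψK hcA hcoer hK in
/-- The upper bound of `A_ψ`: on the fine degrees of freedom by the symbol `x ψ`, on the coarse ones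
by `A` itself. -/
theorem inner_ApL_le_norm_sq {B α : ℝ} (hB : 0 < B) (hα : 0 < α)
    (hψB : ∀ v, ∀ x ∈ specAt L.H_symm (L.P v), x * ψ x ≤ B)
    (hcoarse : ∀ v, inner ℝ (L.A (v - L.P v)) (v - L.P v) ≤ α * ‖v - L.P v‖ ^ 2) (u : S) :
    inner ℝ (L.ApL ψ u) u ≤ (B + α) * ‖u‖ ^ 2 := by
  set y := L.P u with hy
  set x := u - L.P u with hx
  have hu : u = x + y := by rw [hx, hy]; abel
  have hPy : L.P y = y := by rw [hy, L.proj_proj]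
  have h1 : inner ℝ (L.ApL ψ x) x ≤ α * ‖x‖ ^ 2 :=
    (L.inner_ApL_le hψ0 hψ1 x).trans (hcoarse u)
  have h2 : inner ℝ (L.ApL ψ y) y ≤ B * ‖y‖ ^ 2 := by
    rw [L.inner_ApL hψ0]
    have e1 : inner ℝ (L.A y) y = inner ℝ (fc L.H_symm (fun x => x) y) y := by
      rw [fc_id, H_apply, hPy, L.proj_symm, hPy]
    have e2 : L.P (L.A y) = fc L.H_symm (fun x => x) y := by rw [fc_id, H_apply, hPy]
    rw [e1, e2, fc_fc, ← fc_symm, fc_fc, ← inner_add_left, ← fc_add, ← real_inner_self_eq_norm_sq,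
      ← real_inner_smul_left, ← fc_const L.H_symm]
    refine inner_fc_mono _ fun t ht => ?_
    rw [← hPy] at ht
    have := hψB _ t ht
    have h0 := (L.pos_of_mem_specAt ht).ne'
    refine le_trans (le_of_eq ?_) this
    field_simp
    ring
  have h3 : ‖u‖ ^ 2 = ‖x‖ ^ 2 + ‖y‖ ^ 2 := by
    have : inner ℝ x y = 0 := by
      rw [hy, ← L.proj_symm, hx, map_sub, L.proj_proj, sub_self, inner_zero_left]
    rw [hu, ← real_inner_self_eq_norm_sq, inner_add_left, inner_add_right, inner_add_right,
      real_inner_comm x y, this, real_inner_self_eq_norm_sq, real_inner_self_eq_norm_sq]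
    ring
  have h4 : 0 ≤ inner ℝ (L.ApL ψ (B • x - α • y)) (B • x - α • y) := by
    have := L.norm_sq_le_inner_ApL hψ0 hK hψ1 hψK hcA hcoer (B • x - α • y)
    have h5 : 0 < 2 * (1 / cA + K) := by positivity
    exact nonneg_of_mul_nonneg_right ((sq_nonneg _).trans this) h5
  have h6 : inner ℝ (L.ApL ψ y) x = inner ℝ (L.ApL ψ x) y := by
    rw [L.ApL_symm, real_inner_comm]
  rw [map_sub, map_smul, map_smul, inner_sub_left, inner_sub_right, inner_sub_right,
    inner_smul_left, inner_smul_left, inner_smul_left, inner_smul_left, inner_smul_right,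
    inner_smul_right, inner_smul_right, inner_smul_right, h6] at h4
  simp only [conj_trivial] at h4
  have h7 : 2 * inner ℝ (L.ApL ψ x) y ≤ B * ‖x‖ ^ 2 + α * ‖y‖ ^ 2 := by
    have h8 := mul_le_mul_of_nonneg_left h1 (by positivity : 0 ≤ B * B)
    have h9 := mul_le_mul_of_nonneg_left h2 (by positivity : 0 ≤ α * α)
    have h10 : 0 < α * B := by positivity
    by_contra! hn
    have := mul_lt_mul_of_pos_left hn h10
    nlinarith
  rw [h3]
  conv_lhs => rw [hu]
  rw [map_add, inner_add_left, inner_add_right, inner_add_right, h6]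
  linarith

end Form

end LocalOp

/-! ### Stability of the leapfrog recursion -/

section Leapfrog

variable {S : Type*} [NormedAddCommGroup S] [InnerProductSpace ℝ S] {K : S →ₗ[ℝ] S}

/-- The conserved energy of the leapfrog recursion `x_{n+1} - 2 x_n + x_{n-1} = - K x_n`, as a
function of two consecutive iterates `x`, `y`. -/
def leapEnergy (K : S →ₗ[ℝ] S) (x y : S) : ℝ :=
  ‖y - x‖ ^ 2 - 1 / 4 * inner ℝ (K (y - x)) (y - x) + 1 / 4 * inner ℝ (K (y + x)) (y + x)

/-- Only the right-hand side changes the energy. -/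
theorem leapEnergy_sub (hK : K.IsSymmetric) {x y z r : S}
    (h : z - (2 : ℝ) • y + x = -K y + r) :
    leapEnergy K y z - leapEnergy K x y = inner ℝ r ((z - y) + (y - x)) := by
  have hr : r = z - (2 : ℝ) • y + x + K y := by rw [h]; abel
  have hs : ∀ a b, inner ℝ (K a) b = inner ℝ (K b) a := fun a b => by rw [hK, real_inner_comm]
  rw [hr]
  simp only [leapEnergy, ← real_inner_self_eq_norm_sq, map_add, map_sub, inner_add_left,
    inner_add_right, inner_sub_left, inner_sub_right, inner_smul_left, conj_trivial]
  rw [hs y x, hs z y, real_inner_comm x y, real_inner_comm x z, real_inner_comm y z]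
  ring

variable {c k : ℝ} (hc : 0 < c) (hk : 0 < k)
  (hlow : ∀ v, k * ‖v‖ ^ 2 ≤ inner ℝ (K v) v)
  (hup : ∀ v, inner ℝ (K v) v ≤ 4 * (1 - c) * ‖v‖ ^ 2)

include hk hlow hup in
theorem le_leapEnergy (x y : S) : c * ‖y - x‖ ^ 2 ≤ leapEnergy K x y := by
  have h1 := hup (y - x)
  have h2 := hlow (y + x)
  have h3 : 0 ≤ k * ‖y + x‖ ^ 2 := by positivity
  rw [leapEnergy]
  linarith

include hc hlow hup in
theorem le_leapEnergy_add (x y : S) : k / 4 * ‖y + x‖ ^ 2 ≤ leapEnergy K x y := by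
  have h1 := hup (y - x)
  have h2 := hlow (y + x)
  have h3 : 0 ≤ c * ‖y - x‖ ^ 2 := by positivity
  rw [leapEnergy]
  linarith

include hc hk hlow hup in
theorem norm_sub_le_leapEnergy (x y : S) : ‖y - x‖ ≤ √(leapEnergy K x y) / √c := by
  rw [le_div_iff₀ (Real.sqrt_pos.mpr hc)]
  refine Real.le_sqrt_of_sq_le ?_
  rw [mul_pow, Real.sq_sqrt hc.le, mul_comm]
  exact le_leapEnergy hk hlow hup x y

include hc hk hlow hup in
theorem norm_le_leapEnergy (x y : S) :
    ‖y‖ ≤ √(leapEnergy K x y) * (1 / √k + 1 / (2 * √c)) := by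
  have h1 := norm_sub_le_leapEnergy hc hk hlow hup x y
  have h2 : ‖y + x‖ ≤ 2 * (√(leapEnergy K x y) / √k) := by
    have : ‖y + x‖ / 2 ≤ √(leapEnergy K x y) / √k := by
      rw [le_div_iff₀ (Real.sqrt_pos.mpr hk)]
      refine Real.le_sqrt_of_sq_le ?_
      rw [mul_pow, Real.sq_sqrt hk.le]
      have := le_leapEnergy_add hc hlow hup x y
      linarith
    linarith
  have h3 : (2 : ℝ) • y = (y + x) + (y - x) := by rw [two_smul]; abel
  have h4 : 2 * ‖y‖ ≤ ‖y + x‖ + ‖y - x‖ := by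
    have := norm_add_le (y + x) (y - x)
    rw [← h3, norm_smul] at this
    simpa using this
  have h5 : √(leapEnergy K x y) * (1 / √k + 1 / (2 * √c)) =
      √(leapEnergy K x y) / √k + √(leapEnergy K x y) / √c / 2 := by
    field_simp
  rw [h5]
  linarith

include hc hk hlow hup in
theorem sqrt_leapEnergy_le (hK : K.IsSymmetric) {x r : ℕ → S} {N : ℕ} {R : ℝ} (hR : 0 ≤ R)
    (hx : ∀ n, n + 1 < N → x (n + 2) - (2 : ℝ) • x (n + 1) + x n = -K (x (n + 1)) + r (n + 1))
    (hr : ∀ n, n + 1 < N → ‖r (n + 1)‖ ≤ R) :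
    ∀ n, n < N → √(leapEnergy K (x n) (x (n + 1))) ≤
      √(leapEnergy K (x 0) (x 1)) + n * (R / √c) := by
  intro n
  induction n with
  | zero => intro _; simp
  | succ n ih =>
    intro hn
    have h1 := leapEnergy_sub hK (hx n hn)
    set E := leapEnergy K (x n) (x (n + 1)) with hE
    set E' := leapEnergy K (x (n + 1)) (x (n + 1 + 1)) with hE'
    have h2 : ‖x (n + 1) - x n‖ ≤ √E / √c := norm_sub_le_leapEnergy hc hk hlow hup _ _
    have h3 : ‖x (n + 2) - x (n + 1)‖ ≤ √E' / √c := norm_sub_le_leapEnergy hc hk hlow hup _ _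
    have e0 : 0 ≤ E := le_trans (by positivity) (le_leapEnergy hk hlow hup (x n) (x (n + 1)))
    have e0' : 0 ≤ E' :=
      le_trans (by positivity) (le_leapEnergy hk hlow hup (x (n + 1)) (x (n + 2)))
    have h4 : E' - E ≤ R / √c * (√E' + √E) := by
      rw [show E' - E = _ from h1]
      refine (real_inner_le_norm _ _).trans ?_
      have h5 := mul_le_mul (hr n hn) (norm_add_le (x (n + 2) - x (n + 1)) (x (n + 1) - x n))
        (norm_nonneg _) hR
      refine h5.trans ?_
      have : R / √c * (√E' + √E) = R * (√E' / √c + √E / √c) := by ring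
      rw [this]
      exact mul_le_mul_of_nonneg_left (add_le_add h3 h2) hR
    have h5 : √E' ≤ √E + R / √c := by
      have q0 : 0 ≤ R / √c := by positivity
      have q1 := Real.sqrt_nonneg E
      have q2 := Real.sqrt_nonneg E'
      by_contra! hn'
      have q3 : 0 < √E' + √E := by linarith
      have q4 : E' - E = (√E' - √E) * (√E' + √E) := by
        nlinarith [Real.sq_sqrt e0, Real.sq_sqrt e0']
      rw [q4] at h4
      have := le_of_mul_le_mul_right h4 q3
      linarith
    have h6 := ih (by omega)
    push_cast
    linarith

include hc hk hlow hup in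
/-- Stability of the leapfrog method. The initial value enters with a constant that does not depend
on the lower bound `k` of `K`: its contribution is the velocity of another solution. -/
theorem norm_leapfrog_le (hK : K.IsSymmetric) {x r : ℕ → S} {N : ℕ} {R : ℝ} (hR : 0 ≤ R)
    (hx : ∀ n, n + 1 < N → x (n + 2) - (2 : ℝ) • x (n + 1) + x n = -K (x (n + 1)) + r (n + 1))
    (hr : ∀ n, n + 1 < N → ‖r (n + 1)‖ ≤ R) (n : ℕ) (hn : n < N) :
    ‖x (n + 1)‖ ≤ ‖x 0‖ / √c +
      (‖x 1 - x 0‖ + n * (R / √c)) * (1 / √k + 1 / (2 * √c)) := by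
  -- The homogeneous solution `w` with `w 0 = - x 0` and `w 1 = 0`.
  obtain ⟨w, w0, w1, hw⟩ : ∃ w : ℕ → S, w 0 = -x 0 ∧ w 1 = 0 ∧
      ∀ n, w (n + 2) = (2 : ℝ) • w (n + 1) - w n - K (w (n + 1)) :=
    ⟨fun n => (Nat.rec ((-x 0, 0) : S × S)
      (fun _ q => (q.2, (2 : ℝ) • q.2 - q.1 - K q.2)) n : S × S).1, rfl, rfl, fun n => rfl⟩
  have w2 : w 2 = x 0 := by
    have : w 2 = (2 : ℝ) • w 1 - w 0 - K (w 1) := hw 0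
    rw [this, w1, w0]
    simp
  have hN : ∀ y : S, leapEnergy K (-y) 0 = ‖y‖ ^ 2 ∧ leapEnergy K 0 y = ‖y‖ ^ 2 := by
    intro y
    simp [leapEnergy]
  have a1 : ‖w (n + 2) - w (n + 1)‖ ≤ ‖x 0‖ / √c := by
    refine (norm_sub_le_leapEnergy hc hk hlow hup _ _).trans ?_
    have := sqrt_leapEnergy_le hc hk hlow hup hK (x := w) (r := fun _ => 0) (N := n + 2) le_rfl
      (fun j _ => by rw [hw]; module) (fun j _ => by simp) (n + 1) (by omega)
    rw [w0, w1, (hN _).1, Real.sqrt_sq (norm_nonneg _)] at this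
    refine div_le_div_of_nonneg_right ?_ (Real.sqrt_nonneg c)
    simpa using this
  -- The remaining part starts from zero.
  obtain ⟨y, hyd⟩ : ∃ y : ℕ → S, ∀ n, y n = x n - (w (n + 1) - w n) := ⟨_, fun n => rfl⟩
  have y0 : y 0 = 0 := by simp [hyd, w0, w1]
  have y1 : y 1 = x 1 - x 0 := by simp [hyd, w1, w2]
  have hy : ∀ n, n + 1 < N →
      y (n + 2) - (2 : ℝ) • y (n + 1) + y n = -K (y (n + 1)) + r (n + 1) := by
    intro j hj
    have h1 := hx j hj
    have h2 : w (j + 1 + 2) = (2 : ℝ) • w (j + 2) - w (j + 1) - K (w (j + 2)) := hw (j + 1)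
    have h3 := hw j
    have h4 : x (j + 2) = (2 : ℝ) • x (j + 1) - x j - K (x (j + 1)) + r (j + 1) := by
      rw [← sub_eq_zero] at h1 ⊢
      rw [← h1]
      abel
    have e1 : y (j + 2) = x (j + 2) - (w (j + 1 + 2) - w (j + 2)) := hyd _
    have e2 : y (j + 1) = x (j + 1) - (w (j + 2) - w (j + 1)) := hyd _
    rw [e1, e2, hyd j, h4, h2, map_sub, map_sub]
    have h5 : K (w (j + 1)) = (2 : ℝ) • w (j + 1) - w j - w (j + 2) := by rw [h3]; abel
    rw [h5]
    module
  have a2 : ‖y (n + 1)‖ ≤ (‖x 1 - x 0‖ + n * (R / √c)) * (1 / √k + 1 / (2 * √c)) := by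
    refine (norm_le_leapEnergy hc hk hlow hup (y n) (y (n + 1))).trans ?_
    refine mul_le_mul_of_nonneg_right ?_ (by positivity)
    have := sqrt_leapEnergy_le hc hk hlow hup hK hR hy hr n hn
    rwa [y0, y1, (hN _).2, Real.sqrt_sq (norm_nonneg _)] at this
  have e : x (n + 1) = (w (n + 2) - w (n + 1)) + y (n + 1) := by
    have : y (n + 1) = x (n + 1) - (w (n + 2) - w (n + 1)) := hyd _
    rw [this]; abel
  rw [e]
  exact (norm_add_le _ _).trans (add_le_add a1 a2)

end Leapfrog

/-! ### The symbols of the local steps -/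

open Polynomial in
/-- The symbol of the response of `k` local steps to a constant right-hand side. The value at `0`
is the limit. -/
def sig (δ τ : ℝ) (k : ℕ) (x : ℝ) : ℝ :=
  if x = 0 then τ * (derivative (Chebyshev.T ℝ k)).eval δ
  else ((Chebyshev.T ℝ k).eval δ - (Chebyshev.T ℝ k).eval (δ - τ * x)) / x

section Symbols

open Polynomial

variable (δ τ : ℝ)

theorem eval_T_add_two (k : ℕ) (x : ℝ) : (Chebyshev.T ℝ ((k + 2 : ℕ) : ℤ)).eval x =
    2 * x * (Chebyshev.T ℝ ((k + 1 : ℕ) : ℤ)).eval x - (Chebyshev.T ℝ k).eval x := by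
  simp [Chebyshev.T_add_two]

theorem eval_U_add_one (j : ℤ) (x : ℝ) : (Chebyshev.U ℝ (j + 1)).eval x =
    2 * x * (Chebyshev.U ℝ j).eval x - (Chebyshev.U ℝ (j - 1)).eval x := by
  simp [Chebyshev.U_add_one]

theorem sig_zero (x : ℝ) : sig δ τ 0 x = 0 := by simp [sig]

theorem sig_one (x : ℝ) : sig δ τ 1 x = τ := by
  by_cases h : x = 0
  · simp [sig, h]
  · simp [sig, h]

theorem sig_add_two (k : ℕ) (x : ℝ) : sig δ τ (k + 2) x =
    2 * δ * sig δ τ (k + 1) x - sig δ τ k x +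
      2 * τ * ((Chebyshev.T ℝ ((k + 1 : ℕ) : ℤ)).eval δ - x * sig δ τ (k + 1) x) := by
  by_cases h : x = 0
  · simp only [sig, h, if_true]
    have := congrArg (fun q => eval δ (derivative q)) (Chebyshev.T_add_two ℝ (k : ℤ))
    simp only [derivative_sub, derivative_mul, eval_sub, eval_add, eval_mul, derivative_X,
      derivative_ofNat, eval_ofNat, eval_X, eval_one, eval_zero] at this
    push_cast
    rw [this]
    ring
  · simp only [sig, h, if_false]
    rw [eval_T_add_two, eval_T_add_two]
    field_simp
    ring

variable {S : Type*} [NormedAddCommGroup S] [InnerProductSpace ℝ S] [FiniteDimensional ℝ S]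
  (L : LocalOp S)

/-- The weighted local steps `Z_k = T_k(δ) z_k` in closed form. -/
theorem localSteps_closed_form {Z G : ℕ → S} {u w : S} (h0 : Z 0 = u)
    (h1 : Z 1 = δ • u + τ • (w - L.A (L.P u)) + G 0)
    (h2 : ∀ k, Z (k + 2) = (2 * δ) • Z (k + 1) - Z k +
      (2 * τ) • ((Chebyshev.T ℝ ((k + 1 : ℕ) : ℤ)).eval δ • w - L.A (L.P (Z (k + 1)))) +
        G (k + 1)) (k : ℕ) :
    Z k = (Chebyshev.T ℝ k).eval δ • u + L.R (sig δ τ k) (w - L.A (L.P u)) +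
      ∑ j ∈ Finset.range k,
        L.R (fun x => (Chebyshev.U ℝ ((k : ℤ) - 1 - j)).eval (δ - τ * x)) (G j) := by
  induction k using Nat.twoStepInduction with
  | zero =>
    have : sig δ τ 0 = fun _ => 0 := funext (sig_zero δ τ)
    rw [h0, this, L.R_const]
    simp
  | one =>
    have : sig δ τ 1 = fun _ => τ := funext (sig_one δ τ)
    rw [h1, this, L.R_const]
    simp [L.R_const]
  | more k ih0 ih1 =>
    set r := w - L.A (L.P u) with hr
    have hw : w = r + L.A (L.P u) := by rw [hr]; abel
    have e1 : L.R (sig δ τ (k + 2)) r = (2 * δ) • L.R (sig δ τ (k + 1)) r - L.R (sig δ τ k) r +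
        (2 * τ) • ((Chebyshev.T ℝ ((k + 1 : ℕ) : ℤ)).eval δ • r -
          L.A (L.P (L.R (sig δ τ (k + 1)) r))) := by
      rw [L.A_P_R, L.R_congr (q' := fun x => (2 * δ) * sig δ τ (k + 1) x + ((-1) * sig δ τ k x +
        ((2 * τ) * (Chebyshev.T ℝ ((k + 1 : ℕ) : ℤ)).eval δ +
          (-(2 * τ)) * (x * sig δ τ (k + 1) x)))) (fun x => by rw [sig_add_two]; ring)]
      rw [L.R_add, L.R_smul, L.R_add, L.R_smul, L.R_add, L.R_const, L.R_smul]
      module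
    have e2 : ∀ j : ℕ, ∀ g : S,
        L.R (fun x => (Chebyshev.U ℝ (((k + 2 : ℕ) : ℤ) - 1 - j)).eval (δ - τ * x)) g =
        (2 * δ) • L.R (fun x => (Chebyshev.U ℝ (((k + 1 : ℕ) : ℤ) - 1 - j)).eval (δ - τ * x)) g -
        L.R (fun x => (Chebyshev.U ℝ ((k : ℤ) - 1 - j)).eval (δ - τ * x)) g -
        (2 * τ) • L.A (L.P (L.R (fun x => (Chebyshev.U ℝ (((k + 1 : ℕ) : ℤ) - 1 - j)).eval
          (δ - τ * x)) g)) := by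
      intro j g
      have e : ∀ x, (Chebyshev.U ℝ (((k + 2 : ℕ) : ℤ) - 1 - j)).eval (δ - τ * x) =
          2 * (δ - τ * x) * (Chebyshev.U ℝ (((k + 1 : ℕ) : ℤ) - 1 - j)).eval (δ - τ * x) -
          (Chebyshev.U ℝ ((k : ℤ) - 1 - j)).eval (δ - τ * x) := by
        intro x
        have := eval_U_add_one (((k + 1 : ℕ) : ℤ) - 1 - j) (δ - τ * x)
        have i1 : ((k + 1 : ℕ) : ℤ) - 1 - j + 1 = ((k + 2 : ℕ) : ℤ) - 1 - j := by push_cast; ring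
        have i2 : ((k + 1 : ℕ) : ℤ) - 1 - j - 1 = (k : ℤ) - 1 - j := by push_cast; ring
        rwa [i1, i2] at this
      rw [L.A_P_R, L.R_congr (q' := fun x =>
        (2 * δ) * (Chebyshev.U ℝ (((k + 1 : ℕ) : ℤ) - 1 - j)).eval (δ - τ * x) +
        ((-1) * (Chebyshev.U ℝ ((k : ℤ) - 1 - j)).eval (δ - τ * x) +
        (-(2 * τ)) * (x * (Chebyshev.U ℝ (((k + 1 : ℕ) : ℤ) - 1 - j)).eval (δ - τ * x))))
        (fun x => by rw [e]; ring)]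
      rw [L.R_add, L.R_smul, L.R_add, L.R_smul, L.R_smul]
      module
    have i0 : L.R (fun x => (Chebyshev.U ℝ ((k : ℤ) - 1 - k)).eval (δ - τ * x)) (G k) = 0 := by
      have : (k : ℤ) - 1 - k = -1 := by ring
      simp only [this, Chebyshev.U_neg_one, eval_zero, L.R_const, zero_smul]
    have i1 : L.R (fun x => (Chebyshev.U ℝ (((k + 1 : ℕ) : ℤ) - 1 - ((k + 1 : ℕ) : ℤ))).eval
        (δ - τ * x)) (G (k + 1)) = 0 := by
      have : ((k + 1 : ℕ) : ℤ) - 1 - ((k + 1 : ℕ) : ℤ) = -1 := by ring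
      simp only [this, Chebyshev.U_neg_one, eval_zero, L.R_const, zero_smul]
    have i2 : L.R (fun x => (Chebyshev.U ℝ (((k + 2 : ℕ) : ℤ) - 1 - ((k + 1 : ℕ) : ℤ))).eval
        (δ - τ * x)) (G (k + 1)) = G (k + 1) := by
      have : ((k + 2 : ℕ) : ℤ) - 1 - ((k + 1 : ℕ) : ℤ) = 0 := by push_cast; ring
      simp only [this, Chebyshev.U_zero, eval_one, L.R_const, one_smul]
    -- The sum for `Z k` may be extended by one term, since `U_{-1} = 0`.
    have s0 : ∑ j ∈ Finset.range k,
        L.R (fun x => (Chebyshev.U ℝ ((k : ℤ) - 1 - j)).eval (δ - τ * x)) (G j) =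
        ∑ j ∈ Finset.range (k + 1),
        L.R (fun x => (Chebyshev.U ℝ ((k : ℤ) - 1 - j)).eval (δ - τ * x)) (G j) := by
      rw [Finset.sum_range_succ, i0, add_zero]
    rw [h2, ih0, ih1, s0, Finset.sum_range_succ _ (k + 1), i2, e1,
      Finset.sum_congr rfl fun j _ => e2 j (G j), Finset.sum_sub_distrib, Finset.sum_sub_distrib,
      ← Finset.smul_sum, ← Finset.smul_sum, eval_T_add_two, hw]
    simp only [map_add, map_smul, map_sum, smul_add]
    module

end Symbols

/-! ### Uniform bounds for the symbols -/

/-- The parameters of one global time step of length `dt` with `p` local steps. -/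
structure Stepping where
  p : ℕ
  ν : ℝ
  dt : ℝ
  one_le_p : 1 ≤ p
  ν_pos : 0 < ν
  ν_le : ν ≤ 1 / 2
  dt_pos : 0 < dt

namespace Stepping

open Polynomial

variable (s : Stepping)

/-- The stabilization gain `ν / (1 + ν)`. -/
def gain : ℝ := s.ν / (1 + s.ν)

/-- The scaling `Δt² / ω` between the eigenvalues of the local operator and the argument of the
Chebyshev polynomials. -/
def τ : ℝ := s.dt ^ 2 / omg s.p s.ν

/-- The symbol `ψ` of the scheme, with `ψ 0 = 1`; its stiffness operator is `ψ(A P) A`. -/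
def psi (x : ℝ) : ℝ :=
  2 / (s.dt ^ 2 * (Chebyshev.T ℝ s.p).eval (dlt s.p s.ν)) * sig (dlt s.p s.ν) s.τ s.p x

/-- The normalized symbol of the response to a local source term `j` local steps after it has
entered. -/
def ups (j : ℕ) (x : ℝ) : ℝ :=
  (Chebyshev.U ℝ j).eval (dlt s.p s.ν - s.τ * x) / (Chebyshev.U ℝ j).eval (dlt s.p s.ν)

theorem gain_pos : 0 < s.gain := div_pos s.ν_pos (by linarith [s.ν_pos])

theorem gain_le : s.gain ≤ 1 / 3 := by
  have := s.ν_pos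
  have := s.ν_le
  rw [gain, div_le_iff₀ (by linarith)]
  linarith

theorem p_pos : (0 : ℝ) < s.p := by exact_mod_cast s.one_le_p

theorem one_le_dlt : 1 ≤ dlt s.p s.ν := Cheb.one_le_delta (p := s.p) s.ν_pos.le rfl

theorem T_pos : 0 < (Chebyshev.T ℝ s.p).eval (dlt s.p s.ν) :=
  zero_lt_one.trans_le (Chebyshev.one_le_eval_T_real _ s.one_le_dlt)

theorem dT_pos : 0 < (derivative (Chebyshev.T ℝ s.p)).eval (dlt s.p s.ν) :=
  (pow_pos s.p_pos 2).trans_le (Cheb.sq_le_eval_derivative_T s.p s.one_le_dlt)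

theorem omg_pos : 0 < omg s.p s.ν := mul_pos two_pos (div_pos s.dT_pos s.T_pos)

theorem τ_pos : 0 < s.τ := div_pos (pow_pos s.dt_pos 2) s.omg_pos

theorem le_omg : 2 * (s.p : ℝ) ^ 2 ≤ (1 + s.ν) * omg s.p s.ν := by
  have h := Cheb.sq_mul_eval_T_le s.one_le_p s.ν_pos.le (rfl : dlt s.p s.ν = _)
  have h2 : (s.p : ℝ) ^ 2 ≤ (1 + s.ν) * (derivative (Chebyshev.T ℝ s.p)).eval (dlt s.p s.ν) /
      (Chebyshev.T ℝ s.p).eval (dlt s.p s.ν) := by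
    rw [le_div_iff₀ s.T_pos]
    exact h
  have h3 : (1 + s.ν) * omg s.p s.ν = 2 * ((1 + s.ν) *
      (derivative (Chebyshev.T ℝ s.p)).eval (dlt s.p s.ν) /
      (Chebyshev.T ℝ s.p).eval (dlt s.p s.ν)) := by
    rw [omg]; ring
  linarith

theorem psi_zero : s.psi 0 = 1 := by
  have h1 := s.T_pos.ne'
  have h2 := s.dT_pos.ne'
  have h3 := s.dt_pos.ne'
  simp only [psi, sig, if_true, τ, omg]
  field_simp

theorem mul_psi {x : ℝ} (hx : x ≠ 0) : x * s.psi x = 2 * (1 -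
    (Chebyshev.T ℝ s.p).eval (dlt s.p s.ν - s.τ * x) /
      (Chebyshev.T ℝ s.p).eval (dlt s.p s.ν)) / s.dt ^ 2 := by
  have h1 := s.T_pos.ne'
  have h3 := s.dt_pos.ne'
  simp only [psi, sig, hx, if_false]
  field_simp

theorem psi_mul (x : ℝ) (hx : x ≠ 0) : s.psi x * (s.τ * x *
    (derivative (Chebyshev.T ℝ s.p)).eval (dlt s.p s.ν)) =
    (Chebyshev.T ℝ s.p).eval (dlt s.p s.ν) -
      (Chebyshev.T ℝ s.p).eval (dlt s.p s.ν - s.τ * x) := by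
  have h1 := s.T_pos.ne'
  have h2 := s.dT_pos.ne'
  have h3 := s.dt_pos.ne'
  simp only [psi, sig, hx, if_false, τ, omg]
  field_simp

theorem ups_zero (j : ℕ) : s.ups j 0 = 1 := by
  have := (Cheb.one_le_eval_U j s.one_le_dlt)
  rw [ups, mul_zero, sub_zero, div_self (by linarith)]

section Range

variable {x : ℝ} (hx : 0 < x) (hx' : x ≤ (s.p : ℝ) ^ 2 * s.gain / (4 * s.dt ^ 2))

include hx in
theorem τ_mul_pos : 0 < s.τ * x := mul_pos s.τ_pos hx

include hx' in
theorem τ_mul_le : s.τ * x ≤ 2 := by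
  have h0 := pow_pos s.dt_pos 2
  have h1 := s.le_omg
  have h2 := s.omg_pos
  have h3 := s.ν_pos
  have h4 := s.ν_le
  have h5 := pow_pos s.p_pos 2
  rw [τ, div_mul_eq_mul_div, div_le_iff₀ h2]
  rw [le_div_iff₀ (by positivity)] at hx'
  have h6 := s.gain_le
  nlinarith

include hx hx' in
/-- The bound behind the optimal order: a symbol of size at most `min {1, p² τ x}`, up to a factor,
is at most `Δt²` times the symbol `x ψ` of the stiffness operator, uniformly in `p`. -/
theorem abs_le_mul_psi {q : ℝ} (h2 : |q| ≤ 2) (h3 : |q| ≤ 2 * (s.τ * x * (s.p : ℝ) ^ 2)) :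
    |q| ≤ s.dt ^ 2 / s.gain * (x * s.psi x) := by
  have h := Cheb.mul_abs_le_symbol s.one_le_p s.ν_pos.le s.ν_le (rfl : dlt s.p s.ν = _)
    (s.τ_mul_pos hx).le (s.τ_mul_le hx') h2 h3
  have h0 := pow_pos s.dt_pos 2
  rw [s.mul_psi hx.ne', div_mul_div_comm, le_div_iff₀ (mul_pos s.gain_pos h0), mul_comm |q|]
  have h4 : s.gain * |q| ≤ _ := h
  nlinarith

include hx hx' in
theorem mul_psi_le : x * s.psi x ≤ (4 - 2 * s.gain) / s.dt ^ 2 := by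
  have h := Cheb.symbol_le s.one_le_p s.ν_pos.le (rfl : dlt s.p s.ν = _) (s.τ_mul_le hx')
  rw [s.mul_psi hx.ne']
  exact div_le_div_of_nonneg_right h (pow_pos s.dt_pos 2).le

include hx hx' in
theorem psi_nonneg : 0 ≤ s.psi x := by
  have h := s.abs_le_mul_psi hx hx' (q := 0) (by simp)
    (by have := (s.τ_mul_pos hx).le; simp only [abs_zero]; positivity)
  rw [abs_zero] at h
  have h2 := div_pos (pow_pos s.dt_pos 2) s.gain_pos
  exact nonneg_of_mul_nonneg_right (nonneg_of_mul_nonneg_right h h2) hx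

include hx hx' in
theorem psi_le_one : s.psi x ≤ 1 := by
  have h := Cheb.abs_eval_sub_eval_le (Cheb.T_mem_cone s.p) s.one_le_dlt (s.τ_mul_pos hx).le
    (s.τ_mul_le hx')
  have h2 := s.psi_mul x hx.ne'
  have h3 := mul_pos (s.τ_mul_pos hx) s.dT_pos
  have h4 := (le_abs_self _).trans h
  rw [← h2] at h4
  by_contra! hn
  nlinarith

include hx hx' in
theorem abs_one_sub_psi_le : |1 - s.psi x| ≤ s.τ * x * (s.p : ℝ) ^ 2 := by
  have h := Cheb.abs_taylor_le (Cheb.T_mem_cone s.p) s.one_le_dlt (s.τ_mul_pos hx)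
    (s.τ_mul_le hx')
  have h3 := mul_pos (s.τ_mul_pos hx) s.dT_pos
  rw [← s.psi_mul x hx.ne'] at h
  have e : s.τ * x * (derivative (Chebyshev.T ℝ s.p)).eval (dlt s.p s.ν) - s.psi x *
      (s.τ * x * (derivative (Chebyshev.T ℝ s.p)).eval (dlt s.p s.ν)) =
      (1 - s.psi x) * (s.τ * x * (derivative (Chebyshev.T ℝ s.p)).eval (dlt s.p s.ν)) := by ring
  rw [e, abs_mul, abs_of_pos h3] at h
  refine le_of_mul_le_mul_right (h.trans (le_of_eq ?_)) h3
  ring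

include hx hx' in
theorem abs_one_sub_psi_le_one : |1 - s.psi x| ≤ 1 :=
  abs_le.mpr ⟨by linarith [s.psi_le_one hx hx'], by linarith [s.psi_nonneg hx hx']⟩

include hx hx' in
theorem psi_pos : 0 < s.psi x := by
  refine lt_of_le_of_ne (s.psi_nonneg hx hx') fun h0 => ?_
  have h1 := s.abs_one_sub_psi_le_one hx hx'
  have h2 := s.abs_le_mul_psi hx hx' (q := 1 - s.psi x) (by linarith)
    (by have := s.abs_one_sub_psi_le hx hx'; linarith [abs_nonneg (1 - s.psi x)])
  rw [← h0] at h2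
  norm_num at h2

include hx hx' in
theorem abs_ups_le (j : ℕ) : |s.ups j x| ≤ 1 := by
  have h0 : 0 < (Chebyshev.U ℝ j).eval (dlt s.p s.ν) := by
    linarith [Cheb.one_le_eval_U j s.one_le_dlt]
  rw [ups, abs_div, abs_of_pos h0, div_le_one h0]
  have h1 := s.τ_mul_pos hx
  have h2 := s.τ_mul_le hx'
  have h3 := s.one_le_dlt
  exact Cheb.abs_eval_le_of_mem_cone (Chebyshev.U_mem_span_T ℝ j) h3
    (abs_le.mpr ⟨by linarith, by linarith⟩)

include hx hx' in
theorem abs_ups_sub_one_le {j : ℕ} (hj : j ≤ s.p) : |s.ups j x - 1| ≤ s.τ * x * (s.p : ℝ) ^ 2 := by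
  have h0 : 0 < (Chebyshev.U ℝ j).eval (dlt s.p s.ν) := by
    linarith [Cheb.one_le_eval_U j s.one_le_dlt]
  have h1 := s.τ_mul_pos hx
  have h := Cheb.abs_eval_sub_eval_le (Chebyshev.U_mem_span_T ℝ j) s.one_le_dlt h1.le
    (s.τ_mul_le hx')
  have h2 := Cheb.eval_derivative_le_of_mem_cone (Chebyshev.U_mem_span_T ℝ j) s.one_le_dlt
  have h3 : (j : ℝ) ^ 2 ≤ (s.p : ℝ) ^ 2 :=
    pow_le_pow_left₀ (Nat.cast_nonneg j) (by exact_mod_cast hj) 2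
  have e : s.ups j x - 1 = -((Chebyshev.U ℝ j).eval (dlt s.p s.ν) -
      (Chebyshev.U ℝ j).eval (dlt s.p s.ν - s.τ * x)) / (Chebyshev.U ℝ j).eval (dlt s.p s.ν) := by
    rw [ups]
    field_simp
    ring
  rw [e, abs_div, abs_of_pos h0, abs_neg, div_le_iff₀ h0]
  refine h.trans ?_
  rw [mul_assoc (s.τ * x)]
  refine mul_le_mul_of_nonneg_left (h2.trans ?_) h1.le
  exact mul_le_mul_of_nonneg_right h3 h0.le

end Range

end Stepping

/-! ### Error analysis in the discrete space -/

/-- The constant of the error estimate, in terms of the stabilization gain `g`, the coercivity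
constant `cA` of the stiffness operator and a bound `b` for the time step. -/
def errConst (g cA b : ℝ) : ℝ :=
  (1 + 1 / √(7 / 16 * g)) * (8 / g) * (1 + √(2 * (1 / cA + b ^ 2 / g)) + b / (2 * √(7 / 16 * g)))

namespace Stepping

variable {S : Type*} [NormedAddCommGroup S] [InnerProductSpace ℝ S] [FiniteDimensional ℝ S]
  (s : Stepping) (L : LocalOp S)

/-- The bounds of the stiffness operator: coercivity, and the inverse inequalities on the whole
space and on the coarse part combined with the CFL condition. -/
structure CFL (cA : ℝ) : Prop where
  cA_pos : 0 < cA
  coer : ∀ v, cA * ‖v‖ ^ 2 ≤ inner ℝ (L.A v) v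
  all : ∀ v, inner ℝ (L.A v) v ≤ (s.p : ℝ) ^ 2 * s.gain / (4 * s.dt ^ 2) * ‖v‖ ^ 2
  coarse : ∀ v, inner ℝ (L.A (v - L.P v)) (v - L.P v) ≤
    s.gain / (4 * s.dt ^ 2) * ‖v - L.P v‖ ^ 2

variable {s L} {cA : ℝ} (h : s.CFL L cA)

namespace CFL

include h

theorem mem_range {v : S} {x : ℝ} (hx : x ∈ specAt L.H_symm (L.P v)) :
    0 < x ∧ x ≤ (s.p : ℝ) ^ 2 * s.gain / (4 * s.dt ^ 2) :=
  ⟨L.pos_of_mem_specAt hx, L.le_of_mem_specAt h.all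
    (by have := s.gain_pos; have := s.dt_pos; positivity) hx⟩

/-- The preimage under `A_ψ` of a defect of order zero is of order `Δt²`. -/
theorem norm_F_le {φ : ℝ → ℝ} (g : S)
    (hφ : ∀ x, 0 < x → x ≤ (s.p : ℝ) ^ 2 * s.gain / (4 * s.dt ^ 2) →
      |φ x| ≤ 2 ∧ |φ x| ≤ 2 * (s.τ * x * (s.p : ℝ) ^ 2)) :
    ‖L.F s.psi φ g‖ ≤ s.dt ^ 2 / s.gain * ‖g‖ := by
  refine L.norm_F_le (div_pos (pow_pos s.dt_pos 2) s.gain_pos).le g fun x hx => ?_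
  obtain ⟨h1, h2⟩ := h.mem_range hx
  exact ⟨mul_pos h1 (s.psi_pos h1 h2), s.abs_le_mul_psi h1 h2 (hφ x h1 h2).1 (hφ x h1 h2).2⟩

theorem ApL_F {φ : ℝ → ℝ} (hφ : φ 0 = 0) (g : S) :
    L.ApL s.psi (L.F s.psi φ g) = L.R φ g :=
  L.ApL_F s.psi_zero hφ g fun _ hx =>
    (s.psi_pos (h.mem_range hx).1 (h.mem_range hx).2).ne'

theorem norm_F_one_sub_psi_le (g : S) :
    ‖L.F s.psi (fun x => 1 - s.psi x) g‖ ≤ s.dt ^ 2 / s.gain * ‖g‖ :=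
  h.norm_F_le g fun x h1 h2 => by
    have h3 := s.abs_one_sub_psi_le h1 h2
    exact ⟨by linarith [s.abs_one_sub_psi_le_one h1 h2],
      by linarith [abs_nonneg (1 - s.psi x)]⟩

theorem norm_F_ups_sub_psi_le {j : ℕ} (hj : j ≤ s.p) (g : S) :
    ‖L.F s.psi (fun x => s.ups j x - s.psi x) g‖ ≤ s.dt ^ 2 / s.gain * ‖g‖ :=
  h.norm_F_le g fun x h1 h2 => by
    have h3 := s.abs_one_sub_psi_le h1 h2
    have h4 := s.abs_ups_sub_one_le h1 h2 hj
    have h5 := abs_le.mp (s.abs_ups_le h1 h2 j)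
    have h6 := s.psi_nonneg h1 h2
    have h7 := s.psi_le_one h1 h2
    have h8 := abs_add_le (s.ups j x - 1) (1 - s.psi x)
    have e : s.ups j x - 1 + (1 - s.psi x) = s.ups j x - s.psi x := by ring
    rw [e] at h8
    exact ⟨abs_le.mpr ⟨by linarith, by linarith⟩, by linarith⟩

theorem norm_F_ups_sub_one_le {j : ℕ} (hj : j ≤ s.p) (g : S) :
    ‖L.F s.psi (fun x => s.ups j x - 1) g‖ ≤ s.dt ^ 2 / s.gain * ‖g‖ :=
  h.norm_F_le g fun x h1 h2 => by
    have h4 := s.abs_ups_sub_one_le h1 h2 hj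
    have h5 := abs_le.mp (s.abs_ups_le h1 h2 j)
    exact ⟨abs_le.mpr ⟨by linarith, by linarith⟩, by linarith [abs_nonneg (s.ups j x - 1)]⟩

theorem lower (v : S) : s.dt ^ 2 / (2 * (1 / cA + s.dt ^ 2 / s.gain)) * ‖v‖ ^ 2 ≤
    inner ℝ ((s.dt ^ 2 • L.ApL s.psi) v) v := by
  have h0 := s.dt_pos
  have h1 := s.gain_pos
  have h2 := h.cA_pos
  have h3 := L.norm_sq_le_inner_ApL s.psi_zero (K := s.dt ^ 2 / s.gain) (by positivity)
    (fun _ x hx => s.psi_le_one (h.mem_range hx).1 (h.mem_range hx).2)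
    (fun _ x hx => by
      obtain ⟨k1, k2⟩ := h.mem_range hx
      have k3 := s.abs_one_sub_psi_le k1 k2
      exact (le_abs_self _).trans (s.abs_le_mul_psi k1 k2
        (by linarith [s.abs_one_sub_psi_le_one k1 k2]) (by linarith [abs_nonneg (1 - s.psi x)])))
    h2 h.coer v
  rw [LinearMap.smul_apply, inner_smul_left, conj_trivial, div_mul_eq_mul_div,
    div_le_iff₀ (by positivity)]
  nlinarith [pow_pos h0 2]

theorem upper (v : S) : inner ℝ ((s.dt ^ 2 • L.ApL s.psi) v) v ≤
    4 * (1 - 7 / 16 * s.gain) * ‖v‖ ^ 2 := by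
  have h0 := s.dt_pos
  have h1 := s.gain_pos
  have h1' := s.gain_le
  have h2 := h.cA_pos
  have h3 := L.inner_ApL_le_norm_sq s.psi_zero (K := s.dt ^ 2 / s.gain) (by positivity)
    (fun _ x hx => s.psi_le_one (h.mem_range hx).1 (h.mem_range hx).2)
    (fun _ x hx => by
      obtain ⟨k1, k2⟩ := h.mem_range hx
      have k3 := s.abs_one_sub_psi_le k1 k2
      exact (le_abs_self _).trans (s.abs_le_mul_psi k1 k2
        (by linarith [s.abs_one_sub_psi_le_one k1 k2]) (by linarith [abs_nonneg (1 - s.psi x)])))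
    h2 h.coer (B := (4 - 2 * s.gain) / s.dt ^ 2) (α := s.gain / (4 * s.dt ^ 2))
    (div_pos (by linarith) (pow_pos h0 2)) (by positivity)
    (fun _ x hx => s.mul_psi_le (h.mem_range hx).1 (h.mem_range hx).2) h.coarse v
  rw [LinearMap.smul_apply, inner_smul_left, conj_trivial]
  have h4 := mul_le_mul_of_nonneg_left h3 (pow_pos h0 2).le
  refine h4.trans (le_of_eq ?_)
  field_simp
  ring

omit h in
theorem smul_ApL_symm : (s.dt ^ 2 • L.ApL s.psi).IsSymmetric := fun u v => by
  rw [LinearMap.smul_apply, LinearMap.smul_apply, inner_smul_left, inner_smul_right, L.ApL_symm]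
  rfl

/-- The error estimate for a two-step scheme with stiffness operator `ψ(A P) A`, whose right-hand
side is `ψ(A P) f` up to a term `A_ψ ξ + η`. Subtracting `A_ψ⁻¹` of the defect of order zero from
the error leaves a defect of order `Δt⁴`. -/
theorem norm_error_le {N : ℕ} {b M : ℝ} (hb : s.dt ≤ b) (hM : 0 ≤ M) {U W f Y ξ η : ℕ → S} {V₀ : S}
    (hW : ∀ n, W n = f n - L.A (U n))
    (hY0 : Y 0 = U 0) (hY1 : Y 1 = U 0 + s.dt • V₀ + (s.dt ^ 2 / 2) • W 0)
    (hY : ∀ n, n + 1 < N → Y (n + 2) = -Y n + (2 : ℝ) • Y (n + 1) +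
      s.dt ^ 2 • (L.R s.psi (f (n + 1) - L.A (Y (n + 1))) +
        (L.ApL s.psi (ξ (n + 1)) + η (n + 1))))
    (hU : ∀ n, n + 1 < N →
      ‖U (n + 2) - (2 : ℝ) • U (n + 1) + U n - s.dt ^ 2 • W (n + 1)‖ ≤ s.dt ^ 4 * M)
    (hU1 : 0 < N → ‖U 1 - U 0 - s.dt • V₀ - (s.dt ^ 2 / 2) • W 0‖ ≤ s.dt ^ 3 * M)
    (hW0 : ∀ n ≤ N, ‖W n‖ ≤ M) (hW1 : 0 < N → ‖W 1 - W 0‖ ≤ s.dt * M)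
    (hW2 : ∀ n, n + 1 < N → ‖W (n + 2) - (2 : ℝ) • W (n + 1) + W n‖ ≤ s.dt ^ 2 * M)
    (hξ0 : ∀ n ≤ N, ‖ξ n‖ ≤ 5 / s.gain * (s.dt ^ 2 * M))
    (hξ1 : 0 < N → ‖ξ 1 - ξ 0‖ ≤ 5 / s.gain * (s.dt ^ 3 * M))
    (hξ2 : ∀ n, n + 1 < N → ‖ξ (n + 2) - (2 : ℝ) • ξ (n + 1) + ξ n‖ ≤
      5 / s.gain * (s.dt ^ 4 * M))
    (hη : ∀ n, n + 1 < N → ‖η (n + 1)‖ ≤ s.dt ^ 2 * M) (n : ℕ) (hn : n < N) :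
    ‖U (n + 1) - Y (n + 1)‖ ≤ errConst s.gain cA b * s.dt ^ 2 * (1 + N * s.dt) * M := by
  have p0 := s.dt_pos
  have p1 := s.gain_pos
  have p2 := h.cA_pos
  have p3 : 1 ≤ 1 / s.gain := by rw [le_div_iff₀ p1]; linarith [s.gain_le]
  set g := s.gain with hg
  set φ : ℝ → ℝ := fun x => 1 - s.psi x with hφ
  have hφ0 : φ 0 = 0 := by simp [hφ, s.psi_zero]
  obtain ⟨ρ, hρ⟩ : ∃ ρ : ℕ → S, ∀ n, ρ n = L.F s.psi φ (W n) - ξ n := ⟨_, fun _ => rfl⟩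
  obtain ⟨ε, hε⟩ : ∃ ε : ℕ → S, ∀ n, ε n = U n - Y n - ρ n := ⟨_, fun _ => rfl⟩
  have eρ0 : ∀ n ≤ N, ‖ρ n‖ ≤ 6 / g * (s.dt ^ 2 * M) := by
    intro n hn
    have h1 := h.norm_F_one_sub_psi_le (W n)
    have h2 : s.dt ^ 2 / g * ‖W n‖ ≤ s.dt ^ 2 / g * M :=
      mul_le_mul_of_nonneg_left (hW0 n hn) (by positivity)
    rw [hρ]
    refine (norm_sub_le _ _).trans ((add_le_add (h1.trans h2) (hξ0 n hn)).trans (le_of_eq ?_))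
    ring
  have eρ1 : 0 < N → ‖ρ 1 - ρ 0‖ ≤ 6 / g * (s.dt ^ 3 * M) := by
    intro hN
    have h1 := h.norm_F_one_sub_psi_le (W 1 - W 0)
    have h2 : s.dt ^ 2 / g * ‖W 1 - W 0‖ ≤ s.dt ^ 2 / g * (s.dt * M) :=
      mul_le_mul_of_nonneg_left (hW1 hN) (by positivity)
    have e : ρ 1 - ρ 0 = L.F s.psi φ (W 1 - W 0) - (ξ 1 - ξ 0) := by
      rw [hρ, hρ, L.F_sub]; abel
    rw [e]
    refine (norm_sub_le _ _).trans ((add_le_add (h1.trans h2) (hξ1 hN)).trans (le_of_eq ?_))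
    ring
  have eρ2 : ∀ n, n + 1 < N → ‖ρ (n + 2) - (2 : ℝ) • ρ (n + 1) + ρ n‖ ≤
      6 / g * (s.dt ^ 4 * M) := by
    intro n hn
    have h1 := h.norm_F_one_sub_psi_le (W (n + 2) - (2 : ℝ) • W (n + 1) + W n)
    have h2 : s.dt ^ 2 / g * ‖W (n + 2) - (2 : ℝ) • W (n + 1) + W n‖ ≤
        s.dt ^ 2 / g * (s.dt ^ 2 * M) :=
      mul_le_mul_of_nonneg_left (hW2 n hn) (by positivity)
    have e : ρ (n + 2) - (2 : ℝ) • ρ (n + 1) + ρ n =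
        L.F s.psi φ (W (n + 2) - (2 : ℝ) • W (n + 1) + W n) -
          (ξ (n + 2) - (2 : ℝ) • ξ (n + 1) + ξ n) := by
      rw [hρ, hρ, hρ, L.F_add, L.F_sub, L.F_smul]; module
    rw [e]
    refine (norm_sub_le _ _).trans ((add_le_add (h1.trans h2) (hξ2 n hn)).trans (le_of_eq ?_))
    ring
  -- The recursion of the modified error `ε = U - Y - ρ`: the defect `(1 - ψ(A P)) W` of order zero
  -- has been absorbed by `A_ψ ρ`, only second differences of `ρ` are left.
  obtain ⟨r, hr⟩ : ∃ r : ℕ → S, ∀ n, r (n + 1) =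
      (U (n + 2) - (2 : ℝ) • U (n + 1) + U n - s.dt ^ 2 • W (n + 1)) - s.dt ^ 2 • η (n + 1) -
        (ρ (n + 2) - (2 : ℝ) • ρ (n + 1) + ρ n) :=
    ⟨fun n => (U (n + 1) - (2 : ℝ) • U n + U (n - 1) - s.dt ^ 2 • W n) - s.dt ^ 2 • η n -
        (ρ (n + 1) - (2 : ℝ) • ρ n + ρ (n - 1)), fun n => rfl⟩
  have hrec : ∀ n, n + 1 < N → ε (n + 2) - (2 : ℝ) • ε (n + 1) + ε n =
      -(s.dt ^ 2 • L.ApL s.psi) (ε (n + 1)) + r (n + 1) := by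
    intro n hn
    have h1 : f (n + 1) - L.A (Y (n + 1)) = W (n + 1) + L.A (U (n + 1) - Y (n + 1)) := by
      rw [hW, map_sub]; abel
    have h2 : L.R s.psi (W (n + 1)) = W (n + 1) - L.ApL s.psi (L.F s.psi φ (W (n + 1))) := by
      have h3 : L.R (fun x => φ x + s.psi x) (W (n + 1)) = W (n + 1) := by
        rw [L.R_congr (q' := fun _ => 1) (fun x => by simp [hφ]), L.R_const, one_smul]
      rw [h.ApL_F hφ0, eq_sub_iff_add_eq', ← L.R_add, h3]
    have h4 : L.ApL s.psi (ε (n + 1)) = L.ApL s.psi (U (n + 1) - Y (n + 1)) -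
        L.ApL s.psi (L.F s.psi φ (W (n + 1))) + L.ApL s.psi (ξ (n + 1)) := by
      rw [hε, hρ, map_sub, map_sub _ (L.F s.psi φ _)]; abel
    rw [LinearMap.smul_apply, h4, hr, hε (n + 2), hε (n + 1), hε n, hY n hn, h1, L.R_vec_add, h2,
      ← L.ApL_apply]
    module
  have hrb : ∀ n, n + 1 < N → ‖r (n + 1)‖ ≤ 8 / g * (s.dt ^ 4 * M) := by
    intro n hn
    have h1 : ‖s.dt ^ 2 • η (n + 1)‖ ≤ s.dt ^ 4 * M := by
      rw [norm_smul, Real.norm_of_nonneg (by positivity)]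
      have := mul_le_mul_of_nonneg_left (hη n hn) (by positivity : 0 ≤ s.dt ^ 2)
      refine this.trans (le_of_eq ?_)
      ring
    rw [hr]
    refine (norm_sub_le _ _).trans
      ((add_le_add ((norm_sub_le _ _).trans (add_le_add (hU n hn) h1)) (eρ2 n hn)).trans ?_)
    have h2 : 0 ≤ s.dt ^ 4 * M := by positivity
    have h3 : 8 / g * (s.dt ^ 4 * M) = 6 / g * (s.dt ^ 4 * M) +
        2 * (1 / g * (s.dt ^ 4 * M)) := by ring
    rw [h3]
    nlinarith
  have hd : ‖ε 1 - ε 0‖ ≤ 8 / g * (s.dt ^ 3 * M) := by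
    have hN : 0 < N := by omega
    have e : ε 1 - ε 0 = (U 1 - U 0 - s.dt • V₀ - (s.dt ^ 2 / 2) • W 0) - (ρ 1 - ρ 0) := by
      rw [hε, hε, hY0, hY1]; abel
    rw [e]
    refine (norm_sub_le _ _).trans ((add_le_add (hU1 hN) (eρ1 hN)).trans ?_)
    have h2 : 0 ≤ s.dt ^ 3 * M := by positivity
    have h3 : 8 / g * (s.dt ^ 3 * M) = 6 / g * (s.dt ^ 3 * M) +
        2 * (1 / g * (s.dt ^ 3 * M)) := by ring
    rw [h3]
    nlinarith
  have hε0 : ‖ε 0‖ ≤ 6 / g * (s.dt ^ 2 * M) := by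
    rw [hε, hY0, sub_self, zero_sub, norm_neg]
    exact eρ0 0 (Nat.zero_le _)
  set c := 7 / 16 * g with hc
  have hc0 : 0 < c := by positivity
  set k := s.dt ^ 2 / (2 * (1 / cA + s.dt ^ 2 / g)) with hk
  have hk0 : 0 < k := by positivity
  have key := norm_leapfrog_le hc0 hk0 h.lower h.upper smul_ApL_symm
    (R := 8 / g * (s.dt ^ 4 * M)) (by positivity) hrec hrb n hn
  set C₁ := √(2 * (1 / cA + b ^ 2 / g)) with hC₁
  have k1 : 1 / √k ≤ C₁ / s.dt := by
    rw [div_le_div_iff₀ (Real.sqrt_pos.mpr hk0) p0, one_mul, ← Real.sqrt_mul (by positivity)]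
    refine Real.le_sqrt_of_sq_le ?_
    have h1 : s.dt ^ 2 ≤ b ^ 2 := pow_le_pow_left₀ p0.le hb 2
    have h2 : s.dt ^ 2 / g ≤ b ^ 2 / g := div_le_div_of_nonneg_right h1 p1.le
    rw [hk, mul_div_assoc', le_div_iff₀ (by positivity), mul_comm]
    exact mul_le_mul_of_nonneg_right (by linarith) (by positivity)
  have k2 : 1 / (2 * √c) ≤ b / (2 * √c) / s.dt := by
    rw [le_div_iff₀ p0, div_mul_eq_mul_div, one_mul]
    exact div_le_div_of_nonneg_right hb (by positivity)
  have k3 : 1 / √k + 1 / (2 * √c) ≤ (C₁ + b / (2 * √c)) / s.dt := by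
    rw [add_div]
    exact add_le_add k1 k2
  have k4 : (n : ℝ) ≤ N := by exact_mod_cast hn.le
  have k5 : ‖ε 1 - ε 0‖ + n * (8 / g * (s.dt ^ 4 * M) / √c) ≤
      8 / g * (s.dt ^ 3 * M) * (1 + N * s.dt * (1 / √c)) := by
    have h1 : n * (8 / g * (s.dt ^ 4 * M) / √c) ≤ N * (8 / g * (s.dt ^ 4 * M) / √c) :=
      mul_le_mul_of_nonneg_right k4 (by positivity)
    refine (add_le_add hd h1).trans (le_of_eq ?_)
    ring
  have b0 : 0 ≤ b := p0.le.trans hb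
  have k6 : ‖ε (n + 1)‖ ≤ 6 / g * (s.dt ^ 2 * M) * (1 / √c) +
      8 / g * (s.dt ^ 2 * M) * (1 + N * s.dt * (1 / √c)) * (C₁ + b / (2 * √c)) := by
    refine key.trans (add_le_add ?_ ?_)
    · rw [div_eq_mul_one_div]
      exact mul_le_mul_of_nonneg_right hε0 (by positivity)
    · refine (mul_le_mul k5 k3 (by positivity) (by positivity)).trans (le_of_eq ?_)
      field_simp
  have k7 : ‖U (n + 1) - Y (n + 1)‖ ≤ ‖ε (n + 1)‖ + 6 / g * (s.dt ^ 2 * M) := by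
    have : U (n + 1) - Y (n + 1) = ε (n + 1) + ρ (n + 1) := by rw [hε]; abel
    rw [this]
    exact (norm_add_le _ _).trans (add_le_add le_rfl (eρ0 (n + 1) hn))
  have k8 : errConst g cA b = (1 + 1 / √c) * (8 / g) * (1 + C₁ + b / (2 * √c)) := rfl
  rw [k8]
  set q := 1 / √c with hq
  have hq0 : 0 ≤ q := by positivity
  set D := C₁ + b / (2 * √c) with hD
  have hD0 : 0 ≤ D := by positivity
  have hZ : 0 ≤ 1 / g * (s.dt ^ 2 * M) := by positivity
  set Z := 1 / g * (s.dt ^ 2 * M) with hZdef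
  have hT : 0 ≤ N * s.dt := by positivity
  set T := N * s.dt
  have e1 : (1 + q) * (8 / g) * (1 + C₁ + b / (2 * √c)) * s.dt ^ 2 * (1 + T) * M =
      8 * Z * ((1 + q) * (1 + D) * (1 + T)) := by rw [hZdef, hD]; ring
  have e2 : 6 / g * (s.dt ^ 2 * M) = 6 * Z := by rw [hZdef]; ring
  have e3 : 8 / g * (s.dt ^ 2 * M) = 8 * Z := by rw [hZdef]; ring
  rw [e1]
  rw [e2, e3] at k6
  rw [e2] at k7
  have e4 : 6 * Z * q + 8 * Z * (1 + T * q) * D + 6 * Z ≤ 8 * Z * ((1 + q) * (1 + D) * (1 + T)) := by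
    have : 8 * Z * ((1 + q) * (1 + D) * (1 + T)) -
        (6 * Z * q + 8 * Z * (1 + T * q) * D + 6 * Z) =
        Z * (2 + 2 * q + 8 * q * D + 8 * T * (1 + q + D)) := by ring
    have h2 : 0 ≤ Z * (2 + 2 * q + 8 * q * D + 8 * T * (1 + q + D)) := by positivity
    linarith
  linarith

end CFL

end Stepping

/-! ### One global step in closed form -/

namespace Stepping

open Polynomial

variable {S : Type*} [NormedAddCommGroup S] [InnerProductSpace ℝ S] [FiniteDimensional ℝ S]
  (s : Stepping) (L : LocalOp S)

/-- The trapezoidal factor of the local source terms: `1/2` at the first local step. -/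
def trap (j : ℕ) : ℝ := if j = 0 then 1 / 2 else 1

/-- The weight of the local source term of step `j`; the weights add up to `1`. -/
def wt (j : ℕ) : ℝ := 2 * trap j * ((s.p : ℝ) - j) / (s.p : ℝ) ^ 2

theorem wt_nonneg {j : ℕ} (hj : j < s.p) : 0 ≤ s.wt j := by
  have h1 : (j : ℝ) ≤ s.p := by exact_mod_cast hj.le
  have h2 : 0 ≤ trap j := by rw [trap]; split_ifs <;> norm_num
  have h3 : 0 ≤ (s.p : ℝ) - j := by linarith
  rw [wt]
  positivity

theorem sum_wt : ∑ j ∈ Finset.range s.p, s.wt j = 1 := by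
  have h1 : ∀ p : ℕ, ∀ n : ℕ, ∑ j ∈ Finset.range (n + 1), 2 * trap j * ((p : ℝ) - j) =
      p + n * (2 * p - n - 1) := by
    intro p n
    induction n with
    | zero => simp [trap]
    | succ n ih =>
      rw [Finset.sum_range_succ, ih, trap, if_neg (by omega)]
      push_cast
      ring
  obtain ⟨n, hn⟩ : ∃ n, s.p = n + 1 := ⟨s.p - 1, by have := s.one_le_p; omega⟩
  have h2 : ∑ j ∈ Finset.range s.p, s.wt j =
      (∑ j ∈ Finset.range (n + 1), 2 * trap j * ((s.p : ℝ) - j)) / (s.p : ℝ) ^ 2 := by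
    rw [Finset.sum_div, ← hn]
    rfl
  have h3 := s.p_pos
  have h4 : (s.p : ℝ) = n + 1 := by rw [hn]; push_cast; ring
  rw [h2, h1, div_eq_one_iff_eq (by positivity), h4]
  ring

theorem eval_T_pos (k : ℤ) : 0 < (Chebyshev.T ℝ k).eval (dlt s.p s.ν) :=
  zero_lt_one.trans_le (Chebyshev.one_le_eval_T_real _ s.one_le_dlt)

/-- The recursion of the local steps, with coefficients `γ` and samples `F` of the local source. -/
structure IsLocal (γ : ℕ → ℝ) (F : ℤ → S) (w u : S) (z : ℕ → S) : Prop where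
  zero : z 0 = u
  one : z 1 = u + ((1 / 2) * (s.dt / s.p) ^ 2) •
    ((2 * (s.p : ℝ) ^ 2 / omg s.p s.ν * bet s.p s.ν 0 0) • (w - L.A (L.P u)) + γ 0 • L.P (F 0))
  add_two : ∀ k : ℕ, z (k + 2) =
    (1 + bet s.p s.ν (k + 1) (-1)) • z (k + 1) - bet s.p s.ν (k + 1) (-1) • z k +
      ((s.dt / s.p) ^ 2) •
        ((2 * (s.p : ℝ) ^ 2 / omg s.p s.ν * bet s.p s.ν (k + 1) 0) • (w - L.A (L.P (z (k + 1)))) +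
          (γ (k + 1) * (1 / 2)) • L.P (F (k + 1) + F (-(k + 1))))

variable {s L}

/-- The result of the local steps. The weighted steps `T_k(δ) z_k` satisfy the three-term recursion
of the Chebyshev polynomials. -/
theorem IsLocal.closed_form {γ : ℕ → ℝ} {F : ℤ → S} {w u : S} {z : ℕ → S}
    (hz : s.IsLocal L γ F w u z) :
    z s.p = u + (s.dt ^ 2 / 2) • L.R s.psi (w - L.A (L.P u)) +
      (s.dt ^ 2 / 2) • ∑ j ∈ Finset.range s.p,
        (2 * trap j * (Chebyshev.T ℝ ((j + 1 : ℕ) : ℤ)).eval (dlt s.p s.ν) * γ j *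
          (Chebyshev.U ℝ ((s.p - 1 - j : ℕ) : ℤ)).eval (dlt s.p s.ν) /
            ((s.p : ℝ) ^ 2 * (Chebyshev.T ℝ s.p).eval (dlt s.p s.ν))) •
          L.R (s.ups (s.p - 1 - j)) (L.P ((1 / 2 : ℝ) • (F j + F (-j)))) := by
  set δ := dlt s.p s.ν with hδ
  have hT : ∀ k : ℤ, (Chebyshev.T ℝ k).eval δ ≠ 0 := fun k => (s.eval_T_pos k).ne'
  have hω := s.omg_pos.ne'
  have hp := s.p_pos.ne'
  have hdt := s.dt_pos.ne'
  obtain ⟨Z, hZ⟩ : ∃ Z : ℕ → S, ∀ k, Z k = (Chebyshev.T ℝ k).eval δ • z k := ⟨_, fun _ => rfl⟩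
  obtain ⟨G, hG⟩ : ∃ G : ℕ → S, ∀ j, G j = (trap j * (Chebyshev.T ℝ ((j + 1 : ℕ) : ℤ)).eval δ *
      (s.dt / s.p) ^ 2 * γ j) • L.P ((1 / 2 : ℝ) • (F j + F (-j))) := ⟨_, fun _ => rfl⟩
  have h0 : Z 0 = u := by simp [hZ, hz.zero]
  have hG0 : G 0 = (δ * ((1 / 2) * (s.dt / s.p) ^ 2) * γ 0) • L.P (F 0) := by
    have : (1 / 2 : ℝ) • (F ((0 : ℕ) : ℤ) + F (-((0 : ℕ) : ℤ))) = F 0 := by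
      simp only [Nat.cast_zero, neg_zero]
      module
    rw [hG, this]
    simp only [trap, if_true, zero_add, Nat.cast_one, Chebyshev.T_one, eval_X]
    congr 1
    ring
  have h1 : Z 1 = δ • u + s.τ • (w - L.A (L.P u)) + G 0 := by
    have hδ0 : δ ≠ 0 := by simpa using hT 1
    have e : δ * ((1 / 2) * (s.dt / s.p) ^ 2) *
        (2 * (s.p : ℝ) ^ 2 / omg s.p s.ν * bet s.p s.ν 0 0) = s.τ := by
      have : bet s.p s.ν 0 0 = 1 / δ := by simp [bet, ← hδ]
      rw [this, τ]
      field_simp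
    rw [hZ, hz.one, hG0, ← e]
    simp only [Nat.cast_one, Chebyshev.T_one, eval_X]
    module
  have h2 : ∀ k, Z (k + 2) = (2 * δ) • Z (k + 1) - Z k +
      (2 * s.τ) • ((Chebyshev.T ℝ ((k + 1 : ℕ) : ℤ)).eval δ • w - L.A (L.P (Z (k + 1)))) +
        G (k + 1) := by
    intro k
    have i2 : ((k : ℤ) + 1 + 1) = ((k + 2 : ℕ) : ℤ) := by push_cast; ring
    have i0 : ((k : ℤ) + 1 + -1) = k := by ring
    have i1 : ((k : ℤ) + 1 + 0) = ((k + 1 : ℕ) : ℤ) := by push_cast; ring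
    have b1 : (Chebyshev.T ℝ ((k + 2 : ℕ) : ℤ)).eval δ * bet s.p s.ν (k + 1) (-1) =
        (Chebyshev.T ℝ k).eval δ := by
      rw [bet, ← hδ, i2, i0, mul_div_cancel₀ _ (hT _)]
    have b2 : (Chebyshev.T ℝ ((k + 2 : ℕ) : ℤ)).eval δ * ((s.dt / s.p) ^ 2 *
        (2 * (s.p : ℝ) ^ 2 / omg s.p s.ν * bet s.p s.ν (k + 1) 0)) =
        2 * s.τ * (Chebyshev.T ℝ ((k + 1 : ℕ) : ℤ)).eval δ := by
      have := hT ((k + 2 : ℕ) : ℤ)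
      rw [bet, ← hδ, i2, i1, τ]
      field_simp
    have b3 : (Chebyshev.T ℝ ((k + 2 : ℕ) : ℤ)).eval δ =
        2 * δ * (Chebyshev.T ℝ ((k + 1 : ℕ) : ℤ)).eval δ - (Chebyshev.T ℝ k).eval δ :=
      eval_T_add_two k δ
    have hG1 : G (k + 1) = ((Chebyshev.T ℝ ((k + 2 : ℕ) : ℤ)).eval δ * ((s.dt / s.p) ^ 2 *
        (γ (k + 1) * (1 / 2)))) • L.P (F (k + 1) + F (-(k + 1))) := by
      rw [hG, map_smul, smul_smul, trap, if_neg (by omega)]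
      push_cast
      congr 1
      ring_nf
    have e1 : Z (k + 2) = ((Chebyshev.T ℝ ((k + 2 : ℕ) : ℤ)).eval δ +
        (Chebyshev.T ℝ ((k + 2 : ℕ) : ℤ)).eval δ * bet s.p s.ν (k + 1) (-1)) • z (k + 1) -
        ((Chebyshev.T ℝ ((k + 2 : ℕ) : ℤ)).eval δ * bet s.p s.ν (k + 1) (-1)) • z k +
        ((Chebyshev.T ℝ ((k + 2 : ℕ) : ℤ)).eval δ * ((s.dt / s.p) ^ 2 *
        (2 * (s.p : ℝ) ^ 2 / omg s.p s.ν * bet s.p s.ν (k + 1) 0))) •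
          (w - L.A (L.P (z (k + 1)))) + G (k + 1) := by
      rw [hZ, hz.add_two, hG1]
      module
    rw [e1, b1, b2, b3, hZ (k + 1), hZ k, map_smul, map_smul]
    module
  have key := localSteps_closed_form δ s.τ L h0 h1 h2 s.p
  have hpsi : L.R s.psi (w - L.A (L.P u)) =
      (2 / (s.dt ^ 2 * (Chebyshev.T ℝ s.p).eval δ)) • L.R (sig δ s.τ s.p) (w - L.A (L.P u)) := by
    rw [← L.R_smul]
    rfl
  have hups : ∀ j ∈ Finset.range s.p,
      L.R (fun x => (Chebyshev.U ℝ ((s.p : ℤ) - 1 - j)).eval (δ - s.τ * x)) (G j) =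
      ((Chebyshev.T ℝ s.p).eval δ * (s.dt ^ 2 / 2) *
        (2 * trap j * (Chebyshev.T ℝ ((j + 1 : ℕ) : ℤ)).eval δ * γ j *
          (Chebyshev.U ℝ ((s.p - 1 - j : ℕ) : ℤ)).eval δ /
            ((s.p : ℝ) ^ 2 * (Chebyshev.T ℝ s.p).eval δ))) •
          L.R (s.ups (s.p - 1 - j)) (L.P ((1 / 2 : ℝ) • (F j + F (-j)))) := by
    intro j hj
    have hj' : j < s.p := Finset.mem_range.mp hj
    have i : (s.p : ℤ) - 1 - j = ((s.p - 1 - j : ℕ) : ℤ) := by omega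
    have hU : (Chebyshev.U ℝ ((s.p - 1 - j : ℕ) : ℤ)).eval δ ≠ 0 := by
      have := Cheb.one_le_eval_U (s.p - 1 - j) s.one_le_dlt
      linarith
    have hT' := hT s.p
    rw [i, L.R_congr (q' := fun x => (Chebyshev.U ℝ ((s.p - 1 - j : ℕ) : ℤ)).eval δ *
      s.ups (s.p - 1 - j) x) (fun x => by rw [ups, mul_div_cancel₀ _ hU]), L.R_smul, hG,
      L.R_vec_smul, smul_smul]
    congr 1
    field_simp
  rw [Finset.sum_congr rfl hups] at key
  have hTp := hT s.p
  have e : z s.p = ((Chebyshev.T ℝ s.p).eval δ)⁻¹ • Z s.p := by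
    rw [hZ, smul_smul, inv_mul_cancel₀ hTp, one_smul]
  rw [e, key, hpsi, smul_add, smul_add, smul_smul, inv_mul_cancel₀ hTp, one_smul, smul_smul,
    Finset.smul_sum, Finset.smul_sum]
  congr 1
  · congr 2
    field_simp
  · refine Finset.sum_congr rfl fun j _ => ?_
    rw [smul_smul, smul_smul]
    congr 1
    field_simp

/-- The coefficients `γ^{(k)}` of the local source terms normalize their symbols at `0`. -/
theorem IsLocal.closed_form_gam {F : ℤ → S} {w u : S} {z : ℕ → S}
    (hz : s.IsLocal L (gam s.p s.ν) F w u z) :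
    z s.p = u + (s.dt ^ 2 / 2) • L.R s.psi (w - L.A (L.P u)) +
      (s.dt ^ 2 / 2) • ∑ j ∈ Finset.range s.p,
        s.wt j • L.R (s.ups (s.p - 1 - j)) (L.P ((1 / 2 : ℝ) • (F j + F (-j)))) := by
  rw [hz.closed_form]
  congr 2
  refine Finset.sum_congr rfl fun j hj => ?_
  congr 1
  have hj' : j < s.p := Finset.mem_range.mp hj
  have i : (s.p : ℤ) - 1 - j = ((s.p - 1 - j : ℕ) : ℤ) := by omega
  have i2 : (j : ℤ) + ((s.p : ℤ) - j) = s.p := by ring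
  have hU : (Chebyshev.U ℝ ((s.p - 1 - j : ℕ) : ℤ)).eval (dlt s.p s.ν) ≠ 0 := by
    have := Cheb.one_le_eval_U (s.p - 1 - j) s.one_le_dlt
    linarith
  have h1 := (s.eval_T_pos s.p).ne'
  have h2 := (s.eval_T_pos ((j + 1 : ℕ) : ℤ)).ne'
  have hp := s.p_pos.ne'
  have i3 : (j : ℤ) + 1 = ((j + 1 : ℕ) : ℤ) := by push_cast; ring
  rw [gam, bet, i, i2, i3, wt]
  field_simp

theorem IsLocal.closed_form_zero {F : ℤ → S} {w u : S} {z : ℕ → S}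
    (hz : s.IsLocal L (fun _ => 0) F w u z) :
    z s.p = u + (s.dt ^ 2 / 2) • L.R s.psi (w - L.A (L.P u)) := by
  rw [hz.closed_form]
  simp

/-! ### Error estimates of the two schemes in the discrete space -/

omit [FiniteDimensional ℝ S] in
theorem norm_sum_wt_le {B : ℝ} {v : ℕ → S} (hv : ∀ j < s.p, ‖v j‖ ≤ B) :
    ‖∑ j ∈ Finset.range s.p, s.wt j • v j‖ ≤ B := by
  refine (norm_sum_le _ _).trans ?_
  have : ∀ j ∈ Finset.range s.p, ‖s.wt j • v j‖ ≤ s.wt j * B := by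
    intro j hj
    have hj' := Finset.mem_range.mp hj
    rw [norm_smul, Real.norm_of_nonneg (s.wt_nonneg hj')]
    exact mul_le_mul_of_nonneg_left (hv j hj') (s.wt_nonneg hj')
  refine (Finset.sum_le_sum this).trans (le_of_eq ?_)
  rw [← Finset.sum_mul, s.sum_wt, one_mul]

/-- The bounds for the exact solution `U n = u(t_n)` with initial velocity `V₀`, acceleration
`W n = f n - A (U n)` and source `f n`, in terms of the size `M` of the data. -/
structure IsSmooth (s : Stepping) (L : LocalOp S) (N : ℕ) (M : ℝ) (U W f : ℕ → S) (V₀ : S) :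
    Prop where
  nonneg : 0 ≤ M
  eq : ∀ n, W n = f n - L.A (U n)
  second : ∀ n, n + 1 < N →
      ‖U (n + 2) - (2 : ℝ) • U (n + 1) + U n - s.dt ^ 2 • W (n + 1)‖ ≤ s.dt ^ 4 * M
  start : 0 < N → ‖U 1 - U 0 - s.dt • V₀ - (s.dt ^ 2 / 2) • W 0‖ ≤ s.dt ^ 3 * M
  acc_zero : ∀ n ≤ N, ‖W n‖ ≤ M
  acc_one : 0 < N → ‖W 1 - W 0‖ ≤ s.dt * M
  acc_two : ∀ n, n + 1 < N → ‖W (n + 2) - (2 : ℝ) • W (n + 1) + W n‖ ≤ s.dt ^ 2 * M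
  src_zero : ∀ n ≤ N, ‖f n‖ ≤ M
  src_one : 0 < N → ‖f 1 - f 0‖ ≤ s.dt * M
  src_two : ∀ n, n + 1 < N → ‖f (n + 2) - (2 : ℝ) • f (n + 1) + f n‖ ≤ s.dt ^ 2 * M

variable {cA : ℝ} (h : s.CFL L cA) {N : ℕ} {b M : ℝ} (hb : s.dt ≤ b) {U W f Y : ℕ → S} {V₀ : S}
  (hs : s.IsSmooth L N M U W f V₀)
  (hY0 : Y 0 = U 0) (hY1 : Y 1 = U 0 + s.dt • V₀ + (s.dt ^ 2 / 2) • (f 0 - L.A (U 0)))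

include h hb hs hY0 hY1

/-- Split-LFC: the scheme is the leapfrog method with right-hand side `ψ(A P) f`. -/
theorem CFL.norm_error_split_le {F : ℕ → ℤ → S}
    (hY : ∀ n, n + 1 < N → ∃ z : ℕ → S, s.IsLocal L (fun _ => 0) (F (n + 1))
      (f (n + 1) - L.A (Y (n + 1) - L.P (Y (n + 1)))) (Y (n + 1)) z ∧
      Y (n + 2) = -Y n + (2 : ℝ) • z s.p) (n : ℕ) (hn : n < N) :
    ‖U (n + 1) - Y (n + 1)‖ ≤ errConst s.gain cA b * s.dt ^ 2 * (1 + N * s.dt) * M := by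
  have hM := hs.nonneg
  have p0 := s.dt_pos
  have p1 := s.gain_pos
  refine h.norm_error_le hb hM (ξ := fun _ => 0) (η := fun _ => 0) hs.eq hY0 ?_ ?_
    hs.second hs.start hs.acc_zero hs.acc_one hs.acc_two ?_ ?_ ?_ ?_ n hn
  · rw [hs.eq]
    exact hY1
  · intro n hn
    obtain ⟨z, hz, e⟩ := hY n hn
    rw [e, hz.closed_form_zero, map_sub, map_zero, sub_sub, sub_add_cancel]
    module
  · intro n _
    rw [norm_zero]
    positivity
  · intro _
    rw [sub_self, norm_zero]
    positivity
  · intro n _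
    simp only [smul_zero, sub_zero, add_zero, norm_zero]
    positivity
  · intro n _
    rw [norm_zero]
    positivity

/-- `LF-LTS(ν)`: the local source terms have the symbols `υ_j` instead of `ψ`. As both are `1` at
`0`, the difference is in the range of `A_ψ`. -/
theorem CFL.norm_error_lts_le {F : ℕ → ℤ → S}
    (hF0 : ∀ n, n + 1 < N → ∀ j < s.p,
      ‖(1 / 2 : ℝ) • (F (n + 1) j + F (n + 1) (-j)) - f (n + 1)‖ ≤ 2 * M)
    (hF1 : ∀ n, n + 1 < N → ∀ j < s.p,
      ‖(1 / 2 : ℝ) • (F (n + 1) j + F (n + 1) (-j)) - f (n + 1)‖ ≤ s.dt * M)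
    (hF2 : ∀ n, n + 1 < N → ∀ j < s.p,
      ‖(1 / 2 : ℝ) • (F (n + 1) j + F (n + 1) (-j)) - f (n + 1)‖ ≤ s.dt ^ 2 * M)
    (hY : ∀ n, n + 1 < N → ∃ z : ℕ → S, s.IsLocal L (gam s.p s.ν) (F (n + 1))
      ((f (n + 1) - L.P (f (n + 1))) - L.A (Y (n + 1) - L.P (Y (n + 1)))) (Y (n + 1)) z ∧
      Y (n + 2) = -Y n + (2 : ℝ) • z s.p) (n : ℕ) (hn : n < N) :
    ‖U (n + 1) - Y (n + 1)‖ ≤ errConst s.gain cA b * s.dt ^ 2 * (1 + N * s.dt) * M := by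
  have hM := hs.nonneg
  have p0 := s.dt_pos
  have p1 := s.gain_pos
  set g := s.gain with hg
  -- The deviation of the local samples, and its part `κ` of the defect. At the first and the last
  -- time level samples outside of the time interval would occur; there `κ = 0`.
  obtain ⟨G, hG⟩ : ∃ G : ℕ → ℕ → S, ∀ n j, G n j =
    (1 / 2 : ℝ) • (F n j + F n (-j)) - f n := ⟨_, fun _ _ => rfl⟩
  obtain ⟨κ, hκ⟩ : ∃ κ : ℕ → S, ∀ n, κ n = if 1 ≤ n ∧ n < N then
    ∑ j ∈ Finset.range s.p, s.wt j •
      L.F s.psi (fun x => s.ups (s.p - 1 - j) x - 1) (G n j) else 0 := ⟨_, fun _ => rfl⟩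
  obtain ⟨θ, hθ⟩ : ∃ θ : S → S, ∀ v, θ v = ∑ j ∈ Finset.range s.p, s.wt j •
      L.F s.psi (fun x => s.ups (s.p - 1 - j) x - s.psi x) v := ⟨_, fun _ => rfl⟩
  have hθsub : ∀ v w, θ (v - w) = θ v - θ w := by
    intro v w
    rw [hθ, hθ, hθ, ← Finset.sum_sub_distrib]
    exact Finset.sum_congr rfl fun j _ => by rw [L.F_sub, smul_sub]
  have hθ2 : ∀ u v w, θ (u - (2 : ℝ) • v + w) = θ u - (2 : ℝ) • θ v + θ w := by
    intro u v w
    rw [hθ, hθ, hθ, hθ, Finset.smul_sum, ← Finset.sum_sub_distrib, ← Finset.sum_add_distrib]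
    refine Finset.sum_congr rfl fun j _ => ?_
    rw [L.F_add, L.F_sub, L.F_smul]
    module
  have hθn : ∀ v, ‖θ v‖ ≤ s.dt ^ 2 / g * ‖v‖ := by
    intro v
    rw [hθ]
    exact norm_sum_wt_le
      fun j _ => h.norm_F_ups_sub_psi_le (by omega) v
  have hκn : ∀ n {B : ℝ}, 0 ≤ B → (1 ≤ n → n < N → ∀ j < s.p, ‖G n j‖ ≤ B) →
      ‖κ n‖ ≤ s.dt ^ 2 / g * B := by
    intro n B hB hGB
    rw [hκ]
    split_ifs with hn
    · refine norm_sum_wt_le fun j hj => ?_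
      refine (h.norm_F_ups_sub_one_le (by omega) _).trans ?_
      exact mul_le_mul_of_nonneg_left (hGB hn.1 hn.2 j hj) (by positivity)
    · rw [norm_zero]
      positivity
  have hG1 : ∀ n, 1 ≤ n → n < N → ∀ j < s.p, ‖G n j‖ ≤ s.dt * M := by
    intro n h1 h2 j hj
    obtain ⟨m, rfl⟩ : ∃ m, n = m + 1 := ⟨n - 1, by omega⟩
    rw [hG]
    exact hF1 m h2 j hj
  have hG2 : ∀ n, 1 ≤ n → n < N → ∀ j < s.p, ‖G n j‖ ≤ s.dt ^ 2 * M := by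
    intro n h1 h2 j hj
    obtain ⟨m, rfl⟩ : ∃ m, n = m + 1 := ⟨n - 1, by omega⟩
    rw [hG]
    exact hF2 m h2 j hj
  have hθξ : ∀ v, L.ApL s.psi (θ v) = ∑ j ∈ Finset.range s.p, s.wt j •
      (L.R (s.ups (s.p - 1 - j)) (L.P v) - L.R s.psi (L.P v)) := by
    intro v
    rw [hθ, map_sum]
    refine Finset.sum_congr rfl fun j _ => ?_
    have h0 : (fun x => s.ups (s.p - 1 - j) x - s.psi x) 0 = 0 := by
      simp only [s.ups_zero, s.psi_zero, sub_self]
    rw [map_smul, h.ApL_F h0, ← L.R_P h0, L.R_sub]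
  have hκξ : ∀ n, 1 ≤ n → n < N → L.ApL s.psi (κ n) = ∑ j ∈ Finset.range s.p, s.wt j •
      (L.R (s.ups (s.p - 1 - j)) (L.P (G n j)) - L.P (G n j)) := by
    intro n h1 h2
    rw [hκ, if_pos ⟨h1, h2⟩, map_sum]
    refine Finset.sum_congr rfl fun j _ => ?_
    have h0 : (fun x => s.ups (s.p - 1 - j) x - 1) 0 = 0 := by
      simp only [s.ups_zero, sub_self]
    rw [map_smul, h.ApL_F h0, ← L.R_P h0, L.R_sub, L.R_const, one_smul]
  refine h.norm_error_le hb hM (ξ := fun n => θ (f n) + κ n)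
    (η := fun n => ∑ j ∈ Finset.range s.p, s.wt j • L.P (G n j)) hs.eq hY0 ?_ ?_
    hs.second hs.start hs.acc_zero hs.acc_one hs.acc_two ?_ ?_ ?_ ?_ n hn
  · rw [hs.eq]
    exact hY1
  · intro n hn
    obtain ⟨z, hz, e⟩ := hY n hn
    have e1 : f (n + 1) - L.P (f (n + 1)) - L.A (Y (n + 1) - L.P (Y (n + 1))) -
        L.A (L.P (Y (n + 1))) = (f (n + 1) - L.A (Y (n + 1))) - L.P (f (n + 1)) := by
      rw [map_sub]; abel
    have e2 : ∀ j : ℕ, (1 / 2 : ℝ) • (F (n + 1) j + F (n + 1) (-j)) = f (n + 1) + G (n + 1) j := by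
      intro j
      rw [hG]; abel
    have e3 : L.R s.psi (L.P (f (n + 1))) =
        ∑ j ∈ Finset.range s.p, s.wt j • L.R s.psi (L.P (f (n + 1))) := by
      rw [← Finset.sum_smul, s.sum_wt, one_smul]
    have e4 : (∑ j ∈ Finset.range s.p, s.wt j • L.R (s.ups (s.p - 1 - j))
        (L.P ((1 / 2 : ℝ) • (F (n + 1) j + F (n + 1) (-j))))) =
        L.R s.psi (L.P (f (n + 1))) + (L.ApL s.psi (θ (f (n + 1)) + κ (n + 1)) +
          ∑ j ∈ Finset.range s.p, s.wt j • L.P (G (n + 1) j)) := by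
      rw [e3, map_add, hθξ, hκξ (n + 1) (by omega) hn, ← Finset.sum_add_distrib,
        ← Finset.sum_add_distrib, ← Finset.sum_add_distrib]
      refine Finset.sum_congr rfl fun j _ => ?_
      rw [e2, map_add, L.R_vec_add]
      module
    rw [e, hz.closed_form_gam, e1, L.R_vec_sub, e4]
    module
  · intro n hn
    have h1 := hκn n (B := 2 * M) (by positivity) fun h1 h2 j hj => by
      obtain ⟨m, rfl⟩ : ∃ m, n = m + 1 := ⟨n - 1, by omega⟩
      rw [hG]
      exact hF0 m h2 j hj
    have h2 := (hθn (f n)).trans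
      (mul_le_mul_of_nonneg_left (hs.src_zero n hn) (by positivity))
    refine (norm_add_le _ _).trans ((add_le_add h2 h1).trans ?_)
    have h4 : 0 ≤ 1 / g * (s.dt ^ 2 * M) := by positivity
    have e2 : s.dt ^ 2 / g * M + s.dt ^ 2 / g * (2 * M) = 3 * (1 / g * (s.dt ^ 2 * M)) := by ring
    have e3 : 5 / g * (s.dt ^ 2 * M) = 5 * (1 / g * (s.dt ^ 2 * M)) := by ring
    rw [e2, e3]
    linarith
  · intro hN
    have h1 := hκn 1 (B := s.dt * M) (by positivity) (hG1 1)
    have h2 : κ 0 = 0 := by rw [hκ, if_neg (by omega)]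
    have h3 := (hθn (f 1 - f 0)).trans
      (mul_le_mul_of_nonneg_left (hs.src_one hN) (by positivity))
    have e1 : θ (f 1) + κ 1 - (θ (f 0) + κ 0) = θ (f 1 - f 0) + κ 1 := by
      rw [h2, hθsub]; abel
    rw [e1]
    refine (norm_add_le _ _).trans ((add_le_add h3 h1).trans ?_)
    have h4 : 0 ≤ 1 / g * (s.dt ^ 3 * M) := by positivity
    have e2 : s.dt ^ 2 / g * (s.dt * M) + s.dt ^ 2 / g * (s.dt * M) =
        2 * (1 / g * (s.dt ^ 3 * M)) := by ring
    have e3 : 5 / g * (s.dt ^ 3 * M) = 5 * (1 / g * (s.dt ^ 3 * M)) := by ring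
    rw [e2, e3]
    linarith
  · intro n hn
    have h1 := fun m => hκn m (B := s.dt ^ 2 * M) (by positivity) (hG2 m)
    have h3 := (hθn (f (n + 2) - (2 : ℝ) • f (n + 1) + f n)).trans
      (mul_le_mul_of_nonneg_left (hs.src_two n hn) (by positivity))
    have e1 : θ (f (n + 2)) + κ (n + 2) - (2 : ℝ) • (θ (f (n + 1)) + κ (n + 1)) +
        (θ (f n) + κ n) = θ (f (n + 2) - (2 : ℝ) • f (n + 1) + f n) +
          (κ (n + 2) - (2 : ℝ) • κ (n + 1) + κ n) := by
      rw [hθ2]; module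
    have h5 : ‖κ (n + 2) - (2 : ℝ) • κ (n + 1) + κ n‖ ≤ 4 * (s.dt ^ 2 / g * (s.dt ^ 2 * M)) := by
      refine (norm_add_le _ _).trans ((add_le_add (norm_sub_le _ _) le_rfl).trans ?_)
      rw [norm_smul, Real.norm_of_nonneg zero_le_two]
      linarith [h1 n, h1 (n + 1), h1 (n + 2)]
    rw [e1]
    refine (norm_add_le _ _).trans ((add_le_add h3 h5).trans (le_of_eq ?_))
    ring
  · intro n hn
    refine norm_sum_wt_le fun j hj => (L.norm_P_le _).trans (hG2 (n + 1) (by omega) hn j hj)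

end Stepping

/-! ### Pointwise consequences of bounded weak time derivatives -/

section TimeRegularity

open Filter Topology
open scoped Convolution

variable {X : Type*} [NormedAddCommGroup X] [NormedSpace ℝ X] {T : ℝ} {v g : ℝ → X} {M : ℝ}

/-- The mollification of `v`, restricted to `(0, T)`, with the kernel `φ`. -/
def mollify (T : ℝ) (φ : ℝ → ℝ) (v : ℝ → X) : ℝ → X :=
  φ ⋆[ContinuousLinearMap.lsmul ℝ ℝ, volume] (Ioo 0 T).indicator v

theorem mollify_apply (φ : ℝ → ℝ) (v : ℝ → X) (t : ℝ) :
    mollify T φ v t = ∫ s in Ioo 0 T, φ (t - s) • v s := by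
  rw [mollify, convolution_lsmul_swap, ← integral_indicator measurableSet_Ioo]
  refine integral_congr_ae (.of_forall fun s => ?_)
  by_cases hs : s ∈ Ioo 0 T <;> simp [hs]

omit [NormedSpace ℝ X] in
theorem locallyIntegrable_indicator (hv : ContinuousOn v (Icc 0 T)) :
    LocallyIntegrable ((Ioo 0 T).indicator v) := by
  refine Integrable.locallyIntegrable ?_
  rw [integrable_indicator_iff measurableSet_Ioo]
  exact hv.integrableOn_Icc.mono_set Ioo_subset_Icc_self

theorem hasDerivAt_mollify {φ : ℝ → ℝ} (hφ : ContDiff ℝ 1 φ) (hφc : HasCompactSupport φ)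
    (hv : ContinuousOn v (Icc 0 T)) (t : ℝ) :
    HasDerivAt (mollify T φ v) (mollify T (deriv φ) v t) t :=
  hφc.hasDerivAt_convolution_left _ hφ (locallyIntegrable_indicator hv) t

/-- Mollification with a kernel of integral `1` does not increase the bound of a weak derivative. -/
theorem norm_mollify_iteratedDeriv_le {l : ℕ} (hg : IsWeakTimeDeriv T l v g)
    (hM : ∀ᵐ t ∂(volume.restrict (Ioo 0 T)), ‖g t‖ ≤ M)
    (η : ContDiffBump (0 : ℝ)) {t : ℝ} (ht : Metric.closedBall t η.rOut ⊆ Ioo 0 T) :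
    ‖mollify T (iteratedDeriv l (η.normed volume)) v t‖ ≤ M := by
  have hb : Metric.closedBall t η.rOut ∈ 𝓝 t := Metric.closedBall_mem_nhds t η.rOut_pos
  have hM0 : 0 ≤ M := by
    have : (volume.restrict (Ioo 0 T)) ≠ 0 := by
      have h0 : t ∈ Ioo 0 T := ht (mem_of_mem_nhds hb)
      rw [Ne, Measure.restrict_eq_zero, Real.volume_Ioo, ENNReal.ofReal_eq_zero]
      linarith [h0.1, h0.2]
    have : (ae (volume.restrict (Ioo 0 T))).NeBot := ae_neBot.mpr this
    obtain ⟨x, hx⟩ := hM.exists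
    exact (norm_nonneg _).trans hx
  set φ : ℝ → ℝ := fun s => η.normed volume (t - s) with hφ
  have hφs : ContDiff ℝ ∞ φ := η.contDiff_normed.comp (contDiff_const.sub contDiff_id)
  have hφt : tsupport φ ⊆ Metric.closedBall t η.rOut := by
    refine closure_minimal (fun s hs => ?_) Metric.isClosed_closedBall
    have h1 : t - s ∈ Function.support (η.normed volume) := hs
    rw [η.support_normed_eq] at h1
    rw [Metric.mem_closedBall, Real.dist_eq, abs_sub_comm]
    simpa [Real.dist_eq] using (Metric.mem_ball.mp h1).le
  have hφc : HasCompactSupport φ :=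
    (isCompact_closedBall t η.rOut).of_isClosed_subset (isClosed_tsupport φ) hφt
  have hφd : ∀ s, iteratedDeriv l φ s =
      (-1 : ℝ) ^ l * iteratedDeriv l (η.normed volume) (t - s) := by
    intro s
    rw [hφ, iteratedDeriv_comp_const_sub]
    simp
  have h1 := hg φ hφs hφc (hφt.trans ht)
  have h2 : mollify T (iteratedDeriv l (η.normed volume)) v t =
      ∫ s in Ioo 0 T, φ s • g s := by
    have e : ((-1 : ℝ) ^ l * (-1) ^ l) = 1 := by rw [← mul_pow]; norm_num
    rw [mollify_apply, ← one_smul ℝ (∫ s in Ioo 0 T, φ s • g s), ← e, mul_smul, ← h1,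
      ← integral_smul]
    refine integral_congr_ae (.of_forall fun s => ?_)
    simp only [hφd, smul_smul, ← mul_assoc, e, one_mul]
  have hint : Integrable φ := (η.integrable_normed (μ := volume)).comp_sub_left t
  have hone : ∫ s, φ s = 1 := by
    rw [hφ, integral_sub_left_eq_self (fun s => η.normed volume s) volume t, η.integral_normed]
  rw [h2]
  calc ‖∫ s in Ioo 0 T, φ s • g s‖ ≤ ∫ s in Ioo 0 T, φ s * M := by
        refine norm_integral_le_of_norm_le (hint.integrableOn.mul_const M) ?_
        filter_upwards [hM] with s hs
        rw [norm_smul, Real.norm_of_nonneg (η.nonneg_normed _)]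
        exact mul_le_mul_of_nonneg_left hs (η.nonneg_normed _)
    _ = (∫ s in Ioo 0 T, φ s) * M := integral_mul_const _ _
    _ ≤ 1 * M := by
        refine mul_le_mul_of_nonneg_right ?_ hM0
        rw [← hone]
        exact setIntegral_le_integral hint (.of_forall fun s => η.nonneg_normed _)
    _ = M := one_mul M

/-- Bump functions with outer radius `1 / (k + 1)`. -/
def bumpSeq (k : ℕ) : ContDiffBump (0 : ℝ) where
  rIn := 1 / (2 * ((k : ℝ) + 1))
  rOut := 1 / ((k : ℝ) + 1)
  rIn_pos := by positivity
  rIn_lt_rOut := by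
    have : (0 : ℝ) < (k : ℝ) + 1 := by positivity
    exact one_div_lt_one_div_of_lt this (by linarith)

theorem tendsto_mollify [CompleteSpace X] (hv : ContinuousOn v (Icc 0 T)) {t : ℝ}
    (ht : t ∈ Ioo 0 T) :
    Tendsto (fun k => mollify T ((bumpSeq k).normed volume) v t) atTop (𝓝 (v t)) := by
  refine ContDiffBump.convolution_tendsto_right (φ := bumpSeq) (k := fun _ => t)
    (g := fun _ => (Ioo 0 T).indicator v) tendsto_one_div_add_atTop_nhds_zero_nat
    (.of_forall fun _ => (locallyIntegrable_indicator hv).aestronglyMeasurable) ?_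
    tendsto_const_nhds
  have h1 : ContinuousAt ((Ioo 0 T).indicator v) t := by
    have h2 : ContinuousAt v t := (hv t (Ioo_subset_Icc_self ht)).continuousAt
      (mem_of_superset (isOpen_Ioo.mem_nhds ht) Ioo_subset_Icc_self)
    refine h2.congr ?_
    filter_upwards [isOpen_Ioo.mem_nhds ht] with s hs
    rw [indicator_of_mem hs]
  have h3 := h1.tendsto
  rw [indicator_of_mem ht] at h3
  exact h3.comp tendsto_snd

theorem eventually_closedBall_subset {a b : ℝ} (ha : 0 < a) (hb : b < T) :
    ∀ᶠ k : ℕ in atTop, ∀ t ∈ Icc a b, Metric.closedBall t (bumpSeq k).rOut ⊆ Ioo 0 T := by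
  have h1 : ∀ᶠ k : ℕ in atTop, 1 / ((k : ℝ) + 1) < min a (T - b) :=
    (tendsto_order.mp tendsto_one_div_add_atTop_nhds_zero_nat).2 _ (lt_min ha (by linarith))
  filter_upwards [h1] with k hk t ht s hs
  have hr : (bumpSeq k).rOut = 1 / ((k : ℝ) + 1) := rfl
  rw [Metric.mem_closedBall, Real.dist_eq, hr, abs_le] at hs
  have h2 := hk.trans_le (min_le_left _ _)
  have h3 := hk.trans_le (min_le_right _ _)
  exact ⟨by linarith [ht.1, hs.1], by linarith [ht.2, hs.2]⟩

theorem norm_le_of_isWeakTimeDeriv_zero [CompleteSpace X] (hT : 0 < T)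
    (hv : ContinuousOn v (Icc 0 T)) (hg : IsWeakTimeDeriv T 0 v g) (hM : ∀ᵐ t ∂(volume.restrict (Ioo 0 T)), ‖g t‖ ≤ M)
    {t : ℝ} (ht : t ∈ Icc 0 T) : ‖v t‖ ≤ M := by
  rw [← closure_Ioo hT.ne] at ht hv
  refine le_on_closure (fun t ht => ?_) hv.norm continuousOn_const ht
  rw [closure_Ioo hT.ne] at hv
  refine le_of_tendsto (tendsto_mollify hv ht).norm ?_
  filter_upwards [eventually_closedBall_subset ht.1 ht.2] with k hk
  have := norm_mollify_iteratedDeriv_le hg hM (bumpSeq k) (hk t ⟨le_rfl, le_rfl⟩)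
  rwa [iteratedDeriv_zero] at this

/-- A function with weak derivative bounded by `M` is Lipschitz continuous. -/
theorem norm_sub_le_of_isWeakTimeDeriv_one [CompleteSpace X] (hv : ContinuousOn v (Icc 0 T))
    (hg : IsWeakTimeDeriv T 1 v g) (hM : ∀ᵐ t ∂(volume.restrict (Ioo 0 T)), ‖g t‖ ≤ M)
    {s t : ℝ} (hs : 0 ≤ s) (hst : s ≤ t) (ht : t ≤ T) : ‖v t - v s‖ ≤ M * (t - s) := by
  have inner : ∀ s t : ℝ, 0 < s → s ≤ t → t < T → ‖v t - v s‖ ≤ M * (t - s) := by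
    intro s t hs hst ht
    refine le_of_tendsto ((tendsto_mollify hv ⟨hs.trans_le hst, ht⟩).sub
      (tendsto_mollify hv ⟨hs, hst.trans_lt ht⟩)).norm ?_
    filter_upwards [eventually_closedBall_subset hs ht] with k hk
    have := (convex_Icc s t).norm_image_sub_le_of_norm_hasDerivWithin_le (C := M)
      (f := mollify T ((bumpSeq k).normed volume) v)
      (fun x _ => (hasDerivAt_mollify (bumpSeq k).contDiff_normed
        (bumpSeq k).hasCompactSupport_normed hv x).hasDerivWithinAt)
      (fun x hx => by
        have := norm_mollify_iteratedDeriv_le hg hM (bumpSeq k) (hk x hx)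
        rwa [iteratedDeriv_one] at this) (left_mem_Icc.mpr hst) (right_mem_Icc.mpr hst)
    rwa [Real.norm_of_nonneg (by linarith)] at this
  rcases hst.eq_or_lt with rfl | hst
  · simp
  -- Shrink `[s, t]` towards its midpoint.
  set c := (s + t) / 2 with hc
  set r := (t - s) / 2 with hr
  have hr0 : 0 < r := by rw [hr]; linarith
  have key : ∀ x ∈ closure (Ioo 0 r), ‖v (c + x) - v (c - x)‖ ≤ M * (2 * x) := by
    intro x hx
    refine le_on_closure (s := Ioo 0 r) (f := fun x => ‖v (c + x) - v (c - x)‖)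
      (g := fun x => M * (2 * x)) (fun x hx => ?_) ?_ (by fun_prop) hx
    · have := inner (c - x) (c + x) (by linarith [hx.2]) (by linarith [hx.1])
        (by linarith [hx.2])
      have e : c + x - (c - x) = 2 * x := by ring
      rwa [e] at this
    · rw [closure_Ioo hr0.ne]
      refine ((hv.comp (by fun_prop) fun x hx => ?_).sub
        (hv.comp (by fun_prop) fun x hx => ?_)).norm
      · exact ⟨by linarith [hx.1], by linarith [hx.2]⟩
      · exact ⟨by linarith [hx.2], by linarith [hx.1]⟩
  have h1 := key r (by rw [closure_Ioo hr0.ne]; exact right_mem_Icc.mpr hr0.le)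
  have e1 : c + r = t := by rw [hc, hr]; ring
  have e2 : c - r = s := by rw [hc, hr]; ring
  have e3 : 2 * r = t - s := by rw [hr]; ring
  rwa [e1, e2, e3] at h1

/-- Second differences of a function whose second weak derivative is bounded by `M`. -/
theorem norm_second_diff_le [CompleteSpace X] (hv : ContinuousOn v (Icc 0 T))
    (hg : IsWeakTimeDeriv T 2 v g) (hM : ∀ᵐ t ∂(volume.restrict (Ioo 0 T)), ‖g t‖ ≤ M)
    {t r : ℝ} (hr : 0 ≤ r) (hl : 0 ≤ t - r) (hu : t + r ≤ T) :
    ‖v (t + r) - (2 : ℝ) • v t + v (t - r)‖ ≤ M * r ^ 2 := by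
  have inner : ∀ r : ℝ, 0 < r → 0 < t - r → t + r < T →
      ‖v (t + r) - (2 : ℝ) • v t + v (t - r)‖ ≤ M * r ^ 2 := by
    intro r hr hl hu
    refine le_of_tendsto (((tendsto_mollify hv ⟨by linarith, hu⟩).sub
      ((tendsto_mollify hv ⟨by linarith, by linarith⟩).const_smul (2 : ℝ))).add
      (tendsto_mollify hv ⟨hl, by linarith⟩)).norm ?_
    filter_upwards [eventually_closedBall_subset hl hu] with k hk
    set φ : ℝ → ℝ := (bumpSeq k).normed volume with hφ
    have hφs : ContDiff ℝ ∞ φ := (bumpSeq k).contDiff_normed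
    have hφc : HasCompactSupport φ := (bumpSeq k).hasCompactSupport_normed
    have hd1 : ∀ x, HasDerivAt (mollify T φ v) (mollify T (deriv φ) v x) x :=
      hasDerivAt_mollify (hφs.of_le (by simp)) hφc hv
    have hd2 : ∀ x, HasDerivAt (mollify T (deriv φ) v) (mollify T (deriv (deriv φ)) v x) x :=
      hasDerivAt_mollify ((contDiff_infty_iff_deriv.mp hφs).2.of_le (by simp)) hφc.deriv hv
    have hb2 : ∀ x ∈ Icc (t - r) (t + r), ‖mollify T (deriv (deriv φ)) v x‖ ≤ M := by
      intro x hx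
      have := norm_mollify_iteratedDeriv_le hg hM (bumpSeq k) (hk x hx)
      rwa [iteratedDeriv_succ, iteratedDeriv_one] at this
    have hb1 : ∀ x ∈ Icc (t - r) t,
        ‖mollify T (deriv φ) v (x + r) - mollify T (deriv φ) v x‖ ≤ M * r := by
      intro x hx
      have := (convex_Icc (t - r) (t + r)).norm_image_sub_le_of_norm_hasDerivWithin_le (C := M)
        (f := mollify T (deriv φ) v) (x := x) (y := x + r)
        (fun x _ => (hd2 x).hasDerivWithinAt) hb2 ⟨hx.1, by linarith [hx.2]⟩
        ⟨by linarith [hx.1], by linarith [hx.2]⟩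
      rwa [add_sub_cancel_left, Real.norm_of_nonneg hr.le] at this
    have := (convex_Icc (t - r) t).norm_image_sub_le_of_norm_hasDerivWithin_le (C := M * r)
      (f := fun x => mollify T φ v (x + r) - mollify T φ v x) (x := t - r) (y := t)
      (fun x _ => (((hd1 (x + r)).comp_add_const x r).sub (hd1 x)).hasDerivWithinAt)
      hb1 ⟨le_rfl, by linarith⟩ ⟨by linarith, le_rfl⟩
    rw [sub_sub_cancel, Real.norm_of_nonneg hr.le, sub_add_cancel] at this
    have e : mollify T φ v (t + r) - (2 : ℝ) • mollify T φ v t + mollify T φ v (t - r) =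
        mollify T φ v (t + r) - mollify T φ v t -
          (mollify T φ v t - mollify T φ v (t - r)) := by
      module
    rw [e]
    refine this.trans (le_of_eq ?_)
    ring
  rcases hr.eq_or_lt with rfl | hr0
  · have e : v (t + 0) - (2 : ℝ) • v t + v (t - 0) = 0 := by
      rw [add_zero, sub_zero]
      module
    rw [e]
    simp
  refine le_on_closure (s := Ioo 0 r) (f := fun r => ‖v (t + r) - (2 : ℝ) • v t + v (t - r)‖)
    (g := fun r => M * r ^ 2) (fun x hx => ?_) ?_ (by fun_prop)
    (by rw [closure_Ioo hr0.ne]; exact right_mem_Icc.mpr hr)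
  · exact inner x hx.1 (by linarith [hx.2]) (by linarith [hx.2])
  · rw [closure_Ioo hr0.ne]
    refine (((hv.comp (by fun_prop) fun x hx => ?_).sub continuousOn_const).add
        (hv.comp (by fun_prop) fun x hx => ?_)).norm
    · exact ⟨by linarith [hx.1], by linarith [hx.2]⟩
    · exact ⟨by linarith [hx.2], by linarith [hx.1]⟩

/-- The function `u` on `[0, T]` has the continuous velocity `w` and the continuous acceleration
`v`. The velocity is differentiated in `(0, T)` only. -/
structure IsMotion (T : ℝ) (u w v : ℝ → X) : Prop where
  deriv : ∀ t ∈ Icc 0 T, HasDerivWithinAt u (w t) (Icc 0 T) t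
  vel_cont : ContinuousOn w (Icc 0 T)
  vel_deriv : ∀ t ∈ Ioo 0 T, HasDerivWithinAt w (v t) (Icc 0 T) t
  acc_cont : ContinuousOn v (Icc 0 T)

namespace IsMotion

variable {u w : ℝ → X}

theorem continuousOn (h : IsMotion T u w v) : ContinuousOn u (Icc 0 T) := fun t ht =>
  (h.deriv t ht).continuousWithinAt

theorem hasDerivAt (h : IsMotion T u w v) {t : ℝ} (ht : t ∈ Ioo 0 T) : HasDerivAt u (w t) t :=
  (h.deriv t (Ioo_subset_Icc_self ht)).hasDerivAt
    (mem_of_superset (isOpen_Ioo.mem_nhds ht) Ioo_subset_Icc_self)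

theorem hasDerivAt_vel (h : IsMotion T u w v) {t : ℝ} (ht : t ∈ Ioo 0 T) :
    HasDerivAt w (v t) t :=
  (h.vel_deriv t ht).hasDerivAt
    (mem_of_superset (isOpen_Ioo.mem_nhds ht) Ioo_subset_Icc_self)

end IsMotion

/-- If `u'' = v` classically, the weak derivative of order `l + 2` of `u` is the one of order `l`
of `v`. -/
theorem IsWeakTimeDeriv.of_motion [CompleteSpace X] {u w : ℝ → X} {l : ℕ} (hT : 0 < T)
    (h : IsMotion T u w v) (hg : IsWeakTimeDeriv T (l + 2) u g) :
    IsWeakTimeDeriv T l v g := by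
  intro φ h1 h2 h3
  have h4 := hg φ h1 h2 h3
  have e : (-1 : ℝ) ^ (l + 2) = (-1) ^ l := by rw [pow_add]; norm_num
  rw [e] at h4
  rw [← h4]
  have huc := h.continuousOn
  have hwc := h.vel_cont
  have hv := h.acc_cont
  have hc : ∀ k, Continuous (iteratedDeriv k φ) := fun k =>
    h1.continuous_iteratedDeriv k (by exact_mod_cast le_top)
  have hd : ∀ k t, HasDerivAt (iteratedDeriv k φ) (iteratedDeriv (k + 1) φ t) t := by
    intro k t
    rw [iteratedDeriv_succ]
    exact (h1.differentiable_iteratedDeriv k (by exact_mod_cast ENat.natCast_lt_top k) t).hasDerivAt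
  have hz : ∀ k, ∀ t ∉ Ioo 0 T, iteratedDeriv k φ t = 0 := by
    intro k t ht
    by_contra hne
    have : t ∈ Function.support (iteratedFDeriv ℝ k φ) := by
      intro h0
      exact hne (by rw [iteratedDeriv_eq_iteratedFDeriv, h0]; rfl)
    exact ht (h3 (support_iteratedFDeriv_subset k this))
  -- The boundary terms of the integration by parts vanish.
  have key := intervalIntegral.integral_eq_sub_of_hasDerivAt_of_le hT.le
    (f := fun t => iteratedDeriv (l + 1) φ t • u t - iteratedDeriv l φ t • w t)
    (f' := fun t => iteratedDeriv (l + 2) φ t • u t - iteratedDeriv l φ t • v t)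
    (((hc _).continuousOn.smul huc).sub ((hc _).continuousOn.smul hwc)) (fun t ht => by
      have := ((hd (l + 1) t).smul (h.hasDerivAt ht)).sub ((hd l t).smul (h.hasDerivAt_vel ht))
      refine this.congr_deriv ?_
      abel)
    (by
      rw [intervalIntegrable_iff_integrableOn_Icc_of_le hT.le]
      exact (((hc _).continuousOn.smul huc).sub
        ((hc _).continuousOn.smul hv)).integrableOn_Icc)
  rw [hz _ T (by simp), hz _ T (by simp), hz _ 0 (by simp), hz _ 0 (by simp),
    intervalIntegral.integral_of_le hT.le, integral_Ioc_eq_integral_Ioo] at key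
  rw [integral_sub] at key
  · simpa using (sub_eq_zero.mp (by simpa using key)).symm
  · exact ((hc _).continuousOn.smul huc).integrableOn_Icc.mono_set Ioo_subset_Icc_self
  · exact ((hc _).continuousOn.smul hv).integrableOn_Icc.mono_set Ioo_subset_Icc_self

theorem norm_sub_le_of_hasDerivAt {a b C : ℝ} {f f' : ℝ → X} (hab : a ≤ b)
    (hf : ContinuousOn f (Icc a b)) (hd : ∀ t ∈ Ioo a b, HasDerivAt f (f' t) t)
    (hb : ∀ t ∈ Ioo a b, ‖f' t‖ ≤ C) : ‖f b - f a‖ ≤ C * (b - a) := by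
  rcases hab.eq_or_lt with rfl | hab
  · simp
  have hC : 0 ≤ C := by
    have : (a + b) / 2 ∈ Ioo a b := ⟨by linarith, by linarith⟩
    exact (norm_nonneg _).trans (hb _ this)
  have h1 : LipschitzOnWith ⟨C, hC⟩ f (Ioo a b) :=
    (convex_Ioo a b).lipschitzOnWith_of_nnnorm_hasDerivWithin_le
      (fun x hx => (hd x hx).hasDerivWithinAt) fun x hx => hb x hx
  have h2 := h1.closure (by rwa [closure_Ioo hab.ne])
  rw [closure_Ioo hab.ne] at h2
  have h3 := h2.dist_le_mul b (right_mem_Icc.mpr hab.le) a (left_mem_Icc.mpr hab.le)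
  rwa [dist_eq_norm, Real.dist_eq, abs_of_pos (sub_pos.mpr hab)] at h3

/-- Taylor's formula of second order with zero initial data. -/
theorem norm_le_of_second_deriv {r C : ℝ} {f f' f'' : ℝ → X} (hr : 0 ≤ r)
    (hf : ContinuousOn f (Icc 0 r)) (hf' : ContinuousOn f' (Icc 0 r))
    (hd : ∀ t ∈ Ioo 0 r, HasDerivAt f (f' t) t) (hd' : ∀ t ∈ Ioo 0 r, HasDerivAt f' (f'' t) t)
    (hb : ∀ t ∈ Ioo 0 r, ‖f'' t‖ ≤ C) (h0 : f 0 = 0) (h0' : f' 0 = 0) :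
    ‖f r‖ ≤ C * r ^ 2 := by
  rcases hr.eq_or_lt with rfl | hr0
  · simp [h0]
  have hC : 0 ≤ C := (norm_nonneg _).trans (hb (r / 2) ⟨by linarith, by linarith⟩)
  have h1 : ∀ t ∈ Ioo 0 r, ‖f' t‖ ≤ C * r := by
    intro t ht
    have := norm_sub_le_of_hasDerivAt ht.1.le (hf'.mono (Icc_subset_Icc_right ht.2.le))
      (fun x hx => hd' x ⟨hx.1, hx.2.trans ht.2⟩) (fun x hx => hb x ⟨hx.1, hx.2.trans ht.2⟩)
    rw [h0', sub_zero, sub_zero] at this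
    exact this.trans (mul_le_mul_of_nonneg_left ht.2.le hC)
  have h2 := norm_sub_le_of_hasDerivAt hr hf hd h1
  rw [h0, sub_zero, sub_zero] at h2
  refine h2.trans (le_of_eq ?_)
  ring

/-- Central differences of a solution of `u'' = v`. -/
theorem IsMotion.norm_central_diff_le [CompleteSpace X] {u w : ℝ → X} (h : IsMotion T u w v)
    (hg : IsWeakTimeDeriv T 2 v g)
    (hM : ∀ᵐ t ∂(volume.restrict (Ioo 0 T)), ‖g t‖ ≤ M) {t r : ℝ} (hr : 0 ≤ r) (hl : 0 ≤ t - r)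
    (hur : t + r ≤ T) :
    ‖u (t + r) - (2 : ℝ) • u t + u (t - r) - r ^ 2 • v t‖ ≤ r ^ 4 * M := by
  have huc := h.continuousOn
  have hwc := h.vel_cont
  have hv := h.acc_cont
  have m1 : ∀ x ∈ Icc 0 r, t + x ∈ Icc 0 T := fun x hx =>
    ⟨by linarith [hx.1], by linarith [hx.2]⟩
  have m2 : ∀ x ∈ Icc 0 r, t - x ∈ Icc 0 T := fun x hx =>
    ⟨by linarith [hx.2], by linarith [hx.1]⟩
  have m1' : ∀ x ∈ Ioo 0 r, t + x ∈ Ioo 0 T := fun x hx =>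
    ⟨by linarith [hx.1, hx.2], by linarith [hx.2]⟩
  have m2' : ∀ x ∈ Ioo 0 r, t - x ∈ Ioo 0 T := fun x hx =>
    ⟨by linarith [hx.2], by linarith [hx.1, hx.2]⟩
  have := norm_le_of_second_deriv (C := r ^ 2 * M) hr
    (f := fun x => u (t + x) - (2 : ℝ) • u t + u (t - x) - x ^ 2 • v t)
    (f' := fun x => w (t + x) - w (t - x) - (2 * x) • v t)
    (f'' := fun x => v (t + x) - (2 : ℝ) • v t + v (t - x))
    ((((huc.comp (by fun_prop) m1).sub continuousOn_const).add
      (huc.comp (by fun_prop) m2)).sub (by fun_prop))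
    (((hwc.comp (by fun_prop) m1).sub (hwc.comp (by fun_prop) m2)).sub (by fun_prop))
    (fun x hx => by
      have d1 := (h.hasDerivAt (m1' x hx)).comp_const_add t x
      have d2 := (h.hasDerivAt (m2' x hx)).comp_const_sub t x
      have d3 := (hasDerivAt_pow 2 x).smul_const (v t)
      have := ((d1.sub_const ((2 : ℝ) • u t)).add d2).sub d3
      refine this.congr_deriv ?_
      simp only [Nat.cast_ofNat, Nat.add_one_sub_one, pow_one]
      abel)
    (fun x hx => by
      have d1 := (h.hasDerivAt_vel (m1' x hx)).comp_const_add t x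
      have d2 := (h.hasDerivAt_vel (m2' x hx)).comp_const_sub t x
      have d3 := ((hasDerivAt_id x).const_mul 2).smul_const (v t)
      have := (d1.sub d2).sub d3
      refine this.congr_deriv ?_
      rw [mul_one]
      abel)
    (fun x hx => by
      have := norm_second_diff_le hv hg hM hx.1.le (t := t) (by linarith [hx.2])
        (by linarith [hx.2])
      refine this.trans ?_
      have hM0 : 0 ≤ M := by
        have h0 := (norm_nonneg _).trans this
        exact nonneg_of_mul_nonneg_left h0 (by have := hx.1; positivity)
      rw [mul_comm]
      have := hx.1
      have := hx.2.le
      gcongr)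
    (by simp only [add_zero, sub_zero]; module) (by simp)
  refine this.trans (le_of_eq ?_)
  ring

/-- The first Taylor step of a solution of `u'' = v`. -/
theorem IsMotion.norm_taylor_le [CompleteSpace X] {u w : ℝ → X} (h : IsMotion T u w v)
    (hg : IsWeakTimeDeriv T 1 v g)
    (hM : ∀ᵐ t ∂(volume.restrict (Ioo 0 T)), ‖g t‖ ≤ M) {r : ℝ} (hr : 0 ≤ r) (hur : r ≤ T) :
    ‖u r - u 0 - r • w 0 - (r ^ 2 / 2) • v 0‖ ≤ r ^ 3 * M := by
  have huc := h.continuousOn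
  have hwc := h.vel_cont
  have hv := h.acc_cont
  have hm : ∀ x ∈ Ioo 0 r, x ∈ Ioo 0 T := fun x hx => ⟨hx.1, hx.2.trans_le hur⟩
  have hs : Icc 0 r ⊆ Icc 0 T := Icc_subset_Icc_right hur
  have := norm_le_of_second_deriv (C := r * M) hr
    (f := fun x => u x - u 0 - x • w 0 - (x ^ 2 / 2) • v 0)
    (f' := fun x => w x - w 0 - x • v 0)
    (f'' := fun x => v x - v 0)
    ((((huc.mono hs).sub continuousOn_const).sub (by fun_prop)).sub (by fun_prop))
    (((hwc.mono hs).sub continuousOn_const).sub (by fun_prop))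
    (fun x hx => by
      have d1 := h.hasDerivAt (hm x hx)
      have d2 := (hasDerivAt_id x).smul_const (w 0)
      have d3 := ((hasDerivAt_pow 2 x).div_const 2).smul_const (v 0)
      have := ((d1.sub_const (u 0)).sub d2).sub d3
      refine this.congr_deriv ?_
      simp)
    (fun x hx => by
      have d1 := h.hasDerivAt_vel (hm x hx)
      have d2 := (hasDerivAt_id x).smul_const (v 0)
      have := (d1.sub_const (w 0)).sub d2
      refine this.congr_deriv ?_
      simp)
    (fun x hx => by
      have := norm_sub_le_of_isWeakTimeDeriv_one hv hg hM le_rfl hx.1.le (hx.2.le.trans hur)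
      refine this.trans ?_
      have hM0 : 0 ≤ M := by
        have h0 := (norm_nonneg _).trans this
        exact nonneg_of_mul_nonneg_left h0 (by linarith [hx.1])
      rw [mul_comm, sub_zero]
      exact mul_le_mul_of_nonneg_right hx.2.le hM0)
    (by simp) (by simp)
  refine this.trans (le_of_eq ?_)
  ring

end TimeRegularity

section RegularityNorm

variable {X : Type*} [NormedAddCommGroup X] [NormedSpace ℝ X] {T : ℝ} {u f : ℝ → X}

theorem MemWInfty.timeDeriv_spec {k l : ℕ} (h : MemWInfty T k u) (hl : l ≤ k) :
    IsWeakTimeDeriv T l u (timeDeriv T l u) ∧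
      ∀ᵐ t ∂(volume.restrict (Ioo 0 T)), ‖timeDeriv T l u t‖ ≤ timeDerivNorm T l u := by
  have h1 := h.2 l hl
  have e : timeDeriv T l u = h1.choose := by rw [timeDeriv, dif_pos h1]
  have h2 := h1.choose_spec
  rw [← e] at h2
  refine ⟨h2.2, ?_⟩
  filter_upwards [ae_le_eLpNormEssSup (f := timeDeriv T l u)
    (μ := volume.restrict (Ioo 0 T))] with t ht
  have h3 := h2.1.2.ne
  rw [timeDerivNorm, ← toReal_enorm]
  rw [← eLpNorm_exponent_top] at ht
  exact ENNReal.toReal_mono h3 ht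

theorem timeDerivNorm_le_regM_left {l : ℕ} (h1 : 2 ≤ l) (h2 : l ≤ 5) :
    timeDerivNorm T l u ≤ regM T u f :=
  (Finset.le_sup' (fun l => timeDerivNorm T l u) (Finset.mem_Icc.mpr ⟨h1, h2⟩)).trans
    (le_max_left _ _)

theorem timeDerivNorm_le_regM_right {l : ℕ} (h : l ≤ 3) :
    timeDerivNorm T l f ≤ regM T u f :=
  (Finset.le_sup' (fun l => timeDerivNorm T l f) (Finset.mem_Icc.mpr ⟨Nat.zero_le _, h⟩)).trans
    (le_max_right _ _)

theorem regM_nonneg : 0 ≤ regM T u f :=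
  ENNReal.toReal_nonneg.trans (timeDerivNorm_le_regM_right (l := 0) (Nat.zero_le _))

theorem MemWInfty.source_spec {k l : ℕ} (h : MemWInfty T k f) (hl : l ≤ k) (h3 : l ≤ 3) :
    ∃ g : ℝ → X, IsWeakTimeDeriv T l f g ∧
      ∀ᵐ t ∂(volume.restrict (Ioo 0 T)), ‖g t‖ ≤ regM T u f := by
  obtain ⟨h1, h2⟩ := h.timeDeriv_spec hl
  exact ⟨_, h1, h2.mono fun t ht => ht.trans (timeDerivNorm_le_regM_right h3)⟩

theorem MemWInfty.solution_spec {k l : ℕ} (h : MemWInfty T k u) (hl : l ≤ k) (h2 : 2 ≤ l)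
    (h5 : l ≤ 5) :
    ∃ g : ℝ → X, IsWeakTimeDeriv T l u g ∧
      ∀ᵐ t ∂(volume.restrict (Ioo 0 T)), ‖g t‖ ≤ regM T u f := by
  obtain ⟨h1, h3⟩ := h.timeDeriv_spec hl
  exact ⟨_, h1, h3.mono fun t ht => ht.trans (timeDerivNorm_le_regM_left h2 h5)⟩

end RegularityNorm

/-! ### The refined region and the coarse part of a finite element function -/

namespace Mesh

variable {d : ℕ} {Ω : Set (E d)} (T : Mesh Ω)

theorem exists_isBary {s : Finset (E d)} {x : E d} (hx : x ∈ simplex s) : ∃ w, IsBary s x w := by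
  classical
  rw [simplex, Finset.mem_convexHull'] at hx
  obtain ⟨c, h0, h1, h2⟩ := hx
  refine ⟨fun v => if v ∈ s then c v else 0, fun v hv => ?_, fun v hv => if_neg hv, ?_, ?_⟩
  · rw [if_pos hv]
    exact h0 v hv
  · rw [← h1]
    exact Finset.sum_congr rfl fun v hv => if_pos hv
  · rw [← h2]
    exact Finset.sum_congr rfl fun v hv => by rw [if_pos hv]

/-- A cell is the closure of its interior, since its vertices are affinely independent. -/
theorem simplex_subset_closure_interior {s : Finset (E d)} (hs : s ∈ T.cells) :
    simplex s ⊆ closure (interior (simplex s)) := by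
  have h1 : (interior (simplex s)).Nonempty := by
    rw [simplex, interior_convexHull_nonempty_iff_affineSpan_eq_top]
    have h2 := (T.indep s hs).affineSpan_eq_top_iff_card_eq_finrank_add_one
    rw [Subtype.range_coe_subtype] at h2
    refine h2.mpr ?_
    rw [Fintype.card_coe, T.card_cell s hs, finrank_euclideanSpace_fin]
  have h3 := (convex_convexHull ℝ (s : Set (E d))).closure_interior_eq_closure_of_nonempty_interior h1
  exact subset_closure.trans h3.ge

theorem interior_simplex_subset_region {C : Finset (Finset (E d))} {s : Finset (E d)}
    (hs : s ∈ C) : interior (simplex s) ⊆ region C :=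
  interior_mono (subset_biUnion_of_mem (u := fun s => simplex s) hs)

theorem simplex_subset_closure_region {C : Finset (Finset (E d))} (hC : C ⊆ T.cells)
    {s : Finset (E d)} (hs : s ∈ C) : simplex s ⊆ closure (region C) :=
  (T.simplex_subset_closure_interior (hC hs)).trans
    (closure_mono (interior_simplex_subset_region hs))

/-- A nodal basis function vanishes on the cells that do not contain its node: a vertex `v` with
`λᵥ(z) > 0` is missing in such a cell, so that the factor `m λᵥ(x) - 0` vanishes there. -/
theorem nodalBasis_eq_zero {m : ℕ} (hm : 1 ≤ m) {z : E d} (hz : z ∈ T.nodes m)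
    {t : Finset (E d)} (ht : t ∈ T.cells) (hzt : z ∉ simplex t) {x : E d} (hx : x ∈ simplex t) :
    T.nodalBasis m z x = 0 := by
  classical
  obtain ⟨s, hs, α, h1, h2, h3, -, h5⟩ := T.exists_of_mem_nodes hm hz
  have hm' : (m : ℝ) ≠ 0 := by positivity
  have hsub : ∀ r ∈ T.cells, r ⊆ T.vertices := fun r hr v hv => Finset.mem_biUnion.mpr ⟨r, hr, hv⟩
  obtain ⟨v, hv, hvt, hα⟩ : ∃ v ∈ T.vertices, v ∉ t ∧ α v ≠ 0 := by
    by_contra! hcon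
    refine hzt ?_
    rw [simplex, Finset.mem_convexHull']
    refine ⟨fun v => (α v : ℝ) / m, fun v _ => by positivity, ?_, ?_⟩
    · rw [Finset.sum_subset (hsub t ht) fun v hv hvt => by simp [hcon v hv hvt], ← Finset.sum_div,
        ← Nat.cast_sum, h1, div_self hm']
    · rw [Finset.sum_subset (hsub t ht) fun v hv hvt => by simp [hcon v hv hvt], h3]
      exact (Finset.sum_subset (hsub s hs) fun v _ hvs => by simp [h5 v hvs]).symm
  obtain ⟨w, hw⟩ := exists_isBary hx
  rw [nodalBasis]
  split_ifs
  · refine Finset.prod_eq_zero hv (Finset.prod_eq_zero (i := 0) ?_ ?_)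
    · rw [h2, mul_div_cancel₀ _ hm', Nat.floor_natCast, Finset.mem_range]
      exact Nat.pos_of_ne_zero hα
    · rw [T.bary_eq ht hw, hw.zero v hvt]
      simp
  · rfl

end Mesh

namespace FEM

variable {d : ℕ} {Ω : Set (E d)} {V : Submodule ℝ (H1 Ω)} {m : ℕ} (D : FEM V m)

theorem val_eq_zero_of_mem_spanNodal (hm : 1 ≤ m) {Z : Finset (E d)} (hZ : Z ⊆ D.dofs) {w : D.S}
    (hw : w ∈ D.spanNodal Z) {y : E d} (hy : y ∈ D.dofs) (hyZ : y ∉ Z) : D.val w y = 0 := by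
  classical
  have hn : ∀ z ∈ D.dofs, z ∈ D.mesh.nodes m := fun z hz => (Finset.mem_filter.mp hz).1
  induction hw using Submodule.span_induction with
  | mem w hw =>
    obtain ⟨z, hz, h⟩ := hw
    rw [h, D.mesh.nodalBasis_node hm (hn z (hZ hz)) (hn y hy),
      if_neg (fun hzy : z = y => hyZ (hzy ▸ hz))]
  | zero => rfl
  | add a b _ _ ha hb =>
    have : D.val (a + b) y = D.val a y + D.val b y := rfl
    rw [this, ha, hb, add_zero]
  | smul c a _ ha =>
    have : D.val (c • a) y = c * D.val a y := rfl
    rw [this, ha, mul_zero]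

theorem projF_mem (hΩ : IsOpen Ω) (hm : 1 ≤ m) (u : D.S) :
    D.projF u ∈ D.spanNodal D.fineDofs ∧ D.projC u ∈ D.spanNodal D.coarseDofs := by
  have h : ∃ w ∈ D.spanNodal D.fineDofs, u - w ∈ D.spanNodal D.coarseDofs := by
    obtain ⟨w, hw, -⟩ := D.existsUnique_decomp hΩ hm u
    exact ⟨w, hw⟩
  rw [projC, projF, dif_pos h]
  exact h.choose_spec

open Classical in
/-- At the nodal points `Π_f` is multiplication by the indicator function of `Σ_f`. -/
theorem val_projF (hΩ : IsOpen Ω) (hm : 1 ≤ m) (u : D.S) {z : E d} (hz : z ∈ D.dofs) :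
    D.val (D.projF u) z = if z ∈ D.fineDofs then D.val u z else 0 := by
  obtain ⟨h1, h2⟩ := D.projF_mem hΩ hm u
  split_ifs with h
  · have h3 := D.val_eq_zero_of_mem_spanNodal hm Finset.sdiff_subset h2 hz
      fun hc => (Finset.mem_sdiff.mp hc).2 h
    have h4 : D.val (D.projC u) z = D.val u z - D.val (D.projF u) z := rfl
    rw [h4, sub_eq_zero] at h3
    exact h3.symm
  · exact D.val_eq_zero_of_mem_spanNodal hm (Finset.filter_subset _ _) h1 hz h

theorem ext_dofs (hΩ : IsOpen Ω) (hm : 1 ≤ m) {u v : D.S}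
    (h : ∀ z ∈ D.dofs, D.val u z = D.val v z) : u = v := by
  refine D.ext_val hΩ ?_
  rw [D.val_eq_sum hm u, D.val_eq_sum hm v]
  exact Finset.sum_congr rfl fun z hz => by rw [h z hz]

theorem val_projC_eq_zero (hΩ : IsOpen Ω) (hm : 1 ≤ m) (u : D.S) {t : Finset (E d)}
    (ht : t ∈ D.fine) {x : E d} (hx : x ∈ simplex t) : D.val (D.projC u) x = 0 := by
  classical
  have hn : ∀ z ∈ D.dofs, z ∈ D.mesh.nodes m := fun z hz => (Finset.mem_filter.mp hz).1
  have hf : D.fine ⊆ D.mesh.cells := Finset.sdiff_subset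
  rw [D.val_eq_sum hm (D.projC u), Finset.sum_apply]
  refine Finset.sum_eq_zero fun z hz => ?_
  rw [Pi.smul_apply, smul_eq_mul]
  by_cases h : z ∈ D.coarseDofs
  · have hz' : z ∉ simplex t := fun hzt => (Finset.mem_sdiff.mp h).2
      (Finset.mem_filter.mpr ⟨hz, D.mesh.simplex_subset_closure_region hf ht hzt⟩)
    rw [D.mesh.nodalBasis_eq_zero hm (hn z hz) (hf ht) hz' hx, mul_zero]
  · rw [D.val_eq_zero_of_mem_spanNodal hm Finset.sdiff_subset (D.projF_mem hΩ hm u).2 hz h,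
      zero_mul]

end FEM

/-- The weak partial derivative of a function vanishing on an open set vanishes there. -/
theorem IsWeakPartial.ae_eq_zero {d : ℕ} {Ω : Set (E d)} (hΩ : IsOpen Ω) {i : Fin d} {u g : L2 Ω}
    (h : IsWeakPartial Ω i u g) {U : Set (E d)} (hU : IsOpen U)
    (hu : ∀ᵐ x ∂(volume.restrict Ω), x ∈ U → u x = 0) :
    ∀ᵐ x ∂(volume.restrict Ω), x ∈ U → g x = 0 := by
  have hloc : LocallyIntegrableOn (fun x => g x) (U ∩ Ω) := by
    rw [locallyIntegrableOn_iff (hU.inter hΩ).isLocallyClosed]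
    intro K hK hKc
    have hf : IsFiniteMeasure ((volume.restrict Ω).restrict K) :=
      ⟨by
        rw [Measure.restrict_apply_univ]
        exact (Measure.restrict_apply_le _ _).trans_lt hKc.measure_lt_top⟩
    have h2 := ((Lp.memLp g).restrict K).integrable (by norm_num)
    rw [Measure.restrict_restrict_of_subset (hK.trans inter_subset_right)] at h2
    exact h2
  have key := (hU.inter hΩ).ae_eq_zero_of_integral_contDiff_smul_eq_zero hloc fun φ h1 h2 h3 => by
    have e1 := h φ h1 h2 (h3.trans inter_subset_right)
    have e2 : ∫ x in Ω, u x * fderiv ℝ φ x (EuclideanSpace.single i 1) = 0 := by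
      refine integral_eq_zero_of_ae ?_
      filter_upwards [hu] with x hx
      by_cases hxU : x ∈ U
      · rw [hx hxU, zero_mul]
        rfl
      · have : fderiv ℝ φ x = 0 := image_eq_zero_of_notMem_tsupport fun hh =>
          hxU (h3 (tsupport_fderiv_subset ℝ hh)).1
        rw [this]
        simp
    rw [e2, zero_eq_neg] at e1
    rw [← e1, ← setIntegral_eq_integral_of_forall_compl_eq_zero (s := Ω)]
    · exact integral_congr_ae (.of_forall fun x => by simp only [smul_eq_mul, mul_comm])
    · intro x hx
      rw [image_eq_zero_of_notMem_tsupport (fun hh => hx (h3 hh).2), zero_smul]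
  rw [ae_restrict_iff' hΩ.measurableSet]
  filter_upwards [key] with x hx hxΩ hxU
  exact hx ⟨hxU, hxΩ⟩

theorem norm_sq_eq_integral {d : ℕ} {Ω : Set (E d)} (u : L2 Ω) :
    ‖u‖ ^ 2 = ∫ x in Ω, u x ^ 2 := by
  rw [← real_inner_self_eq_norm_sq, L2.inner_def]
  refine integral_congr_ae (.of_forall fun x => ?_)
  simp only [real_inner_self_eq_norm_sq, Real.norm_eq_abs, sq_abs]

theorem H1.norm_sq_eq {d : ℕ} {Ω : Set (E d)} (w : H1 Ω) :
    ‖w‖ ^ 2 = ‖H1.toL2 w‖ ^ 2 + ∑ i, ‖H1.grad w i‖ ^ 2 := by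
  have h1 : ‖w‖ = ‖w.1‖ := rfl
  rw [h1, WithLp.prod_norm_sq_eq_of_L2, PiLp.norm_sq_eq_of_L2]
  rfl

theorem H1.norm_toL2_le {d : ℕ} {Ω : Set (E d)} (w : H1 Ω) : ‖H1.toL2 w‖ ≤ ‖w‖ := by
  refine le_of_sq_le_sq ?_ (norm_nonneg _)
  rw [H1.norm_sq_eq]
  exact le_add_of_nonneg_right (Finset.sum_nonneg fun i _ => sq_nonneg _)

/-- The restricted norm is the full norm if the function and its gradient vanish elsewhere. -/
theorem H1.normOn_eq {d : ℕ} {Ω : Set (E d)} {U : Set (E d)} (w : H1 Ω)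
    (h0 : ∀ᵐ x ∂(volume.restrict Ω), x ∉ U → H1.toL2 w x = 0)
    (h1 : ∀ i, ∀ᵐ x ∂(volume.restrict Ω), x ∉ U → H1.grad w i x = 0) :
    H1.normOn U w = ‖w‖ := by
  have e : ∀ u : L2 Ω, (∀ᵐ x ∂(volume.restrict Ω), x ∉ U → u x = 0) →
      ∫ x in U, (u x) ^ 2 ∂(volume.restrict Ω) = ‖u‖ ^ 2 := by
    intro u hu
    rw [norm_sq_eq_integral]
    refine setIntegral_eq_integral_of_ae_compl_eq_zero ?_
    filter_upwards [hu] with x hx hxU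
    rw [hx hxU]
    norm_num
  rw [H1.normOn, e _ h0, Finset.sum_congr rfl fun i _ => e _ (h1 i), ← H1.norm_sq_eq,
    Real.sqrt_sq (norm_nonneg _)]

namespace FEM

variable {d : ℕ} {Ω : Set (E d)} {V : Submodule ℝ (H1 Ω)} {m : ℕ} (D : FEM V m)

/-- Up to a null set, `Ω` consists of the coarse and the refined region. -/
theorem ae_mem_region (hΩ : IsOpen Ω) :
    ∀ᵐ x ∂(volume.restrict Ω), x ∉ region D.coarse → x ∈ region D.fine := by
  classical
  have h1 : ∀ᵐ x : E d, ∀ s ∈ D.mesh.cells, x ∉ frontier (simplex s) := by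
    refine (Filter.eventually_all_finset D.mesh.cells).mpr fun s _ => ?_
    exact measure_eq_zero_iff_ae_notMem.mp ((convex_convexHull ℝ _).addHaar_frontier volume)
  rw [ae_restrict_iff' hΩ.measurableSet]
  filter_upwards [h1] with x hx hxΩ hxc
  have h3 : x ∈ ⋃ s ∈ D.mesh.cells, convexHull ℝ (s : Set (E d)) := by
    rw [D.mesh.covers]
    exact subset_closure hxΩ
  obtain ⟨s, hs, hxs⟩ := mem_iUnion₂.mp h3
  have h4 : x ∈ interior (simplex s) := by
    by_contra hcon
    exact hx s hs ⟨subset_closure hxs, hcon⟩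
  by_cases hc : s ∈ D.coarse
  · exact absurd (Mesh.interior_simplex_subset_region hc h4) hxc
  · exact Mesh.interior_simplex_subset_region (Finset.mem_sdiff.mpr ⟨hs, hc⟩) h4

theorem toL2_ae_eq (u : D.S) : (D.toL2 u : E d → ℝ) =ᵐ[volume.restrict Ω] D.val u :=
  (Subtype.property (p := fun x => x ∈ D.mesh.galerkin V m) u).2

/-- The coarse part of a finite element function lives on the coarse region. -/
theorem normOn_projC (hΩ : IsOpen Ω) (hm : 1 ≤ m) (u : D.S) :
    H1.normOn (region D.coarse) (D.toV (D.projC u) : H1 Ω) = ‖D.toV (D.projC u)‖ := by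
  have h0 : ∀ᵐ x ∂(volume.restrict Ω), x ∈ region D.fine → D.toL2 (D.projC u) x = 0 := by
    filter_upwards [D.toL2_ae_eq (D.projC u)] with x hx hxf
    obtain ⟨t, ht, hxt⟩ := mem_iUnion₂.mp (interior_subset hxf)
    rw [hx, D.val_projC_eq_zero hΩ hm u ht hxt]
  have h1 : ∀ i, ∀ᵐ x ∂(volume.restrict Ω), x ∈ region D.fine →
      H1.grad (D.toV (D.projC u) : H1 Ω) i x = 0 :=
    fun i => IsWeakPartial.ae_eq_zero hΩ ((D.toV (D.projC u) : H1 Ω).2 i) isOpen_interior h0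
  have h2 := D.ae_mem_region hΩ
  refine H1.normOn_eq _ ?_ fun i => ?_
  · filter_upwards [h0, h2] with x hx hx2 hxc using hx (hx2 hxc)
  · filter_upwards [h1 i, h2] with x hx hx2 hxc using hx (hx2 hxc)

end FEM

/-! ### The finite element space with the mass-lumped scalar product -/

namespace FEM

variable {d : ℕ} {Ω : Set (E d)} {V : Submodule ℝ (H1 Ω)} {m : ℕ} (D : FEM V m)

theorem lumped_comm (u v : D.S) : D.lumped u v = D.lumped v u :=
  Finset.sum_congr rfl fun z _ => by ring

theorem lumped_add_left (u u' v : D.S) :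
    D.lumped (u + u') v = D.lumped u v + D.lumped u' v := by
  rw [lumped, lumped, lumped, ← Finset.sum_add_distrib]
  refine Finset.sum_congr rfl fun z _ => ?_
  rw [map_add, Pi.add_apply]
  ring

theorem lumped_smul_left (c : ℝ) (u v : D.S) : D.lumped (c • u) v = c * D.lumped u v := by
  rw [lumped, lumped, Finset.mul_sum]
  refine Finset.sum_congr rfl fun z _ => ?_
  rw [map_smul, Pi.smul_apply, smul_eq_mul]
  ring

theorem lumped_self_nonneg (u : D.S) : 0 ≤ D.lumped u u :=
  Finset.sum_nonneg fun z hz => by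
    have := D.weight_pos z hz
    have h2 := mul_self_nonneg (D.val u z)
    rw [mul_assoc]
    positivity

theorem eq_zero_of_lumped_self (hΩ : IsOpen Ω) (hm : 1 ≤ m) {u : D.S} (h : D.lumped u u = 0) :
    u = 0 := by
  refine D.ext_dofs hΩ hm fun z hz => ?_
  have h1 := (Finset.sum_eq_zero_iff_of_nonneg fun z hz => by
    have := D.weight_pos z hz
    have h2 := mul_self_nonneg (D.val u z)
    rw [mul_assoc]
    positivity).mp h z hz
  have h2 := (D.weight_pos z hz).ne'
  rw [mul_assoc] at h1
  simpa [h2] using h1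

instance innerCore [hΩ : Fact (IsOpen Ω)] [hm : Fact (1 ≤ m)] : InnerProductSpace.Core ℝ D.S where
  inner u v := D.lumped u v
  conj_inner_symm u v := D.lumped_comm v u
  re_inner_nonneg u := D.lumped_self_nonneg u
  add_left u u' v := D.lumped_add_left u u' v
  smul_left u v c := D.lumped_smul_left c u v
  definite _ h := D.eq_zero_of_lumped_self hΩ.out hm.out h

/-- The norm `‖·‖_𝒯` on `S`. -/
instance [Fact (IsOpen Ω)] [Fact (1 ≤ m)] : NormedAddCommGroup D.S :=
  (D.innerCore).toNormedAddCommGroup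

/-- The scalar product `(·, ·)_𝒯` on `S`. -/
instance [Fact (IsOpen Ω)] [Fact (1 ≤ m)] : InnerProductSpace ℝ D.S :=
  InnerProductSpace.ofCore (D.innerCore).toCore

instance [hΩ : Fact (IsOpen Ω)] [hm : Fact (1 ≤ m)] : FiniteDimensional ℝ D.S := by
  refine FiniteDimensional.of_injective
    ((LinearMap.funLeft ℝ ℝ (fun z : D.dofs => (z : E d))).comp D.val) fun u v h => ?_
  exact D.ext_dofs hΩ.out hm.out fun z hz => congrFun h ⟨z, hz⟩

theorem inner_eq [Fact (IsOpen Ω)] [Fact (1 ≤ m)] (u v : D.S) : inner ℝ u v = D.lumped u v := rfl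

/-- The embedding `S → L²(Ω)` as a linear map. -/
def toL2Lin : D.S →ₗ[ℝ] L2 Ω where
  toFun := D.toL2
  map_add' _ _ := rfl
  map_smul' _ _ := rfl

theorem toL2_add (u v : D.S) : D.toL2 (u + v) = D.toL2 u + D.toL2 v := rfl

theorem toL2_sub (u v : D.S) : D.toL2 (u - v) = D.toL2 u - D.toL2 v := rfl

theorem toL2_smul (c : ℝ) (u : D.S) : D.toL2 (c • u) = c • D.toL2 u := rfl

variable [hΩ : Fact (IsOpen Ω)] [hm : Fact (1 ≤ m)]

theorem lumped_repr (l : D.S →ₗ[ℝ] ℝ) (v : D.S) : D.lumped (D.repr l) v = l v := by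
  have h : ∃ u : D.S, ∀ v, D.lumped u v = l v :=
    (D.existsUnique_repr hΩ.out hm.out l).exists
  have e : D.repr l = h.choose := by rw [repr, dif_pos h]
  rw [e]
  exact h.choose_spec v

variable (a : V →ₗ[ℝ] V →ₗ[ℝ] ℝ)

/-- The bilinear form `a` on `S`. -/
def form : D.S →ₗ[ℝ] D.S →ₗ[ℝ] ℝ := a.compl₁₂ D.toV D.toV

theorem lumped_opA (u v : D.S) : D.lumped (D.opA a u) v = D.form a u v :=
  D.lumped_repr (D.form a u) v

theorem lumped_opA_comm (h : ∀ u v : D.S, D.form a u v = D.form a v u) (u v : D.S) :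
    D.lumped (D.opA a u) v = D.lumped u (D.opA a v) := by
  rw [D.lumped_comm u, lumped_opA, lumped_opA, h]

theorem ext_lumped {u v : D.S} (h : ∀ w, D.lumped u w = D.lumped v w) : u = v :=
  ext_inner_right ℝ h

/-- The stiffness operator `A^S` and the projection `Π_f` as operators on `S`. -/
def localOp (hsymm : ∀ u v : D.S, D.lumped (D.opA a u) v = D.lumped u (D.opA a v))
    (hpos : ∀ u : D.S, u ≠ 0 → 0 < D.lumped (D.opA a u) u) : LocalOp D.S where
  A :=
    { toFun := D.opA a
      map_add' := fun u v => D.ext_lumped fun w => by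
        simp only [lumped_add_left, lumped_opA, map_add, LinearMap.add_apply]
      map_smul' := fun c u => D.ext_lumped fun w => by
        simp only [lumped_smul_left, lumped_opA, map_smul,
          LinearMap.smul_apply, smul_eq_mul, RingHom.id_apply] }
  P :=
    { toFun := D.projF
      map_add' := fun u v => D.ext_dofs hΩ.out hm.out fun z hz => by
        rw [map_add, Pi.add_apply, D.val_projF hΩ.out hm.out _ hz, D.val_projF hΩ.out hm.out _ hz,
          D.val_projF hΩ.out hm.out _ hz, map_add, Pi.add_apply]
        split_ifs <;> simp
      map_smul' := fun c u => D.ext_dofs hΩ.out hm.out fun z hz => by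
        rw [map_smul, Pi.smul_apply, D.val_projF hΩ.out hm.out _ hz,
          D.val_projF hΩ.out hm.out _ hz, map_smul, Pi.smul_apply]
        split_ifs <;> simp }
  symm := hsymm
  proj_symm := fun u v => by
    change D.lumped (D.projF u) v = D.lumped u (D.projF v)
    refine Finset.sum_congr rfl fun z hz => ?_
    rw [D.val_projF hΩ.out hm.out _ hz, D.val_projF hΩ.out hm.out _ hz]
    split_ifs <;> simp
  proj_proj := fun u => D.ext_dofs hΩ.out hm.out fun z hz => by
    change D.val (D.projF (D.projF u)) z = D.val (D.projF u) z
    rw [D.val_projF hΩ.out hm.out _ hz, D.val_projF hΩ.out hm.out _ hz]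
    split_ifs <;> rfl
  pos := hpos

/-! ### Sampling the semi-discrete solution -/

theorem toL2_eq_sum (u : D.S) : D.toL2 u =
    ∑ i, D.lumped u (stdOrthonormalBasis ℝ D.S i) • D.toL2 (stdOrthonormalBasis ℝ D.S i) := by
  conv_lhs => rw [← (stdOrthonormalBasis ℝ D.S).sum_repr' u]
  have := map_sum D.toL2Lin
    (fun i => inner ℝ (stdOrthonormalBasis ℝ D.S i) u • stdOrthonormalBasis ℝ D.S i) Finset.univ
  refine Eq.trans this (Finset.sum_congr rfl fun i _ => ?_)
  rw [map_smul, inner_eq, lumped_comm]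
  rfl

theorem hasDerivWithinAt_toL2 {x : ℝ → D.S} {y : D.S} {I : Set ℝ} {t : ℝ}
    (h : ∀ w, HasDerivWithinAt (fun s => D.lumped (x s) w) (D.lumped y w) I t) :
    HasDerivWithinAt (fun s => D.toL2 (x s)) (D.toL2 y) I t := by
  rw [D.toL2_eq_sum y]
  simp_rw [fun s => D.toL2_eq_sum (x s)]
  exact HasDerivWithinAt.fun_sum fun i _ => (h _).smul_const _

theorem continuousOn_toL2 {x : ℝ → D.S} {I : Set ℝ}
    (h : ∀ w, ContinuousOn (fun s => D.lumped (x s) w) I) :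
    ContinuousOn (fun s => D.toL2 (x s)) I := by
  simp_rw [fun s => D.toL2_eq_sum (x s)]
  exact continuousOn_finsetSum _ fun i _ => (h _).smul continuousOn_const

/-- The acceleration `ü_S = f_S - A^S u_S`. -/
def accel (f : ℝ → L2 Ω) (uS : ℝ → D.S) (t : ℝ) : D.S := D.source f t - D.opA a (uS t)

variable {D a} {f : ℝ → L2 Ω} {T : ℝ} {U₀ V₀ : D.S} {uS vS : ℝ → D.S}

/-- A semi-discrete solution has the velocity `v_S` and the acceleration `f_S - A^S u_S`, also as a
function with values in `L²(Ω)`. -/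
theorem isMotion (hsymm : ∀ u v : D.S, D.lumped (D.opA a u) v = D.lumped u (D.opA a v))
    (hu : IsSemidiscrete D a f T U₀ V₀ uS vS)
    (hf : ContinuousOn (fun t => D.toL2 (D.source f t)) (Icc 0 T)) :
    IsMotion T (fun t => D.toL2 (uS t)) (fun t => D.toL2 (vS t))
      (fun t => D.toL2 (D.accel a f uS t)) where
  deriv t ht := D.hasDerivWithinAt_toL2 fun w => hu.vel w t ht
  vel_cont := D.continuousOn_toL2 hu.vel_cont
  vel_deriv t ht := by
    refine D.hasDerivWithinAt_toL2 fun w => ?_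
    refine (hu.wave w t (Ioo_subset_Ioc_self ht)).congr_deriv ?_
    change D.lumped (D.source f t) w - D.form a (uS t) w = _
    rw [← D.lumped_opA a]
    have e : D.lumped (D.accel a f uS t) w + D.lumped (D.opA a (uS t)) w =
        D.lumped (D.source f t) w := by
      rw [← lumped_add_left, accel, sub_add_cancel]
    linarith
  acc_cont := by
    refine hf.sub (D.continuousOn_toL2 fun w => ?_)
    simp_rw [hsymm]
    exact fun t ht => (hu.vel _ t ht).continuousWithinAt

end FEM

theorem errConst_nonneg {g cA b : ℝ} (hg : 0 ≤ g) (hb : 0 ≤ b) : 0 ≤ errConst g cA b := by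
  unfold errConst
  positivity

/-! ### The error of the fully discrete solutions -/

namespace FEM

variable {d : ℕ} {Ω : Set (E d)} {V : Submodule ℝ (H1 Ω)} {m : ℕ} {D : FEM V m}
  [hΩ : Fact (IsOpen Ω)] [hm : Fact (1 ≤ m)]
  {a : V →ₗ[ℝ] V →ₗ[ℝ] ℝ} {f : ℝ → L2 Ω} {T : ℝ} {U₀ V₀ : D.S} {uS vS : ℝ → D.S}
  (hsymm : ∀ u v : D.S, D.lumped (D.opA a u) v = D.lumped u (D.opA a v))
  (hpos : ∀ u : D.S, u ≠ 0 → 0 < D.lumped (D.opA a u) u)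
  {Ceq : ℝ} (hCeq : 0 < Ceq) (heq : ∀ u : D.S, ‖u‖ ≤ Ceq * ‖D.toL2 u‖)
  {s : Stepping} {N : ℕ} (hN : N * s.dt = T) (hT : 0 < T)

theorem isLocal_localStep (γ : ℕ → ℝ) (F : ℤ → D.S) (w u : D.S) :
    s.IsLocal (D.localOp a hsymm hpos) γ F w u (D.localStep a s.p s.ν s.dt γ F w u) where
  zero := rfl
  one := rfl
  add_two _ := rfl

section

variable (hu : IsMotion T (fun t => D.toL2 (uS t)) (fun t => D.toL2 (vS t))
    (fun t => D.toL2 (D.accel a f uS t)))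
  (hv0 : vS 0 = V₀)
  (hf : ContinuousOn (fun t => D.toL2 (D.source f t)) (Icc 0 T))
  {M : ℝ} (hMdef : M = regM T (fun t => D.toL2 (uS t)) (fun t => D.toL2 (D.source f t)))
  (hreg : MemWInfty T 5 (fun t => D.toL2 (uS t)))
  (hfreg : MemWInfty T 3 (fun t => D.toL2 (D.source f t)))

include hN in
omit hΩ hm in
theorem mul_dt_mem_Icc {n : ℕ} (hn : n ≤ N) : (n : ℝ) * s.dt ∈ Icc 0 T := by
  have h1 := s.dt_pos
  have h2 : (n : ℝ) ≤ N := by exact_mod_cast hn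
  exact ⟨by positivity, by rw [← hN]; exact mul_le_mul_of_nonneg_right h2 h1.le⟩

include hCeq heq hN hT hu hv0 hf hMdef hreg hfreg in
/-- The bounds for the time levels of `u_S` that the error analysis needs. They are proved in
`L²(Ω)`, where the regularity is assumed, and transferred to the norm `‖·‖_𝒯`. -/
theorem isSmooth :
    s.IsSmooth (D.localOp a hsymm hpos) N (Ceq * M) (fun n => uS (n * s.dt))
      (fun n => D.accel a f uS (n * s.dt)) (fun n => D.source f (n * s.dt)) V₀ := by
  have hdt := s.dt_pos
  have hmem : ∀ {n : ℕ}, n ≤ N → (n : ℝ) * s.dt ∈ Icc 0 T := fun hn => mul_dt_mem_Icc hN hn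
  have hM0 : 0 ≤ M := by rw [hMdef]; exact regM_nonneg
  have hac := hu.acc_cont
  obtain ⟨g0, a0, b0⟩ := hreg.solution_spec (f := fun t => D.toL2 (D.source f t)) (l := 0 + 2)
    (by norm_num) (by norm_num) (by norm_num)
  obtain ⟨g1, a1, b1⟩ := hreg.solution_spec (f := fun t => D.toL2 (D.source f t)) (l := 1 + 2)
    (by norm_num) (by norm_num) (by norm_num)
  obtain ⟨g2, a2, b2⟩ := hreg.solution_spec (f := fun t => D.toL2 (D.source f t)) (l := 2 + 2)
    (by norm_num) (by norm_num) (by norm_num)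
  obtain ⟨k0, c0, d0⟩ := hfreg.source_spec (u := fun t => D.toL2 (uS t)) (l := 0)
    (by norm_num) (by norm_num)
  obtain ⟨k1, c1, d1⟩ := hfreg.source_spec (u := fun t => D.toL2 (uS t)) (l := 1)
    (by norm_num) (by norm_num)
  obtain ⟨k2, c2, d2⟩ := hfreg.source_spec (u := fun t => D.toL2 (uS t)) (l := 2)
    (by norm_num) (by norm_num)
  rw [← hMdef] at b0 b1 b2 d0 d1 d2
  replace a0 := a0.of_motion hT hu
  replace a1 := a1.of_motion hT hu
  replace a2 := a2.of_motion hT hu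
  have lift : ∀ {u : D.S} {B : ℝ}, ‖D.toL2 u‖ ≤ B * M → ‖u‖ ≤ B * (Ceq * M) := by
    intro u B h
    refine (heq u).trans ((mul_le_mul_of_nonneg_left h hCeq.le).trans (le_of_eq ?_))
    ring
  have lift1 : ∀ {u : D.S}, ‖D.toL2 u‖ ≤ M → ‖u‖ ≤ Ceq * M := fun h =>
    (heq _).trans (mul_le_mul_of_nonneg_left h hCeq.le)
  have hstep : ∀ n : ℕ, ((n + 1 : ℕ) : ℝ) * s.dt = (n : ℝ) * s.dt + s.dt := fun n => by
    push_cast; ring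
  have hl : ∀ n : ℕ, ((n + 2 : ℕ) : ℝ) * s.dt = ((n + 1 : ℕ) : ℝ) * s.dt + s.dt := fun n => by
    push_cast; ring
  have hr : ∀ n : ℕ, (n : ℝ) * s.dt = ((n + 1 : ℕ) : ℝ) * s.dt - s.dt := fun n => by
    push_cast; ring
  have hlo : ∀ n : ℕ, 0 ≤ ((n + 1 : ℕ) : ℝ) * s.dt - s.dt := fun n => by
    rw [← hr]; positivity
  have hhi : ∀ {n : ℕ}, n + 1 < N → ((n + 1 : ℕ) : ℝ) * s.dt + s.dt ≤ T := fun {n} hn => by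
    rw [← hl]; exact (hmem hn).2
  have hone : 0 < N → s.dt ≤ T := fun h => by
    have := (hmem (n := 1) h).2
    rwa [Nat.cast_one, one_mul] at this
  have hat1 : ((1 : ℕ) : ℝ) * s.dt = s.dt := by rw [Nat.cast_one, one_mul]
  have hat0 : ((0 : ℕ) : ℝ) * s.dt = 0 := by rw [Nat.cast_zero, zero_mul]
  refine ⟨mul_nonneg hCeq.le hM0, fun n => rfl, fun n hn => ?_, fun h => ?_, fun n hn => ?_,
    fun h => ?_, fun n hn => ?_, fun n hn => ?_, fun h => ?_, fun n hn => ?_⟩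
  · refine lift ?_
    have := hu.norm_central_diff_le a2 b2 hdt.le (hlo n) (hhi hn)
    rw [← hl, ← hr] at this
    exact this
  · refine lift ?_
    have := hu.norm_taylor_le a1 b1 hdt.le (hone h)
    rw [hv0] at this
    simp only [hat0, hat1]
    exact this
  · exact lift1 (norm_le_of_isWeakTimeDeriv_zero hT hac a0 b0 (hmem hn))
  · refine lift ?_
    have := norm_sub_le_of_isWeakTimeDeriv_one hac a1 b1 le_rfl hdt.le (hone h)
    rw [sub_zero, mul_comm] at this
    simp only [hat0, hat1]
    exact this
  · refine lift ?_
    have := norm_second_diff_le hac a2 b2 hdt.le (hlo n) (hhi hn)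
    rw [← hl, ← hr, mul_comm M] at this
    exact this
  · exact lift1 (norm_le_of_isWeakTimeDeriv_zero hT hf c0 d0 (hmem hn))
  · refine lift ?_
    have := norm_sub_le_of_isWeakTimeDeriv_one hf c1 d1 le_rfl hdt.le (hone h)
    rw [sub_zero, mul_comm] at this
    simp only [hat0, hat1]
    exact this
  · refine lift ?_
    have := norm_second_diff_le hf c2 d2 hdt.le (hlo n) (hhi hn)
    rw [← hl, ← hr, mul_comm M] at this
    exact this

/-- The symmetric local samples of the source deviate from its value at the time-step by at most
`‖f‖`, `Δt ‖f'‖` and `Δt² ‖f''‖` (up to constants). -/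
theorem norm_sample_sub_le (hfreg : MemWInfty T 3 (fun t => D.toL2 (D.source f t)))
    (hf : ContinuousOn (fun t => D.toL2 (D.source f t)) (Icc 0 T)) {M : ℝ}
    (hMdef : M = regM T (fun t => D.toL2 (uS t)) (fun t => D.toL2 (D.source f t)))
    (hCeq : 0 < Ceq) (heq : ∀ u : D.S, ‖u‖ ≤ Ceq * ‖D.toL2 u‖)
    (hN : N * s.dt = T) (hT : 0 < T) {n : ℕ} (hn : n + 1 < N) {j : ℕ} (hj : j < s.p) :
    ∀ x : D.S, x = (1 / 2 : ℝ) • (D.source f (((n + 1 : ℕ) : ℝ) * s.dt + (j : ℤ) / s.p * s.dt) +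
      D.source f (((n + 1 : ℕ) : ℝ) * s.dt + ((-j : ℤ) : ℝ) / s.p * s.dt)) -
        D.source f (((n + 1 : ℕ) : ℝ) * s.dt) →
    ‖x‖ ≤ 2 * (Ceq * M) ∧ ‖x‖ ≤ s.dt * (Ceq * M) ∧ ‖x‖ ≤ s.dt ^ 2 * (Ceq * M) := by
  have hdt := s.dt_pos
  have hp := s.p_pos
  have hM0 : 0 ≤ M := by rw [hMdef]; exact regM_nonneg
  obtain ⟨k0, c0, d0⟩ := hfreg.source_spec (u := fun t => D.toL2 (uS t)) (l := 0)
    (by norm_num) (by norm_num)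
  obtain ⟨k1, c1, d1⟩ := hfreg.source_spec (u := fun t => D.toL2 (uS t)) (l := 1)
    (by norm_num) (by norm_num)
  obtain ⟨k2, c2, d2⟩ := hfreg.source_spec (u := fun t => D.toL2 (uS t)) (l := 2)
    (by norm_num) (by norm_num)
  rw [← hMdef] at d0 d1 d2
  set t : ℝ := ((n + 1 : ℕ) : ℝ) * s.dt with ht
  set r : ℝ := (j : ℝ) / s.p * s.dt with hr
  have hj' : (j : ℝ) ≤ s.p := by exact_mod_cast hj.le
  have hr0 : 0 ≤ r := by positivity
  have hr1 : r ≤ s.dt := by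
    rw [hr]
    exact mul_le_of_le_one_left hdt.le ((div_le_one hp).mpr hj')
  have hlo : 0 ≤ t - r := by
    have : t = (n : ℝ) * s.dt + s.dt := by rw [ht]; push_cast; ring
    have h2 : 0 ≤ (n : ℝ) * s.dt := by positivity
    linarith
  have hhi : t + r ≤ T := by
    have h1 := (mul_dt_mem_Icc hN (n := n + 2) hn).2
    have : ((n + 2 : ℕ) : ℝ) * s.dt = t + s.dt := by rw [ht]; push_cast; ring
    linarith
  intro x hx
  have ep : t + ((j : ℤ) : ℝ) / s.p * s.dt = t + r := by rw [hr, Int.cast_natCast]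
  have em : t + ((-j : ℤ) : ℝ) / s.p * s.dt = t - r := by
    rw [hr]; push_cast; ring
  rw [ep, em] at hx
  have h0 : ∀ y ∈ Icc 0 T, ‖D.toL2 (D.source f y)‖ ≤ M := fun y hy =>
    norm_le_of_isWeakTimeDeriv_zero hT hf c0 d0 hy
  have hx2 : D.toL2 x = (1 / 2 : ℝ) • (D.toL2 (D.source f (t + r)) -
      (2 : ℝ) • D.toL2 (D.source f t) + D.toL2 (D.source f (t - r))) := by
    rw [hx, toL2_sub, toL2_smul, toL2_add]
    module
  have hx1 : D.toL2 x = (1 / 2 : ℝ) • ((D.toL2 (D.source f (t + r)) - D.toL2 (D.source f t)) -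
      (D.toL2 (D.source f t) - D.toL2 (D.source f (t - r)))) := by
    rw [hx2]
    module
  have half : ‖(1 / 2 : ℝ)‖ = 1 / 2 := by rw [Real.norm_of_nonneg (by norm_num)]
  have lift : ∀ {B : ℝ}, ‖D.toL2 x‖ ≤ B * M → ‖x‖ ≤ B * (Ceq * M) := by
    intro B h
    refine (heq x).trans ((mul_le_mul_of_nonneg_left h hCeq.le).trans (le_of_eq ?_))
    ring
  refine ⟨lift ?_, lift ?_, lift ?_⟩
  · rw [hx1, norm_smul, half]
    have i1 := h0 (t + r) ⟨by linarith, hhi⟩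
    have i2 := h0 t ⟨by linarith, by linarith⟩
    have i3 := h0 (t - r) ⟨hlo, by linarith⟩
    have i4 := norm_sub_le (D.toL2 (D.source f (t + r))) (D.toL2 (D.source f t))
    have i5 := norm_sub_le (D.toL2 (D.source f t)) (D.toL2 (D.source f (t - r)))
    have i6 := norm_sub_le (D.toL2 (D.source f (t + r)) - D.toL2 (D.source f t))
      (D.toL2 (D.source f t) - D.toL2 (D.source f (t - r)))
    linarith
  · rw [hx1, norm_smul, half]
    have i1 := norm_sub_le_of_isWeakTimeDeriv_one hf c1 d1 (s := t) (t := t + r)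
      (by linarith) (by linarith) hhi
    have i2 := norm_sub_le_of_isWeakTimeDeriv_one hf c1 d1 (s := t - r) (t := t)
      hlo (by linarith) (by linarith)
    have i3 := norm_sub_le (D.toL2 (D.source f (t + r)) - D.toL2 (D.source f t))
      (D.toL2 (D.source f t) - D.toL2 (D.source f (t - r)))
    rw [add_sub_cancel_left] at i1
    rw [sub_sub_cancel] at i2
    have i4 := mul_le_mul_of_nonneg_left hr1 hM0
    linarith
  · rw [hx2, norm_smul, half]
    have i1 := norm_second_diff_le hf c2 d2 hr0 hlo hhi
    have i2 : M * r ^ 2 ≤ M * s.dt ^ 2 :=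
      mul_le_mul_of_nonneg_left (pow_le_pow_left₀ hr0 hr1 2) hM0
    have i3 := (norm_nonneg _).trans i1
    linarith

/-- The error of both schemes in `L²(Ω)`, under the stability bounds of the stiffness operator. -/
theorem norm_error_le {cA b : ℝ} (h : s.CFL (D.localOp a hsymm hpos) cA) (hb : s.dt ≤ b)
    (hle : ∀ u : D.S, ‖D.toL2 u‖ ≤ Ceq * ‖u‖) {n : ℕ} (hn : n < N)
    (hCeq : 0 < Ceq) (heq : ∀ u : D.S, ‖u‖ ≤ Ceq * ‖D.toL2 u‖)
    (hN : N * s.dt = T) (hT : 0 < T) (hu0 : uS 0 = U₀) (hv0 : vS 0 = V₀)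
    (hu : IsMotion T (fun t => D.toL2 (uS t)) (fun t => D.toL2 (vS t))
      (fun t => D.toL2 (D.accel a f uS t)))
    (hf : ContinuousOn (fun t => D.toL2 (D.source f t)) (Icc 0 T)) {M : ℝ}
    (hMdef : M = regM T (fun t => D.toL2 (uS t)) (fun t => D.toL2 (D.source f t)))
    (hreg : MemWInfty T 5 (fun t => D.toL2 (uS t)))
    (hfreg : MemWInfty T 3 (fun t => D.toL2 (D.source f t))) :
    ‖D.toL2 (uS ((n + 1 : ℕ) * s.dt)) - D.toL2 (D.ltsSolution a f s.p s.ν s.dt U₀ V₀ (n + 1))‖ ≤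
        Ceq ^ 2 * errConst s.gain cA b * s.dt ^ 2 * (1 + T) * M ∧
      ‖D.toL2 (uS ((n + 1 : ℕ) * s.dt)) -
          D.toL2 (D.splitLFCSolution a f s.p s.ν s.dt U₀ V₀ (n + 1))‖ ≤
        Ceq ^ 2 * errConst s.gain cA b * s.dt ^ 2 * (1 + T) * M := by
  have hs := isSmooth hsymm hpos hCeq heq hN hT hu hv0 hf hMdef hreg hfreg
  have hat0 : ((0 : ℕ) : ℝ) * s.dt = 0 := by rw [Nat.cast_zero, zero_mul]
  have h0 : uS (((0 : ℕ) : ℝ) * s.dt) = U₀ := by rw [hat0, hu0]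
  have lift : ∀ y : D.S, ‖uS ((n + 1 : ℕ) * s.dt) - y‖ ≤
      errConst s.gain cA b * s.dt ^ 2 * (1 + N * s.dt) * (Ceq * M) →
      ‖D.toL2 (uS ((n + 1 : ℕ) * s.dt)) - D.toL2 y‖ ≤
        Ceq ^ 2 * errConst s.gain cA b * s.dt ^ 2 * (1 + T) * M := by
    intro y hy
    rw [hN] at hy
    rw [← D.toL2_sub (uS _) y]
    refine (hle _).trans ((mul_le_mul_of_nonneg_left hy hCeq.le).trans (le_of_eq ?_))
    ring
  have e : ∀ n : ℕ, ((n + 1 : ℕ) : ℝ) = n + 1 := fun n => by push_cast; rfl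
  obtain ⟨F, hF⟩ : ∃ F : ℕ → ℤ → D.S, ∀ n k, F n k =
    D.source f ((n : ℝ) * s.dt + (k : ℝ) / s.p * s.dt) := ⟨_, fun _ _ => rfl⟩
  have hF' : ∀ n : ℕ, (fun k : ℤ => D.source f (((n : ℝ) + 1) * s.dt + (k : ℝ) / s.p * s.dt)) =
      F (n + 1) := fun n => funext fun k => by rw [hF, e]
  have hFs : ∀ n, n + 1 < N → ∀ j < s.p, ∀ x : D.S, x = (1 / 2 : ℝ) • (F (n + 1) j +
      F (n + 1) (-j)) - D.source f (((n + 1 : ℕ) : ℝ) * s.dt) →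
      ‖x‖ ≤ 2 * (Ceq * M) ∧ ‖x‖ ≤ s.dt * (Ceq * M) ∧ ‖x‖ ≤ s.dt ^ 2 * (Ceq * M) := by
    intro n hn j hj x hx
    rw [hF, hF] at hx
    exact norm_sample_sub_le hfreg hf hMdef hCeq heq hN hT hn hj x hx
  have start : ∀ (Pi : D.S → D.S) (γ : ℕ → ℝ),
      D.scheme a f s.p s.ν s.dt Pi γ U₀ V₀ 0 = uS (((0 : ℕ) : ℝ) * s.dt) := by
    intro Pi γ
    rw [h0, scheme]
  have first : ∀ (Pi : D.S → D.S) (γ : ℕ → ℝ), D.scheme a f s.p s.ν s.dt Pi γ U₀ V₀ 1 =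
      uS (((0 : ℕ) : ℝ) * s.dt) + s.dt • V₀ + (s.dt ^ 2 / 2) •
        (D.source f (((0 : ℕ) : ℝ) * s.dt) - D.opA a (uS (((0 : ℕ) : ℝ) * s.dt))) := by
    intro Pi γ
    rw [h0, hat0, scheme]
  have step : ∀ (Pi : D.S → D.S) (γ : ℕ → ℝ) (n : ℕ), ∃ z : ℕ → D.S,
      s.IsLocal (D.localOp a hsymm hpos) γ (F (n + 1))
        (Pi (D.source f (((n + 1 : ℕ) : ℝ) * s.dt)) -
          D.opA a (D.projC (D.scheme a f s.p s.ν s.dt Pi γ U₀ V₀ (n + 1))))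
        (D.scheme a f s.p s.ν s.dt Pi γ U₀ V₀ (n + 1)) z ∧
      D.scheme a f s.p s.ν s.dt Pi γ U₀ V₀ (n + 2) =
        -D.scheme a f s.p s.ν s.dt Pi γ U₀ V₀ n + (2 : ℝ) • z s.p := by
    intro Pi γ n
    refine ⟨_, isLocal_localStep hsymm hpos _ _ _ _, ?_⟩
    rw [scheme, hF', e]
  constructor
  · exact lift _ (h.norm_error_lts_le hb hs (start _ _) (first _ _)
      (fun n hn j hj => (hFs n hn j hj _ rfl).1) (fun n hn j hj => (hFs n hn j hj _ rfl).2.1)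
      (fun n hn j hj => (hFs n hn j hj _ rfl).2.2) (fun n _ => step D.projC (gam s.p s.ν) n) n hn)
  · exact lift _ (h.norm_error_split_le hb hs (start _ _) (first _ _)
      (fun n _ => step id (fun _ => 0) n) n hn)

end

end FEM

/-! ### The error estimate with constants from the inverse inequalities -/

namespace FEM

variable {d : ℕ} {Ω : Set (E d)} {V : Submodule ℝ (H1 Ω)} {m : ℕ} {D : FEM V m}
  [hΩ : Fact (IsOpen Ω)] [hm : Fact (1 ≤ m)] {a : V →ₗ[ℝ] V →ₗ[ℝ] ℝ}

/-- The stability bounds follow from the inverse inequalities and the CFL condition. The factor `4`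
there is `3 + 1 ≤ 3 + C_cont / c_coer`. -/
theorem cfl (hsymm : ∀ u v : D.S, D.lumped (D.opA a u) v = D.lumped u (D.opA a v))
    (hpos : ∀ u : D.S, u ≠ 0 → 0 < D.lumped (D.opA a u) u) {s : Stepping}
    {Ccont ccoer Ceq Cinv h : ℝ} (hccoer : 0 < ccoer) (hCeq : 0 < Ceq) (hcc : ccoer ≤ Ccont)
    (hh : 0 < h)
    (hcoer : ∀ u : D.S, ccoer * ‖D.toL2 u‖ ^ 2 ≤ D.lumped (D.opA a u) u)
    (hle : ∀ u : D.S, ‖u‖ ≤ Ceq * ‖D.toL2 u‖)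
    (hall : ∀ u : D.S, D.lumped (D.opA a u) u ≤ Ccont * (Cinv * (s.p / h) * ‖u‖) ^ 2)
    (hcoarse : ∀ u : D.S, D.lumped (D.opA a (D.projC u)) (D.projC u) ≤
      Ccont * (Cinv * h⁻¹ * ‖D.projC u‖) ^ 2)
    (hcfl : (3 + Ccont / ccoer) * Ccont * Cinv ^ 2 * (s.dt / h) ^ 2 ≤ s.gain) :
    s.CFL (D.localOp a hsymm hpos) (ccoer / Ceq ^ 2) := by
  have hdt := s.dt_pos
  have hC : 0 < Ccont := hccoer.trans_le hcc
  have h1 : 1 ≤ Ccont / ccoer := (one_le_div hccoer).mpr hcc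
  have h2 : Ccont * (Cinv ^ 2 * (1 / h) ^ 2) ≤ s.gain / (4 * s.dt ^ 2) := by
    rw [le_div_iff₀ (by positivity)]
    refine le_trans ?_ hcfl
    have h3 : Ccont * (Cinv ^ 2 * (1 / h) ^ 2) * (4 * s.dt ^ 2) =
        4 * (Ccont * Cinv ^ 2 * (s.dt / h) ^ 2) := by
      field_simp
    have h4 : (3 + Ccont / ccoer) * Ccont * Cinv ^ 2 * (s.dt / h) ^ 2 =
        (3 + Ccont / ccoer) * (Ccont * Cinv ^ 2 * (s.dt / h) ^ 2) := by ring
    rw [h3, h4]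
    exact mul_le_mul_of_nonneg_right (by linarith) (by positivity)
  refine ⟨by positivity, fun v => ?_, fun v => ?_, fun v => ?_⟩
  · refine le_trans ?_ (hcoer v)
    have h3 : ‖v‖ ^ 2 ≤ (Ceq * ‖D.toL2 v‖) ^ 2 := pow_le_pow_left₀ (norm_nonneg _) (hle v) 2
    have h4 : ccoer / Ceq ^ 2 * (Ceq * ‖D.toL2 v‖) ^ 2 = ccoer * ‖D.toL2 v‖ ^ 2 := by
      field_simp
    rw [← h4]
    exact mul_le_mul_of_nonneg_left h3 (by positivity)
  · refine (hall v).trans ?_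
    have h3 : Ccont * (Cinv * (s.p / h) * ‖v‖) ^ 2 =
        Ccont * (Cinv ^ 2 * (1 / h) ^ 2) * ((s.p : ℝ) ^ 2 * ‖v‖ ^ 2) := by ring
    have h4 : (s.p : ℝ) ^ 2 * s.gain / (4 * s.dt ^ 2) * ‖v‖ ^ 2 =
        s.gain / (4 * s.dt ^ 2) * ((s.p : ℝ) ^ 2 * ‖v‖ ^ 2) := by ring
    rw [h3, h4]
    exact mul_le_mul_of_nonneg_right h2 (by positivity)
  · refine (hcoarse v).trans ?_
    have h3 : Ccont * (Cinv * h⁻¹ * ‖D.projC v‖) ^ 2 =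
        Ccont * (Cinv ^ 2 * (1 / h) ^ 2) * ‖D.projC v‖ ^ 2 := by
      rw [one_div]; ring
    rw [h3]
    exact mul_le_mul_of_nonneg_right h2 (by positivity)

/-- The constant of the error estimate. Its last argument bounds `Δt`, by the CFL condition and
`h ≤ h₀`. -/
def boundConst (Ccont ccoer ν h₀ Ceq Cinv : ℝ) : ℝ :=
  Ceq ^ 2 * errConst (ν / (1 + ν)) (ccoer / Ceq ^ 2)
    √(ν / (1 + ν) * h₀ ^ 2 / ((3 + Ccont / ccoer) * Ccont * Cinv ^ 2))

/-- The error estimate, with the semi-discrete solution entering only as a motion in `L²(Ω)`. For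
`S ≠ 0` the inverse inequalities and the CFL condition imply `h > 0`, `C_inv ≠ 0` and `ν > 0`; the
case `ν = 0` occurs only for `S = 0`. -/
theorem norm_error_le_boundConst {Ccont ccoer ν h₀ Ceq Cinv : ℝ} (hccoer : 0 < ccoer)
    (hν : 0 ≤ ν) (hν' : ν ≤ 1 / 2) (hCeq : 0 < Ceq) {f : ℝ → L2 Ω} {p N : ℕ} {T : ℝ}
    {U₀ V₀ : D.S} {uS vS : ℝ → D.S}
    (hsymm : ∀ u v : D.S, D.lumped (D.opA a u) v = D.lumped u (D.opA a v))
    (hupper : ∀ u : D.S, D.lumped (D.opA a u) u ≤ Ccont * ‖D.toV u‖ ^ 2)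
    (hlower : ∀ u : D.S, ccoer * ‖D.toV u‖ ^ 2 ≤ D.lumped (D.opA a u) u)
    (hp : 1 ≤ p) (hN : 1 ≤ N) (hT : 0 < T) (hh : D.h ≤ h₀)
    (heq : ∀ u : D.S, Ceq⁻¹ * D.lumpedNorm u ≤ ‖D.toL2 u‖ ∧ ‖D.toL2 u‖ ≤ Ceq * D.lumpedNorm u)
    (hinvc : ∀ u : D.S, H1.normOn (region D.coarse) (D.toV u : H1 Ω) ≤
      Cinv * D.h⁻¹ * D.lumpedNorm u)
    (hinv : ∀ u : D.S, ‖D.toV u‖ ≤ Cinv * (p / D.h) * D.lumpedNorm u)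
    (hcfl : (3 + Ccont / ccoer) * Ccont * Cinv ^ 2 * (T / N / D.h) ^ 2 ≤ ν / (ν + 1))
    (hu0 : uS 0 = U₀) (hv0 : vS 0 = V₀)
    (hu : IsMotion T (fun t => D.toL2 (uS t)) (fun t => D.toL2 (vS t))
      (fun t => D.toL2 (D.accel a f uS t)))
    (hreg : MemWInfty T 5 (fun t => D.toL2 (uS t)))
    (hfreg : MemWInfty T 3 (fun t => D.toL2 (D.source f t)))
    (hf : ContinuousOn (fun t => D.toL2 (D.source f t)) (Icc 0 T)) {n : ℕ} (hn : n < N) :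
    ‖D.toL2 (uS ((n + 1 : ℕ) * (T / N))) -
        D.toL2 (D.ltsSolution a f p ν (T / N) U₀ V₀ (n + 1))‖ ≤
      boundConst Ccont ccoer ν h₀ Ceq Cinv * (T / N) ^ 2 * (1 + T) *
        regM T (fun t => D.toL2 (uS t)) (fun t => D.toL2 (D.source f t)) ∧
    ‖D.toL2 (uS ((n + 1 : ℕ) * (T / N))) -
        D.toL2 (D.splitLFCSolution a f p ν (T / N) U₀ V₀ (n + 1))‖ ≤
      boundConst Ccont ccoer ν h₀ Ceq Cinv * (T / N) ^ 2 * (1 + T) *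
        regM T (fun t => D.toL2 (uS t)) (fun t => D.toL2 (D.source f t)) := by
  have hg0 : 0 ≤ ν / (1 + ν) := by positivity
  have hC0 : 0 ≤ boundConst Ccont ccoer ν h₀ Ceq Cinv :=
    mul_nonneg (by positivity) (errConst_nonneg hg0 (Real.sqrt_nonneg _))
  have hM0 : 0 ≤ regM T (fun t => D.toL2 (uS t)) (fun t => D.toL2 (D.source f t)) := regM_nonneg
  have hN0 : (0 : ℝ) < N := by exact_mod_cast hN
  have hh0 : 0 ≤ D.h := Real.sSup_nonneg (by
    rintro _ ⟨s, -, rfl⟩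
    exact Metric.diam_nonneg)
  by_cases htriv : ∀ u : D.S, u = 0
  · -- If `S = 0`, there is no error at all.
    have e : ∀ u v : D.S, ‖D.toL2 u - D.toL2 v‖ = 0 := fun u v => by
      rw [htriv u, htriv v, sub_self, norm_zero]
    exact ⟨(e _ _).trans_le (by positivity), (e _ _).trans_le (by positivity)⟩
  push Not at htriv
  obtain ⟨u₀, hu₀⟩ := htriv
  have hle : ∀ u : D.S, ‖u‖ ≤ Ceq * ‖D.toL2 u‖ := fun u => by
    have := (heq u).1
    rwa [inv_mul_le_iff₀ hCeq] at this
  have hL2 : ∀ u : D.S, ‖D.toL2 u‖ ≤ ‖D.toV u‖ := fun u => H1.norm_toL2_le _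
  have hVpos : ∀ u : D.S, u ≠ 0 → 0 < ‖D.toV u‖ := fun u hu => by
    have h1 : 0 < ‖u‖ := norm_pos_iff.mpr hu
    have h2 := h1.trans_le (hle u)
    exact (pos_of_mul_pos_right h2 hCeq.le).trans_le (hL2 u)
  have hpos : ∀ u : D.S, u ≠ 0 → 0 < D.lumped (D.opA a u) u := fun u hu => by
    have := hVpos u hu
    exact lt_of_lt_of_le (by positivity) (hlower _)
  -- The nonzero element `u₀` excludes the degenerate values of the constants.
  have hV0 := hVpos u₀ hu₀
  have hcc : ccoer ≤ Ccont :=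
    le_of_mul_le_mul_right ((hlower u₀).trans (hupper u₀)) (by positivity)
  have hCc : 0 < Ccont := hccoer.trans_le hcc
  have hprod : 0 < Cinv * (p / D.h) * D.lumpedNorm u₀ := hV0.trans_le (hinv u₀)
  have hCinv : Cinv ≠ 0 := by
    rintro rfl
    simp at hprod
  have hhne : D.h ≠ 0 := by
    intro h0
    rw [h0] at hprod
    simp at hprod
  have hhpos : 0 < D.h := lt_of_le_of_ne hh0 hhne.symm
  have hdt : 0 < T / N := by positivity
  have hXpos : 0 < (3 + Ccont / ccoer) * Ccont * Cinv ^ 2 := by positivity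
  rw [add_comm ν 1] at hcfl
  have hgpos : 0 < ν / (1 + ν) := lt_of_lt_of_le (by positivity) hcfl
  have hνpos : 0 < ν := by
    rcases hν.eq_or_lt with h0 | h0
    · rw [← h0, zero_div] at hgpos
      exact absurd hgpos (lt_irrefl _)
    · exact h0
  let s : Stepping := ⟨p, ν, T / N, by omega, hνpos, hν', hdt⟩
  have hbdt : s.dt ≤ √(ν / (1 + ν) * h₀ ^ 2 / ((3 + Ccont / ccoer) * Ccont * Cinv ^ 2)) := by
    refine Real.le_sqrt_of_sq_le ?_
    rw [le_div_iff₀ hXpos]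
    have e : (T / N) ^ 2 * ((3 + Ccont / ccoer) * Ccont * Cinv ^ 2) =
        (3 + Ccont / ccoer) * Ccont * Cinv ^ 2 * (T / N / D.h) ^ 2 * D.h ^ 2 := by
      rw [mul_assoc _ ((T / N / D.h) ^ 2), div_pow (T / N) D.h,
        div_mul_cancel₀ _ (pow_ne_zero 2 hhne), mul_comm]
    exact e.trans_le (mul_le_mul hcfl (pow_le_pow_left₀ hh0 hh 2) (by positivity) hg0)
  have hCFL : s.CFL (D.localOp a hsymm hpos) (ccoer / Ceq ^ 2) := by
    refine FEM.cfl hsymm hpos hccoer hCeq hcc hhpos (fun u => ?_) hle (fun u => ?_) (fun u => ?_)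
      hcfl
    · exact (mul_le_mul_of_nonneg_left (pow_le_pow_left₀ (norm_nonneg _) (hL2 u) 2)
        hccoer.le).trans (hlower u)
    · exact (hupper u).trans (mul_le_mul_of_nonneg_left
        (pow_le_pow_left₀ (norm_nonneg _) (hinv u) 2) hCc.le)
    · have h1 := hinvc (D.projC u)
      rw [D.normOn_projC hΩ.out hm.out] at h1
      exact (hupper _).trans (mul_le_mul_of_nonneg_left
        (pow_le_pow_left₀ (norm_nonneg _) h1 2) hCc.le)
  exact norm_error_le hsymm hpos hCFL hbdt (fun u => (heq u).2) hn hCeq hle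
    (mul_div_cancel₀ T hN0.ne') hT hu0 hv0 hu hf rfl hreg hfreg

end FEM

end LFLTS

end

open LFLTS in
theorem theorem3p6 {d : ℕ} (hd : 1 ≤ d) {Ω : Set (E d)} (hΩ_open : IsOpen Ω)
    (hΩ_conn : IsConnected Ω) (hΩ_bdd : Bornology.IsBounded Ω)
    -- the closed subspace `V` of `H¹(Ω)` and the bilinear form
    (V : Submodule ℝ (H1 Ω)) (hV : IsClosed (V : Set (H1 Ω)))
    (a : V →ₗ[ℝ] V →ₗ[ℝ] ℝ) (Ccont ccoer : ℝ) (hccoer : 0 < ccoer)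
    (ha_symm : ∀ u v : V, a u v = a v u)
    (ha_cont : ∀ u v : V, |a u v| ≤ Ccont * ‖u‖ * ‖v‖)
    (ha_coer : ∀ u : V, ccoer * ‖u‖ ^ 2 ≤ a u u)
    -- polynomial degree, stabilization parameter and the constants of the discretization
    (m : ℕ) (hm : 1 ≤ m) (ν : ℝ) (hν : 0 ≤ ν) (hν' : ν ≤ 1 / 2)
    (h₀ Ceq Cinv Cqu : ℝ) (hCeq : 0 < Ceq) :
    ∃ C : ℝ, ∀ (D : FEM V m) (p N : ℕ) (T : ℝ) (f : ℝ → L2 Ω) (U₀ V₀ : D.S) (uS vS : ℝ → D.S),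
      2 ≤ p → 1 ≤ N → 0 < T →
      D.h ≤ h₀ →
      -- equivalence of the lumped norm and the `L²` norm
      (∀ u : D.S, Ceq⁻¹ * D.lumpedNorm u ≤ ‖D.toL2 u‖ ∧
        ‖D.toL2 u‖ ≤ Ceq * D.lumpedNorm u) →
      -- quasi-uniformity of the coarse mesh and local refinement ratio
      (∀ s ∈ D.coarse, D.h ≤ Cqu * Metric.diam (simplex s)) →
      (∀ s ∈ D.mesh.cells, D.h / Metric.diam (simplex s) ≤ Cqu * p) →
      -- `Cinv` is a constant in the inverse inequalities
      (∀ u : D.S, H1.normOn (region D.coarse) (D.toV u : H1 Ω) ≤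
        Cinv * D.h⁻¹ * D.lumpedNorm u) →
      (∀ u : D.S, ‖D.toV u‖ ≤ Cinv * (p / D.h) * D.lumpedNorm u) →
      -- CFL condition, with `Δt = T / N`
      (3 + Ccont / ccoer) * Ccont * Cinv ^ 2 * (T / N / D.h) ^ 2 ≤ ν / (ν + 1) →
      -- the semi-discrete solution and its regularity
      IsSemidiscrete D a f T U₀ V₀ uS vS →
      MemWInfty T 5 (fun t => D.toL2 (uS t)) →
      MemWInfty T 3 (fun t => D.toL2 (D.source f t)) →
      ContinuousOn (fun t => D.toL2 (D.source f t)) (Icc 0 T) →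
      ∀ n : ℕ, n + 1 ≤ N →
        ‖D.toL2 (uS ((n + 1 : ℕ) * (T / N))) -
            D.toL2 (D.ltsSolution a f p ν (T / N) U₀ V₀ (n + 1))‖ ≤
          C * (T / N) ^ 2 * (1 + T) *
            regM T (fun t => D.toL2 (uS t)) (fun t => D.toL2 (D.source f t)) ∧
        ‖D.toL2 (uS ((n + 1 : ℕ) * (T / N))) -
            D.toL2 (D.splitLFCSolution a f p ν (T / N) U₀ V₀ (n + 1))‖ ≤
          C * (T / N) ^ 2 * (1 + T) *
            regM T (fun t => D.toL2 (uS t)) (fun t => D.toL2 (D.source f t)) := by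
  have : Fact (IsOpen Ω) := ⟨hΩ_open⟩
  have : Fact (1 ≤ m) := ⟨hm⟩
  refine ⟨FEM.boundConst Ccont ccoer ν h₀ Ceq Cinv, ?_⟩
  intro D p N T f U₀ V₀ uS vS hp hN hT hh heq _ _ hinvc hinv hcfl hu hreg hfreg hf n hn
  have hself : ∀ u : D.S, D.lumped (D.opA a u) u = a (D.toV u) (D.toV u) := fun u =>
    D.lumped_opA a u u
  have hsymm := D.lumped_opA_comm a fun u v => ha_symm (D.toV u) (D.toV v)
  refine FEM.norm_error_le_boundConst hccoer hν hν' hCeq hsymm (fun u => ?_) (fun u => ?_)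
    (one_le_two.trans hp) hN hT hh heq hinvc hinv hcfl hu.init hu.init_vel
    (FEM.isMotion hsymm hu hf) hreg hfreg hf hn
  · refine (hself u).trans_le ((le_abs_self _).trans ((ha_cont _ _).trans (le_of_eq ?_)))
    ring
  · exact (ha_coer _).trans_eq (hself u).symm
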